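/- Let $\mathrm{Cob}^m_n$ be Bar-Natan's graded category whose objects are formal shifts $q^k T$ of crossingless planar diagrams $T$ in a rectangle with $m$ end points on the top and $n$ on the bottom, and whose morphisms are $\mathbb{Z}[\alpha]$-linear combinations of dotted cobordisms up to isotopy rel boundary, modulo the local relations: spheres with $0,1,2,3$ dots equal $0,1,0,\alpha$, respectively; a neck is the sum of the two ways of cutting it into two disks and putting a dot on one of them; a handle on a sheet is twice a dot. (A dot has degree $2$, $\alpha$ has degree $4$, and a cobordism $S$ from $q^kT$ to $q^lT'$ has degree $l-k-\chi(S)+(m+n)/2$, plus $2$ for each dot.) Let $\mathrm{BN}^m_n$ be its closure under finite direct sums, let $\otimes$ denote vertical stacking of diagrams, cobordisms and chain complexes, and let $1_n$ be the diagram of $n$ vertical strands. For every $n\ge 0$ fix a universal projector $P_n$: a chain complex over $\mathrm{BN}^n_n$ with differential of homological degree $+1$ and $q$-degree $0$, concentrated in non-positive homological degrees, with $1_n$ in homological degree $0$ and no shift of $1_n$ as a direct summand of any other chain object, such that $P_n$ kills turnbacks: stacking the diagram with a single cap and $n-2$ vertical strands on top of $P_n$, or the diagram with a single cup and $n-2$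 vertical strands below $P_n$, gives a contractible complex, for every position of the cap or cup. Call a triple $(a,b,c)$ of non-negative integers admissible if $a+b+c$ is even and each of the three is at most the sum of the other two. If $(a,b,i)$ and $(c,d,i)$ are admissible, let $I_i=I_i(a,b;c,d)$ be the categorified spin network in the shape of the letter I: the chain complex over $\mathrm{BN}^{a+b}_{c+d}$ obtained by planar composition of $P_a$ and $P_b$ (side by side, on the top), $P_i$ (on the middle edge), $P_c$ and $P_d$ (side by side, on the bottom), connected by the unique crossingless families of strands at the two trivalent vertices (without turnbacks at any of the projectors). For chain complexes $A,B$ let $\mathrm{Hom}^\bullet(A,B)$ be the bigraded complex of homogeneous maps of all bidegrees, with differential $f\mapsto d_B f-(-1)^{|f|}f d_A$, where $|f|$ is the homological degree. **Proposition.** Let $a,b,c,d,i,j\ge 0$ be such that $(a,b,i)$, $(c,d,i)$, $(a,b,j)$, $(c,d,j)$ are admissible. If $j<i$, then $\mathrm{Hom}^\bullet(I_j,I_i)$ is contractible as a complex of graded abelian groups; that is, for every quantum degree the complex formed by the maps of that quantum degree is contractible. -/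

import Mathlib

open CategoryTheory Limits

noncomputable section

namespace BarNatan

/-! ### Planar diagrams -/

/-- The elementary pieces of a crossingless planar diagram in general position with respect to
the height function, read from the top to the bottom.  `cap i` is an arc with a local maximum:
it creates two new strands in positions `i` and `i + 1` (positions are counted from `0`, from the
left).  `cup i` is an arc with a local minimum: it joins the strands in positions `i` and
`i + 1`. -/
inductive Arc : Type
  | cap (i : ℕ)
  | cup (i : ℕ)

/-- `Goes w m n`: the word `w`, read downwards, is a diagram with `m` end points on the top and
`n` end points on the bottom. -/
def Goes : List Arc → ℕ → ℕ → Prop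
  | [], m, n => m = n
  | .cap i :: w, m, n => i ≤ m ∧ Goes w (m + 2) n
  | .cup i :: w, m, n => i + 2 ≤ m ∧ Goes w (m - 2) n

/-- Crossingless planar diagrams (properly embedded `1`-submanifolds of the square, closed
components allowed) with `m` end points on the top and `n` on the bottom. -/
@[ext]
structure Diag (m n : ℕ) where
  word : List Arc
  goes : Goes word m n

theorem Goes.append {u v : List Arc} {l m n : ℕ} (hu : Goes u l m) (hv : Goes v m n) :
    Goes (u ++ v) l n := by
  induction u generalizing l with
  | nil => cases hu; exact hv
  | cons c u ih => cases c with
    | cap i => exact ⟨hu.1, ih hu.2⟩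
    | cup i => exact ⟨hu.1, ih hu.2⟩

/-- The effect of adding `k` vertical strands on the left of a piece. -/
def Arc.shift (k : ℕ) : Arc → Arc
  | .cap i => .cap (k + i)
  | .cup i => .cup (k + i)

theorem Goes.shift (k : ℕ) {w : List Arc} {m n : ℕ} (h : Goes w m n) :
    Goes (w.map (Arc.shift k)) (k + m) (k + n) := by
  induction w generalizing m with
  | nil => exact congrArg (k + ·) h
  | cons c w ih => cases c with
    | cap i => exact ⟨by have := h.1; omega, ih h.2⟩
    | cup i =>
      refine ⟨by have := h.1; omega, ?_⟩
      have h1 := h.1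
      rw [show k + m - 2 = k + (m - 2) by omega]
      exact ih h.2

theorem Goes.addRight (k : ℕ) {w : List Arc} {m n : ℕ} (h : Goes w m n) :
    Goes w (m + k) (n + k) := by
  induction w generalizing m with
  | nil => exact congrArg (· + k) h
  | cons c w ih => cases c with
    | cap i =>
      refine ⟨by have := h.1; omega, ?_⟩
      rw [show m + k + 2 = m + 2 + k by omega]
      exact ih h.2
    | cup i =>
      refine ⟨by have := h.1; omega, ?_⟩
      have h1 := h.1
      rw [show m + k - 2 = m - 2 + k by omega]
      exact ih h.2

namespace Diag

/-- The diagram `1_n` consisting of `n` vertical strands. -/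
def one (n : ℕ) : Diag n n := ⟨[], rfl⟩

/-- Vertical stacking, `a` on top of `b`. -/
def stack {l m n : ℕ} (a : Diag l m) (b : Diag m n) : Diag l n :=
  ⟨a.word ++ b.word, a.goes.append b.goes⟩

/-- `k` vertical strands to the left of `a`. -/
def padL (k : ℕ) {m n : ℕ} (a : Diag m n) : Diag (k + m) (k + n) :=
  ⟨a.word.map (Arc.shift k), a.goes.shift k⟩

/-- `k` vertical strands to the right of `a`. -/
def padR (k : ℕ) {m n : ℕ} (a : Diag m n) : Diag (m + k) (n + k) :=
  ⟨a.word, a.goes.addRight k⟩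

/-- The turnback `i` strands, a cap, `n - i - 2` strands. -/
def capTurn (n i : ℕ) (h : i + 2 ≤ n) : Diag (n - 2) n :=
  ⟨[.cap i], ⟨by omega, show n - 2 + 2 = n by omega⟩⟩

/-- The turnback `i` strands, a cup, `n - i - 2` strands. -/
def cupTurn (n i : ℕ) (h : i + 2 ≤ n) : Diag n (n - 2) :=
  ⟨[.cup i], ⟨h, rfl⟩⟩

end Diag

/-! ### Elementary cobordisms -/

/-- The elementary planar isotopies between words: straightening a zigzag, and exchanging the
heights of two distant pieces. -/
inductive IsotopyStep : List Arc → List Arc → Prop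
  | zigzagL (i : ℕ) : IsotopyStep [.cap i, .cup (i + 1)] []
  | zigzagR (i : ℕ) : IsotopyStep [.cap (i + 1), .cup i] []
  | capCap (i j : ℕ) : i ≤ j → IsotopyStep [.cap i, .cap (j + 2)] [.cap j, .cap i]
  | capCup (i j : ℕ) : i ≤ j → IsotopyStep [.cap i, .cup (j + 2)] [.cup j, .cap i]
  | cupCap (i j : ℕ) : i ≤ j → IsotopyStep [.cup i, .cap j] [.cap (j + 2), .cup i]
  | cupCup (i j : ℕ) : i ≤ j → IsotopyStep [.cup i, .cup j] [.cup (j + 2), .cup i]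

/-- The elementary events in a movie of planar diagrams: birth and death of a circle, the two
saddles, a dot on the strand in position `i`, and planar isotopies. -/
inductive Event : Type
  | birth (i : ℕ)
  | death (i : ℕ)
  | saddle (i : ℕ)
  | cosaddle (i : ℕ)
  | dot (i : ℕ)
  | isotopy (l r : List Arc) (h : IsotopyStep l r ∨ IsotopyStep r l)

namespace Event

/-- The piece of a diagram before the event. -/
def src : Event → List Arc
  | birth _ => []
  | death i => [.cap i, .cup i]
  | saddle i => [.cup i, .cap i]
  | cosaddle _ => []
  | dot _ => []
  | isotopy l _ _ => l

/-- The piece of a diagram after the event. -/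
def tgt : Event → List Arc
  | birth i => [.cap i, .cup i]
  | death _ => []
  | saddle _ => []
  | cosaddle i => [.cup i, .cap i]
  | dot _ => []
  | isotopy _ r _ => r

/-- The event can take place at a level which meets `k` strands. -/
def Valid (k : ℕ) : Event → Prop
  | birth i => i ≤ k
  | death i => i ≤ k
  | saddle i => i + 2 ≤ k
  | cosaddle i => i + 2 ≤ k
  | dot i => i < k
  | isotopy _ _ _ => True

/-- The `q`-degree: minus the Euler characteristic of the cobordism relative to its source, plus
`2` for a dot. -/
def degree : Event → ℤ
  | birth _ => -1
  | death _ => -1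
  | saddle _ => 1
  | cosaddle _ => 1
  | dot _ => 2
  | isotopy _ _ _ => 0

/-- The effect of `k` additional strands on the left. -/
def shift (k : ℕ) : Event → Event
  | birth i => birth (k + i)
  | death i => death (k + i)
  | saddle i => saddle (k + i)
  | cosaddle i => cosaddle (k + i)
  | dot i => dot (k + i)
  | isotopy l r h => isotopy (l.map (Arc.shift k)) (r.map (Arc.shift k)) (by
      have key : ∀ {l r : List Arc}, IsotopyStep l r →
          IsotopyStep (l.map (Arc.shift k)) (r.map (Arc.shift k)) := by
        intro l r h
        cases h with
        | zigzagL i => exact .zigzagL (k + i)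
        | zigzagR i => exact .zigzagR (k + i)
        | capCap i j h => exact .capCap (k + i) (k + j) (by omega)
        | capCup i j h => exact .capCup (k + i) (k + j) (by omega)
        | cupCap i j h => exact .cupCap (k + i) (k + j) (by omega)
        | cupCup i j h => exact .cupCup (k + i) (k + j) (by omega)
      exact h.imp key key)

end Event

/-- An elementary cobordism: an event takes place in the diagram `a`, below the pieces `above`
and above the pieces `below`, at a level meeting `width` strands. -/
structure Move {m n : ℕ} (a b : Diag m n) where
  above : List Arc
  below : List Arc
  width : ℕ
  event : Event
  goes_above : Goes above m width
  valid : event.Valid width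
  src_eq : a.word = above ++ event.src ++ below
  tgt_eq : b.word = above ++ event.tgt ++ below

instance (m n : ℕ) : Quiver (Diag m n) := ⟨Move⟩

/-- An elementary cobordism as an arrow of the quiver of diagrams. -/
abbrev Move.arrow {m n : ℕ} {a b : Diag m n} (e : Move a b) : a ⟶ b := e

/-- A dotted cobordism between diagrams, presented as a movie. -/
abbrev Movie {m n : ℕ} (a b : Diag m n) := Quiver.Path a b

/-! ### The surface swept out by a movie -/

/-- The number of strands at the level just below the first `t` pieces of `w`, when there are `m`
strands on the top. -/
def widthAt (m : ℕ) (w : List Arc) (t : ℕ) : ℕ :=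
  (w.take t).foldl (fun k c => match c with | .cap _ => k + 2 | .cup _ => k - 2) m

/-- The points at which a diagram meets the horizontal levels between its pieces: `(t, p)` is the
point in position `p` at the level just below the first `t` pieces. -/
def Frame {m n : ℕ} (a : Diag m n) : Type :=
  {x : ℕ × ℕ // x.1 ≤ a.word.length ∧ x.2 < widthAt m a.word x.1}

/-- Two such points are joined by a strand of one piece of the diagram. -/
inductive Joined (w : List Arc) : ℕ × ℕ → ℕ × ℕ → Prop
  | capLeft (t i p : ℕ) : w[t]? = some (.cap i) → p < i → Joined w (t, p) (t + 1, p)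
  | capRight (t i p : ℕ) : w[t]? = some (.cap i) → i ≤ p → Joined w (t, p) (t + 1, p + 2)
  | capTurn (t i : ℕ) : w[t]? = some (.cap i) → Joined w (t + 1, i) (t + 1, i + 1)
  | cupLeft (t i p : ℕ) : w[t]? = some (.cup i) → p < i → Joined w (t, p) (t + 1, p)
  | cupRight (t i p : ℕ) : w[t]? = some (.cup i) → i ≤ p → Joined w (t, p + 2) (t + 1, p)
  | cupTurn (t i : ℕ) : w[t]? = some (.cup i) → Joined w (t, i) (t, i + 1)

theorem Goes.foldl {u : List Arc} {m k : ℕ} (h : Goes u m k) :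
    u.foldl (fun k c => match c with | .cap _ => k + 2 | .cup _ => k - 2) m = k := by
  induction u generalizing m with
  | nil => exact h
  | cons c u ih => cases c with
    | cap i => exact ih h.2
    | cup i => exact ih h.2

theorem Goes.widthAt_append {u : List Arc} {m k : ℕ} (h : Goes u m k) (v : List Arc) :
    widthAt m (u ++ v) u.length = k := by
  simp [widthAt, h.foldl]

theorem Goes.widthAt_append_cap {u : List Arc} {m k : ℕ} (h : Goes u m k) (i : ℕ)
    (v : List Arc) : widthAt m (u ++ .cap i :: v) (u.length + 1) = k + 2 := by
  have : (u ++ Arc.cap i :: v).take (u.length + 1) = u ++ [Arc.cap i] := by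
    simp [List.take_append]
  simp [widthAt, this, h.foldl]

namespace Move

variable {m n : ℕ} {a b : Diag m n}

/-- The point `(t, p)` of the frame before the move and the point `(t', p')` of the frame after
it are connected by the part of the cobordism on which nothing happens. -/
def Persists (e : Move a b) (x y : ℕ × ℕ) : Prop :=
  x.2 = y.2 ∧ ((x.1 = y.1 ∧ x.1 ≤ e.above.length) ∨
    ∃ s, x.1 = e.above.length + e.event.src.length + s ∧
      y.1 = e.above.length + e.event.tgt.length + s)

/-- The contributions of a move: a point on the component of the surface where it takes place
(in the frame before or after the move), the change of the Euler characteristic and the number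
of dots. -/
def marks (e : Move a b) : List ((Frame a ⊕ Frame b) × ℤ × ℕ) :=
  match e with
  | ⟨u, v, _, .birth i, hu, hi, _, hb⟩ =>
    [(.inr ⟨(u.length + 1, i), by
      simp only [Event.tgt, List.append_assoc] at hb
      rw [hb, List.cons_append, hu.widthAt_append_cap]
      exact ⟨by simp, Nat.lt_of_le_of_lt hi (by omega)⟩⟩, 1, 0)]
  | ⟨u, v, _, .death i, hu, hi, ha, _⟩ =>
    [(.inl ⟨(u.length + 1, i), by
      simp only [Event.src, List.append_assoc] at ha
      rw [ha, List.cons_append, hu.widthAt_append_cap]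
      exact ⟨by simp, Nat.lt_of_le_of_lt hi (by omega)⟩⟩, 1, 0)]
  | ⟨u, v, k, .saddle i, hu, hi, ha, _⟩ =>
    [(.inl ⟨(u.length, i), by
      have hi' : i + 2 ≤ k := hi
      rw [ha, List.append_assoc, hu.widthAt_append]
      exact ⟨by simp, by omega⟩⟩, -1, 0)]
  | ⟨u, v, k, .cosaddle i, hu, hi, ha, _⟩ =>
    [(.inl ⟨(u.length, i), by
      have hi' : i + 2 ≤ k := hi
      rw [ha, List.append_assoc, hu.widthAt_append]
      exact ⟨by simp, by omega⟩⟩, -1, 0)]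
  | ⟨u, v, _, .dot i, hu, hi, ha, _⟩ =>
    [(.inl ⟨(u.length, i), by
      rw [ha, List.append_assoc, hu.widthAt_append]
      exact ⟨by simp, hi⟩⟩, 0, 1)]
  | ⟨_, _, _, .isotopy _ _ _, _, _, _, _⟩ => []

end Move

namespace Movie

variable {m n : ℕ} {a : Diag m n}

/-- The `q`-degree of a cobordism between unshifted diagrams. -/
def degree : {b : Diag m n} → Movie a b → ℤ
  | _, .nil => 0
  | _, .cons p e => degree p + (Move.event e).degree

/-- The points of the frames of a movie. -/
def Points : {b : Diag m n} → Movie a b → Type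
  | _, .nil => Frame a
  | b, .cons p _ => Points p ⊕ Frame b

/-- The points in the first frame. -/
def first : {b : Diag m n} → (p : Movie a b) → Frame a → Points p
  | _, .nil, x => x
  | _, .cons p _, x => Sum.inl (first p x)

/-- The points in the last frame. -/
def last : {b : Diag m n} → (p : Movie a b) → Frame b → Points p
  | _, .nil, x => x
  | _, .cons _ _, x => Sum.inr x

/-- Two points are adjacent on the surface: they are joined by a strand in one of the frames, or
they correspond to each other in two successive frames. -/
def Adj {b : Diag m n} (p : Movie a b) : Points p → Points p → Prop :=
  match b, p with
  | _, .nil => fun x y => Joined a.word x.1 y.1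
  | b, .cons p e => fun x y =>
    match (show Points p ⊕ Frame b from x), (show Points p ⊕ Frame b from y) with
    | .inl x, .inl y => Adj p x y
    | .inr x, .inr y => Joined b.word x.1 y.1
    | .inl x, .inr y => ∃ z, last p z = x ∧ Move.Persists e z.1 y.1
    | .inr _, .inl _ => False

/-- All the contributions of the moves of a movie. -/
def marks : {b : Diag m n} → (p : Movie a b) → List (Points p × ℤ × ℕ)
  | _, .nil => []
  | _, .cons p e =>
    (marks p).map (fun x => (Sum.inl x.1, x.2)) ++
      (Move.marks e).map (fun x => (Sum.map (last p) id x.1, x.2))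

/-- The set of connected components of the surface swept out by a movie. -/
def Component {b : Diag m n} (p : Movie a b) : Type := Quot (Adj p)

open scoped Classical in
/-- The Euler characteristic of a component, relative to the part of the source diagram which it
contains. -/
def euler {b : Diag m n} (p : Movie a b) (c : Component p) : ℤ :=
  ((marks p).map (fun x => if Quot.mk _ x.1 = c then x.2.1 else 0)).sum

open scoped Classical in
/-- The number of dots on a component. -/
def dots {b : Diag m n} (p : Movie a b) (c : Component p) : ℕ :=
  ((marks p).map (fun x => if Quot.mk _ x.1 = c then x.2.2 else 0)).sum

/-- The dotted surfaces swept out by two movies between the same diagrams are homeomorphic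
relative to their boundary.  (The surfaces are orientable, so they are classified by their
components, the boundary, the Euler characteristic and the number of dots of each component.) -/
def Homeomorphic {b : Diag m n} (p p' : Movie a b) : Prop :=
  ∃ φ : Component p ≃ Component p',
    (∀ x, φ (Quot.mk _ (first p x)) = Quot.mk _ (first p' x)) ∧
    (∀ x, φ (Quot.mk _ (last p x)) = Quot.mk _ (last p' x)) ∧
    ∀ c, euler p' (φ c) = euler p c ∧ dots p' (φ c) = dots p c

end Movie

/-! ### Gluing cobordisms to vertical pieces -/

namespace Move

variable {l m n : ℕ}

/-- The identity of the diagram `c` is glued to the top of an elementary cobordism. -/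
def stackTop (c : Diag l m) {a b : Diag m n} (e : Move a b) : Move (c.stack a) (c.stack b) where
  above := c.word ++ e.above
  below := e.below
  width := e.width
  event := e.event
  goes_above := c.goes.append e.goes_above
  valid := e.valid
  src_eq := by simp [Diag.stack, e.src_eq]
  tgt_eq := by simp [Diag.stack, e.tgt_eq]

/-- The identity of the diagram `c` is glued to the bottom of an elementary cobordism. -/
def stackBot (c : Diag m n) {a b : Diag l m} (e : Move a b) : Move (a.stack c) (b.stack c) where
  above := e.above
  below := e.below ++ c.word
  width := e.width
  event := e.event
  goes_above := e.goes_above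
  valid := e.valid
  src_eq := by simp [Diag.stack, e.src_eq]
  tgt_eq := by simp [Diag.stack, e.tgt_eq]

/-- `k` vertical sheets are added on the left of an elementary cobordism. -/
def padL (k : ℕ) {a b : Diag m n} (e : Move a b) : Move (a.padL k) (b.padL k) where
  above := e.above.map (Arc.shift k)
  below := e.below.map (Arc.shift k)
  width := k + e.width
  event := e.event.shift k
  goes_above := e.goes_above.shift k
  valid := by
    have := e.valid
    revert this
    cases e.event <;> simp only [Event.Valid, Event.shift] <;> first | omega | exact id
  src_eq := by
    simp only [Diag.padL, e.src_eq, List.map_append]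
    cases e.event <;> rfl
  tgt_eq := by
    simp only [Diag.padL, e.tgt_eq, List.map_append]
    cases e.event <;> rfl

/-- `k` vertical sheets are added on the right of an elementary cobordism. -/
def padR (k : ℕ) {a b : Diag m n} (e : Move a b) : Move (a.padR k) (b.padR k) where
  above := e.above
  below := e.below
  width := e.width + k
  event := e.event
  goes_above := e.goes_above.addRight k
  valid := by
    have := e.valid
    revert this
    cases e.event <;> simp only [Event.Valid] <;> first | omega | exact id
  src_eq := e.src_eq
  tgt_eq := e.tgt_eq

end Move

/-! ### Linear combinations of cobordisms -/

/-- The ground ring `ℤ[α]`. -/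
abbrev Coeff : Type := Polynomial ℤ

/-- The parameter `α`. -/
abbrev α : Coeff := Polynomial.X

/-- Diagrams and formal `ℤ[α]`-linear combinations of movies of dotted cobordisms, before imposing
any relation. -/
abbrev PreCob (m n : ℕ) : Type := Free Coeff (Paths (Diag m n))

/-- A diagram as an object of `PreCob m n`. -/
abbrev PreCob.of {m n : ℕ} (a : Diag m n) : PreCob m n := a

/-- A movie as a morphism. -/
def Movie.hom {m n : ℕ} {a b : Diag m n} (p : Movie a b) : PreCob.of a ⟶ PreCob.of b :=
  Finsupp.single (α := Quiver.Path a b) p (1 : Coeff)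

/-- An elementary cobordism as a morphism. -/
def Move.hom {m n : ℕ} {a b : Diag m n} (e : Move a b) : PreCob.of a ⟶ PreCob.of b :=
  Movie.hom e.arrow.toPath

/-- The linear functor on `PreCob` determined by its effect on elementary cobordisms. -/
def PreCob.map {m n m' n' : ℕ} (f : Diag m n → Diag m' n')
    (g : ∀ {a b : Diag m n}, Move a b → Move (f a) (f b)) : PreCob m n ⥤ PreCob m' n' :=
  Free.lift Coeff (Paths.lift { obj := fun a => PreCob.of (f a), map := fun e => (g e).hom })


namespace PreCob

variable {l m n : ℕ}

/-- Gluing the identity of `c` to the top. -/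
def stackTop (c : Diag l m) : PreCob m n ⥤ PreCob l n := map c.stack (Move.stackTop c)

/-- Gluing the identity of `c` to the bottom. -/
def stackBot (c : Diag m n) : PreCob l m ⥤ PreCob l n :=
  map (fun a => a.stack c) (Move.stackBot c)

/-- Adding `k` vertical sheets on the left. -/
def padL (k : ℕ) : PreCob m n ⥤ PreCob (k + m) (k + n) := map (Diag.padL k) (Move.padL k)

/-- Adding `k` vertical sheets on the right. -/
def padR (k : ℕ) : PreCob m n ⥤ PreCob (m + k) (n + k) := map (Diag.padR k) (Move.padR k)

instance {m' n' : ℕ} (f : Diag m n → Diag m' n')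
    (g : ∀ {a b : Diag m n}, Move a b → Move (f a) (f b)) : (map f g).Additive := by
  unfold map; infer_instance

instance {m' n' : ℕ} (f : Diag m n → Diag m' n')
    (g : ∀ {a b : Diag m n}, Move a b → Move (f a) (f b)) : (map f g).Linear Coeff := by
  unfold map; infer_instance

instance (c : Diag l m) : (stackTop (n := n) c).Additive := by unfold stackTop; infer_instance

instance (c : Diag m n) : (stackBot (l := l) c).Additive := by unfold stackBot; infer_instance

instance (k : ℕ) : (padL (m := m) (n := n) k).Additive := by unfold padL; infer_instance

instance (k : ℕ) : (padR (m := m) (n := n) k).Additive := by unfold padR; infer_instance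

end PreCob

/-! ### Local pictures -/

namespace Local

/-- `k` vertical strands and a circle, which has `i` strands on its left. -/
def circle (k i : ℕ) (h : i ≤ k) : Diag k k := ⟨[.cap i, .cup i], ⟨h, by omega, rfl⟩⟩

def birth (k i : ℕ) (h : i ≤ k) : Move (Diag.one k) (circle k i h) :=
  ⟨[], [], k, .birth i, rfl, h, rfl, rfl⟩

def death (k i : ℕ) (h : i ≤ k) : Move (circle k i h) (Diag.one k) :=
  ⟨[], [], k, .death i, rfl, h, rfl, rfl⟩

/-- A dot on the circle. -/
def circleDot (k i : ℕ) (h : i ≤ k) : Move (circle k i h) (circle k i h) :=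
  ⟨[.cap i], [.cup i], k + 2, .dot i, ⟨h, rfl⟩, show i < k + 2 by omega, rfl, rfl⟩

/-- `k` vertical strands and a cap, which has `i` strands on its left. -/
def arc (k i : ℕ) (h : i ≤ k) : Diag k (k + 2) := ⟨[.cap i], ⟨h, rfl⟩⟩

/-- The same picture with a circle inserted above the cap. -/
def circleArc (k i : ℕ) (h : i ≤ k) : Diag k (k + 2) :=
  ⟨[.cap i, .cup i, .cap i], ⟨h, by omega, h, rfl⟩⟩

/-- A circle is split off from the cap by a saddle. -/
def split (k i : ℕ) (h : i ≤ k) : Move (arc k i h) (circleArc k i h) :=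
  ⟨[.cap i], [], k + 2, .cosaddle i, ⟨h, rfl⟩, show i + 2 ≤ k + 2 by omega, rfl, rfl⟩

/-- The circle is merged with the cap by a saddle. -/
def merge (k i : ℕ) (h : i ≤ k) : Move (circleArc k i h) (arc k i h) :=
  ⟨[.cap i], [], k + 2, .saddle i, ⟨h, rfl⟩, show i + 2 ≤ k + 2 by omega, rfl, rfl⟩

/-- A dot on the cap. -/
def arcDot (k i : ℕ) (h : i ≤ k) : Move (arc k i h) (arc k i h) :=
  ⟨[.cap i], [], k + 2, .dot i, ⟨h, rfl⟩, show i < k + 2 by omega, rfl, rfl⟩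

end Local

/-! ### The relations -/

open Local in
/-- The equivalence relation on linear combinations of dotted cobordisms generated by
homeomorphism relative to the boundary and the local relations, in every planar context.

Isotopic cobordisms are homeomorphic relative to the boundary.  Conversely, embedded cobordisms
which are homeomorphic relative to the boundary are already equal modulo isotopy and the local
relations: neck cutting along the boundary curves rewrites both as the same combination of dotted
disks, with coefficients given by the evaluation of closed components.  So using homeomorphism
instead of isotopy does not change the quotient. -/
inductive Rel : ∀ {m n : ℕ} {a b : PreCob m n}, (a ⟶ b) → (a ⟶ b) → Prop
  -- Surfaces are considered up to homeomorphism relative to the boundary; in particular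
  -- isotopic cobordisms are identified.
  | homeo {m n : ℕ} {a b : Diag m n} (p p' : Movie a b) (h : p.Homeomorphic p') :
      Rel p.hom p'.hom
  -- Cobordisms which are stacked on top of each other in the square commute (an isotopy which
  -- exchanges the times of distant events).
  | interchange {l m n : ℕ} {a a' : Diag l m} {b b' : Diag m n}
      (f : PreCob.of a ⟶ PreCob.of a') (g : PreCob.of b ⟶ PreCob.of b') :
      Rel ((PreCob.stackBot b).map f ≫ (PreCob.stackTop a').map g)
        ((PreCob.stackTop a).map g ≫ (PreCob.stackBot b').map f)
  -- The sphere with zero, one, two and three dots.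
  | sphere (k i : ℕ) (h : i ≤ k) :
      Rel ((birth k i h).hom ≫ (death k i h).hom) 0
  | sphereDot (k i : ℕ) (h : i ≤ k) :
      Rel ((birth k i h).hom ≫ (circleDot k i h).hom ≫ (death k i h).hom) (𝟙 _)
  | sphereDotDot (k i : ℕ) (h : i ≤ k) :
      Rel ((birth k i h).hom ≫ (circleDot k i h).hom ≫ (circleDot k i h).hom ≫
        (death k i h).hom) 0
  | sphereDotDotDot (k i : ℕ) (h : i ≤ k) :
      Rel ((birth k i h).hom ≫ (circleDot k i h).hom ≫ (circleDot k i h).hom ≫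
        (circleDot k i h).hom ≫ (death k i h).hom) (α • 𝟙 _)
  -- Neck cutting: a cylinder is the sum of the two ways to put a dot on a pair of disks.
  | neck (k i : ℕ) (h : i ≤ k) :
      Rel (𝟙 (PreCob.of (circle k i h)))
        ((circleDot k i h).hom ≫ (death k i h).hom ≫ (birth k i h).hom +
          (death k i h).hom ≫ (birth k i h).hom ≫ (circleDot k i h).hom)
  -- A handle on a sheet is twice a dot.
  | handle (k i : ℕ) (h : i ≤ k) :
      Rel ((split k i h).hom ≫ (merge k i h).hom) ((2 : Coeff) • (arcDot k i h).hom)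
  -- The relations are closed under gluing.
  | stackTop {l m n : ℕ} (c : Diag l m) {a b : PreCob m n} {f g : a ⟶ b} :
      Rel f g → Rel ((PreCob.stackTop c).map f) ((PreCob.stackTop c).map g)
  | stackBot {l m n : ℕ} (c : Diag m n) {a b : PreCob l m} {f g : a ⟶ b} :
      Rel f g → Rel ((PreCob.stackBot c).map f) ((PreCob.stackBot c).map g)
  | padL {m n : ℕ} (k : ℕ) {a b : PreCob m n} {f g : a ⟶ b} :
      Rel f g → Rel ((PreCob.padL k).map f) ((PreCob.padL k).map g)
  | padR {m n : ℕ} (k : ℕ) {a b : PreCob m n} {f g : a ⟶ b} :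
      Rel f g → Rel ((PreCob.padR k).map f) ((PreCob.padR k).map g)
  -- The relations are closed under composition and linear combinations.
  | compLeft {m n : ℕ} {a b c : PreCob m n} (f : a ⟶ b) {g g' : b ⟶ c} :
      Rel g g' → Rel (f ≫ g) (f ≫ g')
  | compRight {m n : ℕ} {a b c : PreCob m n} {f f' : a ⟶ b} (g : b ⟶ c) :
      Rel f f' → Rel (f ≫ g) (f' ≫ g)
  | add {m n : ℕ} {a b : PreCob m n} {f f' g g' : a ⟶ b} :
      Rel f f' → Rel g g' → Rel (f + g) (f' + g')
  | smul {m n : ℕ} {a b : PreCob m n} (r : Coeff) {f f' : a ⟶ b} :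
      Rel f f' → Rel (r • f) (r • f')
  | refl {m n : ℕ} {a b : PreCob m n} (f : a ⟶ b) : Rel f f
  | symm {m n : ℕ} {a b : PreCob m n} {f g : a ⟶ b} : Rel f g → Rel g f
  | trans {m n : ℕ} {a b : PreCob m n} {f g h : a ⟶ b} : Rel f g → Rel g h → Rel f h

/-- The relations between linear combinations of dotted cobordisms. -/
def cobRel (m n : ℕ) : HomRel (PreCob m n) := fun _ _ f g => Rel f g

instance (m n : ℕ) : Congruence (cobRel m n) where
  comp_left f _ _ h := Rel.compLeft f h
  comp_right g h := Rel.compRight g h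
  equivalence := ⟨Rel.refl, Rel.symm, Rel.trans⟩

/-- The category of planar diagrams and `ℤ[α]`-linear combinations of dotted cobordisms modulo the
local relations. -/
abbrev Cob (m n : ℕ) : Type := CategoryTheory.Quotient (cobRel m n)

instance (m n : ℕ) : Preadditive (Cob m n) :=
  CategoryTheory.Quotient.preadditive (cobRel m n) (fun _ _ _ _ _ _ h h' => Rel.add h h')

instance (m n : ℕ) : (CategoryTheory.Quotient.functor (cobRel m n)).Additive :=
  CategoryTheory.Quotient.functor_additive (cobRel m n) (fun _ _ _ _ _ _ h h' => Rel.add h h')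

instance (m n : ℕ) : Linear Coeff (Cob m n) :=
  CategoryTheory.Quotient.linear Coeff (cobRel m n) (fun r _ _ _ _ h => Rel.smul r h)

instance (m n : ℕ) : (CategoryTheory.Quotient.functor (cobRel m n)).Linear Coeff :=
  CategoryTheory.Quotient.linear_functor Coeff (cobRel m n) (fun r _ _ _ _ h => Rel.smul r h)

namespace Cob

variable {l m n : ℕ}

/-- A diagram as an object. -/
abbrev of (a : Diag m n) : Cob m n := ⟨PreCob.of a⟩

/-- The class of a dotted cobordism. -/
def movie {a b : Diag m n} (p : Movie a b) : of a ⟶ of b :=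
  (CategoryTheory.Quotient.functor (cobRel m n)).map p.hom

/-- The homogeneous morphisms of `q`-degree `d`, where `α` has degree `4`. -/
def homog (a b : Diag m n) (d : ℤ) : AddSubgroup (of a ⟶ of b) :=
  AddSubgroup.closure
    {f | ∃ (e : ℕ) (p : Movie a b), 4 * (e : ℤ) + p.degree = d ∧ f = α ^ e • movie p}

end Cob

namespace PreCob

variable {m n m' n' : ℕ} (f : Diag m n → Diag m' n')
  (g : ∀ {a b : Diag m n}, Move a b → Move (f a) (f b))

theorem hom_comp {a b c : Diag m n} (p : Movie a b) (q : Movie b c) :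
    p.hom ≫ q.hom = Movie.hom (p.comp q) := by
  refine (Free.single_comp_single (R := Coeff) (C := Paths (Diag m n)) p q 1 1).trans ?_
  rw [one_mul]
  rfl

theorem degree_comp {a b c : Diag m n} (p : Movie a b) (q : Movie b c) :
    Movie.degree (p.comp q) = p.degree + q.degree := by
  induction q with
  | nil => simp [Movie.degree]
  | cons q e ih =>
    rw [Quiver.Path.comp_cons]
    simp only [Movie.degree, ih, add_assoc]

theorem map_hom (hg : ∀ {a b : Diag m n} (e : Move a b), (g e).event.degree = e.event.degree)
    {a b : Diag m n} (p : Movie a b) :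
    ∃ p' : Movie (f a) (f b), p'.degree = p.degree ∧ (map f g).map p.hom = p'.hom := by
  induction p with
  | nil => exact ⟨.nil, rfl, (map f g).map_id (PreCob.of a)⟩
  | @cons b c p e ih =>
    obtain ⟨p', h1, h2⟩ := ih
    refine ⟨p'.cons (g e).arrow, ?_, ?_⟩
    · simp only [Movie.degree, h1]
      rw [show Move.event (g e).arrow = (g e).event from rfl, hg]
    · have h3 : Movie.hom (p.cons e) = Movie.hom p ≫ Move.hom e :=
        (hom_comp p (Move.arrow e).toPath).symm
      have h4 : Movie.hom (p'.cons (g e).arrow) = Movie.hom p' ≫ Move.hom (g e) :=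
        (hom_comp p' (g e).arrow.toPath).symm
      rw [h3, h4, Functor.map_comp, h2]
      congr 1
      simp only [Move.hom, Movie.hom, map]
      erw [Free.lift_map_single]
      rw [one_smul]
      exact Category.id_comp _

end PreCob

namespace Cob

variable {l m n : ℕ}

theorem movie_comp {a b c : Diag m n} (p : Movie a b) (q : Movie b c) :
    movie p ≫ movie q = movie (p.comp q) := by
  rw [movie, movie, ← Functor.map_comp, PreCob.hom_comp]
  rfl

theorem homog_id (a : Diag m n) : 𝟙 (of a) ∈ homog a a 0 :=
  AddSubgroup.subset_closure ⟨0, .nil, rfl, (one_smul Coeff (𝟙 (of a))).symm.trans (by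
    rw [pow_zero]; rfl)⟩

theorem homog_comp {a b c : Diag m n} {d d' : ℤ} {f : of a ⟶ of b} {g : of b ⟶ of c}
    (hf : f ∈ homog a b d) (hg : g ∈ homog b c d') : f ≫ g ∈ homog a c (d + d') := by
  induction hf using AddSubgroup.closure_induction with
  | mem f hf =>
    induction hg using AddSubgroup.closure_induction with
    | mem g hg =>
      obtain ⟨e, p, h, rfl⟩ := hf
      obtain ⟨e', p', h', rfl⟩ := hg
      refine AddSubgroup.subset_closure ⟨e + e', p.comp p', ?_, ?_⟩
      · rw [PreCob.degree_comp, ← h, ← h']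
        push_cast
        ring
      · rw [Linear.smul_comp, Linear.comp_smul, smul_smul, movie_comp, pow_add]
    | zero => rw [comp_zero]; exact zero_mem _
    | add g g' _ _ h h' => rw [Preadditive.comp_add]; exact add_mem h h'
    | neg g _ h => rw [Preadditive.comp_neg]; exact neg_mem h
  | zero => rw [zero_comp]; exact zero_mem _
  | add f f' _ _ h h' => rw [Preadditive.add_comp]; exact add_mem h h'
  | neg f _ h => rw [Preadditive.neg_comp]; exact neg_mem h

section

variable {m' n' : ℕ} (F : PreCob m n ⥤ PreCob m' n')
  (hF : ∀ {a b : PreCob m n} {f g : a ⟶ b}, Rel f g → Rel (F.map f) (F.map g))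

/-- The functor on `Cob` induced by a functor which is compatible with the relations. -/
def lift : Cob m n ⥤ Cob m' n' :=
  CategoryTheory.Quotient.lift _ (F ⋙ CategoryTheory.Quotient.functor _)
    (fun _ _ _ _ h => CategoryTheory.Quotient.sound _ (hF h))

instance [F.Additive] : (lift F hF).Additive where
  map_add {_ _ f g} := by
    obtain ⟨f, rfl⟩ := (CategoryTheory.Quotient.functor _).map_surjective f
    obtain ⟨g, rfl⟩ := (CategoryTheory.Quotient.functor _).map_surjective g
    rw [← Functor.map_add]
    change (CategoryTheory.Quotient.functor _).map (F.map (f + g)) =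
      (CategoryTheory.Quotient.functor _).map (F.map f) +
      (CategoryTheory.Quotient.functor _).map (F.map g)
    rw [F.map_add, Functor.map_add]
    rfl

theorem lift_smul [F.Additive] [F.Linear Coeff] {a b : Cob m n} (r : Coeff) (f : a ⟶ b) :
    (lift F hF).map (r • f) = r • (lift F hF).map f := by
  obtain ⟨f, rfl⟩ := (CategoryTheory.Quotient.functor _).map_surjective f
  rw [← Functor.map_smul]
  change (CategoryTheory.Quotient.functor _).map (F.map (r • f)) =
      r • (CategoryTheory.Quotient.functor _).map (F.map f)
  rw [F.map_smul, Functor.map_smul]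
  rfl

end

section

variable {m' n' : ℕ} (f : Diag m n → Diag m' n')
  (g : ∀ {a b : Diag m n}, Move a b → Move (f a) (f b))
  (hF : ∀ {a b : PreCob m n} {u v : a ⟶ b}, Rel u v →
    Rel ((PreCob.map f g).map u) ((PreCob.map f g).map v))

theorem lift_homog
    (hg : ∀ {a b : Diag m n} (e : Move a b), (g e).event.degree = e.event.degree)
    {a b : Diag m n} {d : ℤ} {u : of a ⟶ of b} (hu : u ∈ homog a b d) :
    (lift (PreCob.map f g) hF).map u ∈ homog (f a) (f b) d := by
  induction hu using AddSubgroup.closure_induction with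
  | mem u hu =>
    obtain ⟨e, p, h, rfl⟩ := hu
    obtain ⟨p', h1, h2⟩ := PreCob.map_hom f g hg p
    refine AddSubgroup.subset_closure ⟨e, p', by rw [h1, h], ?_⟩
    rw [lift_smul]
    congr 1
    exact congrArg (CategoryTheory.Quotient.functor (cobRel m' n')).map h2
  | zero => rw [Functor.map_zero]; exact zero_mem _
  | add u v _ _ h h' => rw [Functor.map_add]; exact add_mem h h'
  | neg u _ h => rw [Functor.map_neg]; exact neg_mem h

end

/-- Gluing the identity of `c` to the top. -/
def stackTop (c : Diag l m) : Cob m n ⥤ Cob l n := lift (PreCob.stackTop c) (Rel.stackTop c)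

/-- Gluing the identity of `c` to the bottom. -/
def stackBot (c : Diag m n) : Cob l m ⥤ Cob l n := lift (PreCob.stackBot c) (Rel.stackBot c)

/-- Adding `k` vertical sheets on the left. -/
def padL (k : ℕ) : Cob m n ⥤ Cob (k + m) (k + n) := lift (PreCob.padL k) (Rel.padL k)

/-- Adding `k` vertical sheets on the right. -/
def padR (k : ℕ) : Cob m n ⥤ Cob (m + k) (n + k) := lift (PreCob.padR k) (Rel.padR k)

instance (c : Diag l m) : (stackTop (n := n) c).Additive := by
  unfold stackTop; infer_instance

instance (c : Diag m n) : (stackBot (l := l) c).Additive := by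
  unfold stackBot; infer_instance

instance (k : ℕ) : (padL (m := m) (n := n) k).Additive := by
  unfold padL; infer_instance

instance (k : ℕ) : (padR (m := m) (n := n) k).Additive := by
  unfold padR; infer_instance

theorem interchange {a a' : Diag l m} {b b' : Diag m n} (f : of a ⟶ of a') (g : of b ⟶ of b') :
    (stackBot b).map f ≫ (stackTop a').map g = (stackTop a).map g ≫ (stackBot b').map f := by
  obtain ⟨f, rfl⟩ := (CategoryTheory.Quotient.functor _).map_surjective f
  obtain ⟨g, rfl⟩ := (CategoryTheory.Quotient.functor _).map_surjective g
  exact CategoryTheory.Quotient.sound _ (Rel.interchange f g)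

theorem stackTop_homog (c : Diag l m) {a b : Diag m n} {d : ℤ} {f : of a ⟶ of b}
    (hf : f ∈ homog a b d) :
    (stackTop c).map f ∈ homog (c.stack a) (c.stack b) d :=
  lift_homog c.stack (Move.stackTop c) (Rel.stackTop c) (fun _ => rfl) hf

theorem stackBot_homog (c : Diag m n) {a b : Diag l m} {d : ℤ} {f : of a ⟶ of b}
    (hf : f ∈ homog a b d) :
    (stackBot c).map f ∈ homog (a.stack c) (b.stack c) d :=
  lift_homog (fun a => a.stack c) (Move.stackBot c) (Rel.stackBot c) (fun _ => rfl) hf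

theorem padL_homog (k : ℕ) {a b : Diag m n} {d : ℤ} {f : of a ⟶ of b}
    (hf : f ∈ homog a b d) : (padL k).map f ∈ homog (a.padL k) (b.padL k) d :=
  lift_homog (Diag.padL k) (Move.padL k) (Rel.padL k)
    (fun e => by
      change (e.event.shift k).degree = _
      cases e.event <;> rfl) hf

theorem padR_homog (k : ℕ) {a b : Diag m n} {d : ℤ} {f : of a ⟶ of b}
    (hf : f ∈ homog a b d) : (padR k).map f ∈ homog (a.padR k) (b.padR k) d :=
  lift_homog (Diag.padR k) (Move.padR k) (Rel.padR k) (fun _ => rfl) hf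

end Cob

/-! ### Formal `q`-shifts and finite direct sums -/

/-- The formal shift `q ^ shift diag` of a planar diagram. -/
@[ext]
structure QDiag (m n : ℕ) where
  diag : Diag m n
  shift : ℤ

/-- A morphism of degree `0` from `q ^ k a` to `q ^ l b`: the degree of a cobordism `S` from
`q ^ k a` to `q ^ l b` is `l - k` plus its degree as a cobordism from `a` to `b`. -/
@[ext]
structure QDiag.Hom {m n : ℕ} (X Y : QDiag m n) where
  val : Cob.of X.diag ⟶ Cob.of Y.diag
  homog : val ∈ Cob.homog X.diag Y.diag (X.shift - Y.shift)

namespace QDiag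

variable {l m n : ℕ}

instance : Category (QDiag m n) where
  Hom := QDiag.Hom
  id X := ⟨𝟙 _, by rw [sub_self]; exact Cob.homog_id _⟩
  comp {X Y Z} f g := ⟨f.val ≫ g.val, by
    rw [← sub_add_sub_cancel X.shift Y.shift Z.shift]
    exact Cob.homog_comp f.homog g.homog⟩
  id_comp f := QDiag.Hom.ext (Category.id_comp _)
  comp_id f := QDiag.Hom.ext (Category.comp_id _)
  assoc f g h := QDiag.Hom.ext (Category.assoc _ _ _)

@[ext]
theorem hom_ext {X Y : QDiag m n} {f g : X ⟶ Y} (h : f.val = g.val) : f = g := QDiag.Hom.ext h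

@[simp] theorem id_val (X : QDiag m n) : QDiag.Hom.val (𝟙 X) = 𝟙 (Cob.of X.diag) := rfl

@[simp] theorem comp_val {X Y Z : QDiag m n} (f : X ⟶ Y) (g : Y ⟶ Z) :
    QDiag.Hom.val (f ≫ g) = f.val ≫ g.val := rfl

/-- Morphisms of degree `0` are the elements of a group of homogeneous morphisms. -/
def homEquiv (X Y : QDiag m n) :
    (X ⟶ Y) ≃ Cob.homog X.diag Y.diag (X.shift - Y.shift) where
  toFun f := ⟨f.val, f.homog⟩
  invFun f := ⟨f.1, f.2⟩

instance (X Y : QDiag m n) : AddCommGroup (X ⟶ Y) := (homEquiv X Y).addCommGroup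

@[simp] theorem add_val {X Y : QDiag m n} (f g : X ⟶ Y) :
    QDiag.Hom.val (f + g) = f.val + g.val := rfl

instance : Preadditive (QDiag m n) where
  add_comp _ _ _ _ _ _ := hom_ext (Preadditive.add_comp _ _ _ _ _ _)
  comp_add _ _ _ _ _ _ := hom_ext (Preadditive.comp_add _ _ _ _ _ _)

/-- The shift of all objects by `q ^ k`. -/
def qShift (k : ℤ) : QDiag m n ⥤ QDiag m n where
  obj X := ⟨X.diag, X.shift + k⟩
  map f := ⟨f.val, by rw [add_sub_add_right_eq_sub]; exact f.homog⟩

instance (k : ℤ) : (qShift (m := m) (n := n) k).Additive where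

/-- Adding `k` vertical strands on the left. -/
def padL (k : ℕ) : QDiag m n ⥤ QDiag (k + m) (k + n) where
  obj X := ⟨X.diag.padL k, X.shift⟩
  map f := ⟨(Cob.padL k).map f.val, Cob.padL_homog k f.homog⟩
  map_id _ := hom_ext ((Cob.padL k).map_id _)
  map_comp _ _ := hom_ext ((Cob.padL k).map_comp _ _)

instance (k : ℕ) : (padL (m := m) (n := n) k).Additive where
  map_add := hom_ext ((Cob.padL k).map_add)

/-- Adding `k` vertical strands on the right. -/
def padR (k : ℕ) : QDiag m n ⥤ QDiag (m + k) (n + k) where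
  obj X := ⟨X.diag.padR k, X.shift⟩
  map f := ⟨(Cob.padR k).map f.val, Cob.padR_homog k f.homog⟩
  map_id _ := hom_ext ((Cob.padR k).map_id _)
  map_comp _ _ := hom_ext ((Cob.padR k).map_comp _ _)

instance (k : ℕ) : (padR (m := m) (n := n) k).Additive where
  map_add := hom_ext ((Cob.padR k).map_add)

/-- Vertical stacking of diagrams and cobordisms: `(X, Y) ↦ X ⊗ Y`, with `X` on top of `Y`. -/
def stack : QDiag l m ⥤ QDiag m n ⥤ QDiag l n where
  obj X :=
    { obj := fun Y => ⟨X.diag.stack Y.diag, X.shift + Y.shift⟩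
      map := fun g => ⟨(Cob.stackTop X.diag).map g.val, by
        rw [add_sub_add_left_eq_sub]
        exact Cob.stackTop_homog _ g.homog⟩
      map_id := fun _ => hom_ext ((Cob.stackTop X.diag).map_id _)
      map_comp := fun _ _ => hom_ext ((Cob.stackTop X.diag).map_comp _ _) }
  map {X X'} f :=
    { app := fun Y => ⟨(Cob.stackBot Y.diag).map f.val, by
        rw [add_sub_add_right_eq_sub]
        exact Cob.stackBot_homog _ f.homog⟩
      naturality := fun _ _ g => hom_ext (Cob.interchange f.val g.val).symm }
  map_id _ := by
    ext Y
    exact (Cob.stackBot Y.diag).map_id _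
  map_comp _ _ := by
    ext Y
    exact (Cob.stackBot Y.diag).map_comp _ _

instance : (stack (l := l) (m := m) (n := n)).Additive where
  map_add := by
    intros
    ext Y
    exact (Cob.stackBot Y.diag).map_add

instance (X : QDiag l m) : (stack (n := n).obj X).Additive where
  map_add := hom_ext ((Cob.stackTop X.diag).map_add)

end QDiag

section Bifunctor

variable {C D E : Type} [Category.{0} C] [Category.{0} D] [Category.{0} E]
  [Preadditive C] [Preadditive D] [Preadditive E]
  (F : C ⥤ D ⥤ E)

/-- The matrix obtained by applying a bifunctor to the entries of two matrices. -/
def matTensor {M M' : Mat_ C} {N N' : Mat_ D} (f : M ⟶ M') (g : N ⟶ N') :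
    (⟨M.ι × N.ι, fun x => (F.obj (M.X x.1)).obj (N.X x.2)⟩ : Mat_ E) ⟶
      ⟨M'.ι × N'.ι, fun x => (F.obj (M'.X x.1)).obj (N'.X x.2)⟩ :=
  fun x y => (F.map (f x.1 y.1)).app (N.X x.2) ≫ (F.obj (M'.X y.1)).map (g x.2 y.2)

theorem matTensor_add_left [F.Additive] {M M' : Mat_ C} {N N' : Mat_ D} (f f' : M ⟶ M') (g : N ⟶ N') :
    matTensor F (f + f') g = matTensor F f g + matTensor F f' g := by
  ext ⟨i, j⟩ ⟨k, l⟩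
  simp only [matTensor, Mat_.add_apply, Functor.map_add, NatTrans.app_add, Preadditive.add_comp]

theorem matTensor_add_right [∀ X, (F.obj X).Additive]
    {M M' : Mat_ C} {N N' : Mat_ D} (f : M ⟶ M') (g g' : N ⟶ N') :
    matTensor F f (g + g') = matTensor F f g + matTensor F f g' := by
  ext ⟨i, j⟩ ⟨k, l⟩
  simp only [matTensor, Mat_.add_apply, Functor.map_add, Preadditive.comp_add]

variable [F.Additive] [∀ X, (F.obj X).Additive]

theorem matTensor_id (M : Mat_ C) (N : Mat_ D) : matTensor F (𝟙 M) (𝟙 N) = 𝟙 _ := by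
  ext ⟨i, j⟩ ⟨i', j'⟩
  simp only [matTensor]
  by_cases hi : i = i'
  · subst hi
    by_cases hj : j = j'
    · subst hj
      simp
    · refine Eq.trans ?_ (Mat_.id_apply_of_ne
        (⟨M.ι × N.ι, fun x => (F.obj (M.X x.1)).obj (N.X x.2)⟩ : Mat_ E) (i, j) (i, j')
        (by simpa using hj)).symm
      rw [Mat_.id_apply_of_ne _ _ _ hj, Functor.map_zero, comp_zero]
  · refine Eq.trans ?_ (Mat_.id_apply_of_ne
      (⟨M.ι × N.ι, fun x => (F.obj (M.X x.1)).obj (N.X x.2)⟩ : Mat_ E) (i, j) (i', j')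
      (by simp [hi])).symm
    rw [Mat_.id_apply_of_ne _ _ _ hi, Functor.map_zero, zero_app, zero_comp]

theorem matTensor_comp {M M' M'' : Mat_ C} {N N' N'' : Mat_ D} (f : M ⟶ M') (f' : M' ⟶ M'')
    (g : N ⟶ N') (g' : N' ⟶ N'') :
    matTensor F (f ≫ f') (g ≫ g') = matTensor F f g ≫ matTensor F f' g' := by
  ext ⟨i, j⟩ ⟨k, l⟩
  simp only [matTensor, Mat_.comp_apply, Functor.map_sum, NatTrans.app_sum, Functor.map_comp,
    NatTrans.comp_app, Preadditive.sum_comp, Preadditive.comp_sum, Category.assoc,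
    Fintype.sum_prod_type, NatTrans.naturality_assoc]
  exact Finset.sum_comm

/-- The extension of a biadditive functor to formal finite direct sums. -/
def mapMat₂ : Mat_ C ⥤ Mat_ D ⥤ Mat_ E where
  obj M :=
    { obj := fun N => ⟨M.ι × N.ι, fun x => (F.obj (M.X x.1)).obj (N.X x.2)⟩
      map := fun g => matTensor F (𝟙 M) g
      map_id := fun N => matTensor_id F M N
      map_comp := fun g g' => by rw [← matTensor_comp, Category.id_comp] }
  map f :=
    { app := fun N => matTensor F f (𝟙 N)
      naturality := fun _ _ g => by
        rw [← matTensor_comp, ← matTensor_comp]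
        simp only [Category.id_comp, Category.comp_id] }
  map_id M := by
    ext N : 2
    exact matTensor_id F M N
  map_comp f f' := by
    ext N : 2
    exact (congrArg _ (Category.comp_id _).symm).trans (matTensor_comp F _ _ _ _)

instance : (mapMat₂ F).Additive where
  map_add := by
    intros
    ext N : 2
    exact matTensor_add_left F _ _ _

instance (M : Mat_ C) : ((mapMat₂ F).obj M).Additive where
  map_add := matTensor_add_right F _ _ _

end Bifunctor

/-- Bar-Natan's category of planar diagrams with `m` end points on the top and `n` on the bottom:
the closure of the graded category of dotted cobordisms under finite direct sums. -/
abbrev BN (m n : ℕ) : Type 1 := Mat_ (QDiag m n)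

namespace BN

variable {l m n : ℕ}

/-- A diagram, without shift, as an object. -/
def of (a : Diag m n) : BN m n := (Mat_.embedding _).obj ⟨a, 0⟩

/-- Vertical stacking, the first argument is on top. -/
def stack : BN l m ⥤ BN m n ⥤ BN l n := mapMat₂ QDiag.stack

instance : (stack (l := l) (m := m) (n := n)).Additive := by unfold stack; infer_instance

instance (M : BN l m) : (stack (n := n).obj M).Additive := by unfold stack; infer_instance

instance (N : BN m n) : (stack (l := l).flip.obj N).Additive where
  map_add {_ _ f g} := by
    simp only [Functor.flip_obj_map, Functor.map_add, NatTrans.app_add]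

/-- The shift by `q ^ k`. -/
def qShift (k : ℤ) : BN m n ⥤ BN m n := (QDiag.qShift k).mapMat_

instance (k : ℤ) : (qShift (m := m) (n := n) k).Additive where
  map_add := by
    intros
    apply Mat_.hom_ext
    intros
    exact (QDiag.qShift k).map_add

/-- Adding `k` vertical strands on the left. -/
def padL (k : ℕ) : BN m n ⥤ BN (k + m) (k + n) := (QDiag.padL k).mapMat_

instance (k : ℕ) : (padL (m := m) (n := n) k).Additive where
  map_add := by
    intros
    apply Mat_.hom_ext
    intros
    exact (QDiag.padL k).map_add

/-- Adding `k` vertical strands on the right. -/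
def padR (k : ℕ) : BN m n ⥤ BN (m + k) (n + k) := (QDiag.padR k).mapMat_

instance (k : ℕ) : (padR (m := m) (n := n) k).Additive where
  map_add := by
    intros
    apply Mat_.hom_ext
    intros
    exact (QDiag.padR k).map_add

end BN

/-! ### Chain complexes -/

/-- Chain complexes over `BN m n` which are concentrated in non-positive cohomological degrees:
the object `X k` of such a complex sits in cohomological degree `-k`, and the differential
`X (k + 1) ⟶ X k` raises the cohomological degree by one. -/
abbrev ChNonpos (m n : ℕ) := ChainComplex (BN m n) ℕ

/-- A complex is contractible if its identity is homotopic to zero. -/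
def Contractible {V : Type*} [Category* V] [Preadditive V] {ι : Type*} {c : ComplexShape ι}
    (K : HomologicalComplex V c) : Prop :=
  Nonempty (Homotopy (𝟙 K) 0)

namespace ChNonpos

variable {l m n : ℕ}

instance (A : ChNonpos l m) (B : ChNonpos m n) :
    HomologicalComplex.HasMapBifunctor A B BN.stack (ComplexShape.down ℕ) := fun j => by
  have : Finite (ComplexShape.π (ComplexShape.down ℕ) (ComplexShape.down ℕ)
      (ComplexShape.down ℕ) ⁻¹' {j}) :=
    inferInstanceAs (Finite ((fun i : ℕ × ℕ => i.1 + i.2) ⁻¹' {j}))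
  infer_instance

/-- The planar composition `A ⊗ B` of two complexes, `A` on top of `B`: the total complex of the
bicomplex of all `A i ⊗ B j`, with the Koszul sign rule. -/
def stack (A : ChNonpos l m) (B : ChNonpos m n) : ChNonpos l n :=
  HomologicalComplex.mapBifunctor A B BN.stack (ComplexShape.down ℕ)

/-- The planar composition with a diagram on the top. -/
def stackTop (a : Diag l m) (B : ChNonpos m n) : ChNonpos l n :=
  ((BN.stack.obj (BN.of a)).mapHomologicalComplex _).obj B

/-- The planar composition with a diagram on the bottom. -/
def stackBot (A : ChNonpos l m) (b : Diag m n) : ChNonpos l n :=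
  ((BN.stack.flip.obj (BN.of b)).mapHomologicalComplex _).obj A

/-- `k` vertical strands on the left of a complex. -/
def padL (k : ℕ) (A : ChNonpos m n) : ChNonpos (k + m) (k + n) :=
  ((BN.padL k).mapHomologicalComplex _).obj A

/-- `k` vertical strands on the right of a complex. -/
def padR (k : ℕ) (A : ChNonpos m n) : ChNonpos (m + k) (n + k) :=
  ((BN.padR k).mapHomologicalComplex _).obj A

/-- The planar composition of two complexes side by side, `A` on the left of `B`. -/
def juxtapose {m' n' : ℕ} (A : ChNonpos m n) (B : ChNonpos m' n') :
    ChNonpos (m + m') (n + n') :=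
  stack (padR m' A) (padL n B)

/-- The same complex as a cochain complex indexed by the integers. -/
def toCochain (A : ChNonpos m n) : CochainComplex (BN m n) ℤ :=
  HomologicalComplex.extend A ComplexShape.embeddingDownNat

end ChNonpos

/-- The part of quantum degree `-l` of the complex `Hom^•(A, B)`: its elements of degree `k` are
the families of morphisms `A i ⟶ q ^ l B (i + k)` of quantum degree `0`, for all `i`, and the
differential is the supercommutator with the differentials of `A` and `B`. -/
def homComplex {m n : ℕ} (A B : CochainComplex (BN m n) ℤ) (l : ℤ) :
    CochainComplex AddCommGrpCat ℤ :=
  CochainComplex.HomComplex A (((BN.qShift l).mapHomologicalComplex _).obj B)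

/-- A universal projector: a complex `P` in non-positive degrees, with the identity diagram `1_n`
in degree zero, such that no shift of `1_n` is a direct summand of any other chain object, and
such that `P` kills turnbacks from above and from below. -/
structure IsUniversalProjector {n : ℕ} (P : ChNonpos n n) : Prop where
  zero : Nonempty (P.X 0 ≅ BN.of (Diag.one n))
  summand : ∀ (k : ℕ) (l : ℤ), 0 < k →
    IsEmpty (Retract ((BN.qShift l).obj (BN.of (Diag.one n))) (P.X k))
  above : ∀ (i : ℕ) (h : i + 2 ≤ n), Contractible (P.stackTop (Diag.capTurn n i h))
  below : ∀ (i : ℕ) (h : i + 2 ≤ n), Contractible (P.stackBot (Diag.cupTurn n i h))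

/-! ### Spin networks -/

/-- Three colors can meet at a trivalent vertex. -/
structure Admissible (a b c : ℕ) : Prop where
  even : Even (a + b + c)
  left : a ≤ b + c
  mid : b ≤ a + c
  right : c ≤ a + b

/-- `k` nested cups, the outermost of which joins the strands in positions `x` and
`x + 2 * k - 1`. -/
def nestedCups (x : ℕ) : ℕ → List Arc
  | 0 => []
  | k + 1 => .cup (x + k) :: nestedCups x k

/-- `k` nested caps, the outermost of which creates the strands in positions `x` and
`x + 2 * k - 1`. -/
def nestedCaps (x : ℕ) : ℕ → List Arc
  | 0 => []
  | k + 1 => nestedCaps x k ++ [.cap (x + k)]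

theorem goes_nestedCups (x y z : ℕ) : Goes (nestedCups x y) (x + 2 * y + z) (x + z) := by
  induction y with
  | zero => exact rfl
  | succ y ih =>
    refine ⟨by omega, ?_⟩
    rw [show x + 2 * (y + 1) + z - 2 = x + 2 * y + z by omega]
    exact ih

theorem goes_nestedCaps (x y z : ℕ) : Goes (nestedCaps x y) (x + z) (x + 2 * y + z) := by
  induction y with
  | zero => exact rfl
  | succ y ih => exact ih.append ⟨by omega, show _ = _ by omega⟩

/-- The planar diagram of a vertex with two edges of colors `a` and `b` above and one edge of
color `i` below: `(a + b - i) / 2` strands connect the two upper edges, and the remaining strands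
of the upper edges continue to the lower one. -/
def vertexDown {a b i : ℕ} (h : Admissible a b i) : Diag (a + b) i :=
  ⟨nestedCups ((a + i - b) / 2) ((a + b - i) / 2), by
    obtain ⟨⟨k, hk⟩, h1, h2, h3⟩ := h
    have := goes_nestedCups ((a + i - b) / 2) ((a + b - i) / 2) ((b + i - a) / 2)
    rwa [show (a + i - b) / 2 + 2 * ((a + b - i) / 2) + (b + i - a) / 2 = a + b by omega,
      show (a + i - b) / 2 + (b + i - a) / 2 = i by omega] at this⟩

/-- The reflection of `vertexDown` in a horizontal line: one edge of color `i` above and two edges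
of colors `a` and `b` below. -/
def vertexUp {a b i : ℕ} (h : Admissible a b i) : Diag i (a + b) :=
  ⟨nestedCaps ((a + i - b) / 2) ((a + b - i) / 2), by
    obtain ⟨⟨k, hk⟩, h1, h2, h3⟩ := h
    have := goes_nestedCaps ((a + i - b) / 2) ((a + b - i) / 2) ((b + i - a) / 2)
    rwa [show (a + i - b) / 2 + 2 * ((a + b - i) / 2) + (b + i - a) / 2 = a + b by omega,
      show (a + i - b) / 2 + (b + i - a) / 2 = i by omega] at this⟩

/-- The categorified spin network in the shape of the letter `I`: the upper edges are colored `a`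
and `b`, the middle edge is colored `i` and the lower edges are colored `c` and `d`.  Every edge of
color `n` carries the projector `P n`. -/
def iNetwork (P : ∀ n, ChNonpos n n) {a b c d i : ℕ} (h : Admissible a b i)
    (h' : Admissible c d i) : ChNonpos (a + b) (c + d) :=
  ((((P a).juxtapose (P b)).stackBot (vertexDown h)).stack (P i)).stack
    (((P c).juxtapose (P d)).stackTop (vertexUp h'))

end BarNatan

end

noncomputable section

namespace BarNatan

/-! ### Contractible complexes -/

section Contractible

variable {V W : Type*} [Category* V] [Category* W] [Preadditive V] [Preadditive W]
  {ι : Type*} {c : ComplexShape ι}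

/-! The network I_j is cut at its middle edge of color j, so each of its chain objects is a finite
sum of shifted diagrams x ⊗ y, where x ends and y begins at j points. Reflecting y in a horizontal
line gives a dual diagram y* from c + d to j points, and a triangle identity makes Hom(x ⊗ y, I_i),
up to a shift, a retract of Hom(x, I_i ⊗ y*). It is therefore enough that I_i ⊗ t is contractible
for every diagram t from c + d to j points (`contractible_homFrom_stack`).

In I_i ⊗ t everything below P_i is made of diagrams with i end points on the top and j < i on the
bottom. Some strand of such a diagram has to turn back to P_i. Concretely, a cup directly below a
cap can be moved above it by an isotopy, cancelled with it, or closed up with it to a circle, which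
neck cutting removes; in the end the word starts with a cup, and P_i kills turnbacks from below
(`killed_of_turnbacks`). The pieces are put together by `killed_stack` and `Killed.stack_right`.

Two passages from pieces to a whole complex use one perturbation argument. The contracting
homotopies of the pieces give a candidate homotopy, whose associated null-homotopic map is 1 + N,
where N moves one step in a filtration. If 1 + N is invertible, the identity is null-homotopic. In a
total complex the antidiagonals are finite and N is nilpotent in each degree
(`contractible_of_rows`). In Hom(I_j, I_i) the component of N z at p depends only on the component
of z at p + 1; since I_j vanishes in positive degrees, the geometric series for the inverse of 1 + N
is finite at every p, although the complex is an infinite product and N need not be nilpotent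
(`contractible_homComplex`).

Direct sum decompositions enter as identities written as finite sums of maps through other objects
(`contractible_of_sum`). The topological input, namely that isotopies are invertible and that caps
and cups are dual, is the statement that certain movies of two steps sweep out a product surface
(`Movie.homeomorphic_nil`). -/

theorem Contractible.map {K : HomologicalComplex V c} (h : Contractible K) (F : V ⥤ W)
    [F.Additive] : Contractible ((F.mapHomologicalComplex c).obj K) := by
  obtain ⟨h⟩ := h
  exact ⟨(Homotopy.ofEq (by simp)).trans ((F.mapHomotopy h).trans (Homotopy.ofEq (by simp)))⟩

/-- Composing the null homotopy with the inverse of `f` gives one for the identity. A candidate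
homotopy thus only has to give the identity up to an invertible error. -/
theorem contractible_of_homotopy_of_isIso {K : HomologicalComplex V c} {f : K ⟶ K} [IsIso f]
    (h : Homotopy f 0) : Contractible K :=
  ⟨(Homotopy.ofEq (by simp)).trans ((h.compRight (inv f)).trans (Homotopy.ofEq (by simp)))⟩

theorem Contractible.of_factor {K L : HomologicalComplex V c} (hL : Contractible L) (φ : K ⟶ L)
    (ψ : L ⟶ K) : Nonempty (Homotopy (φ ≫ ψ) 0) := by
  obtain ⟨h⟩ := hL
  exact ⟨(Homotopy.ofEq (by simp)).trans (((h.compLeft φ).compRight ψ).trans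
    (Homotopy.ofEq (by simp)))⟩

/-- Each summand factors through a contractible complex, hence is null-homotopic, and homotopies
add. The `L t` need not form a direct sum decomposition of `K`: the maps `ψ t ≫ φ t'` are
unrestricted. -/
theorem contractible_of_sum {K : HomologicalComplex V c} {T : Type*} (s : Finset T)
    (L : T → HomologicalComplex V c) (φ : ∀ t, K ⟶ L t) (ψ : ∀ t, L t ⟶ K)
    (h : ∑ t ∈ s, φ t ≫ ψ t = 𝟙 K) (hL : ∀ t ∈ s, Contractible (L t)) : Contractible K := by
  classical
  rw [Contractible, ← h]
  clear h
  induction s using Finset.induction_on with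
  | empty => exact ⟨Homotopy.ofEq (by simp)⟩
  | insert a s ha ih =>
    obtain ⟨h1⟩ := ih (fun t ht => hL t (Finset.mem_insert_of_mem ht))
    obtain ⟨h2⟩ := (hL a (Finset.mem_insert_self a s)).of_factor (φ a) (ψ a)
    exact ⟨(Homotopy.ofEq (Finset.sum_insert ha)).trans ((h2.add h1).trans
      (Homotopy.ofEq (add_zero 0)))⟩

theorem Contractible.of_retract {K L : HomologicalComplex V c} (hL : Contractible L) (φ : K ⟶ L)
    (ψ : L ⟶ K) (h : φ ≫ ψ = 𝟙 K) : Contractible K := by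
  obtain ⟨h'⟩ := hL.of_factor φ ψ
  exact ⟨(Homotopy.ofEq h.symm).trans h'⟩

theorem Contractible.of_iso {K L : HomologicalComplex V c} (hL : Contractible L) (e : K ≅ L) :
    Contractible K :=
  hL.of_retract e.hom e.inv e.hom_inv_id

/-- A finite sum of functors through contractible complexes is contractible. -/
theorem contractible_map_of_sum {K : HomologicalComplex V c} {T : Type*} (s : Finset T)
    (F : V ⥤ W) [F.Additive] (G : T → V ⥤ W) [∀ t, (G t).Additive] (φ : ∀ t, F ⟶ G t)
    (ψ : ∀ t, G t ⟶ F) (h : ∀ X, ∑ t ∈ s, (φ t).app X ≫ (ψ t).app X = 𝟙 (F.obj X))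
    (hL : ∀ t ∈ s, Contractible (((G t).mapHomologicalComplex c).obj K)) :
    Contractible ((F.mapHomologicalComplex c).obj K) := by
  refine contractible_of_sum s (fun t => ((G t).mapHomologicalComplex c).obj K)
    (fun t => (NatTrans.mapHomologicalComplex (φ t) c).app K)
    (fun t => (NatTrans.mapHomologicalComplex (ψ t) c).app K) ?_ hL
  ext i
  exact (map_sum (HomologicalComplex.Hom.fAddMonoidHom (C₁ := (F.mapHomologicalComplex c).obj K)
    (C₂ := (F.mapHomologicalComplex c).obj K) i) _ _).trans (h (K.X i))

theorem contractible_map_of_iso {K : HomologicalComplex V c} {F G : V ⥤ W} [F.Additive]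
    [G.Additive] (e : F ≅ G) (h : Contractible ((G.mapHomologicalComplex c).obj K)) :
    Contractible ((F.mapHomologicalComplex c).obj K) :=
  h.of_iso ((NatIso.mapHomologicalComplex e c).app K)

end Contractible

/-! ### Passage from chain complexes indexed by ℕ to cochain complexes indexed by ℤ -/

section Extend

variable {V W : Type*} [Category* V] [Category* W] [Preadditive V] [Preadditive W]
  [HasZeroObject V] [HasZeroObject W]
  {ι ι' : Type*} {c : ComplexShape ι} {c' : ComplexShape ι'} (e : c.Embedding c')

theorem Contractible.extend [e.IsRelIff] {K : HomologicalComplex V c} (h : Contractible K) :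
    Contractible (K.extend e) := by
  obtain ⟨h⟩ := h
  exact ⟨(Homotopy.ofEq (by simp)).trans ((h.extend e).trans (Homotopy.ofEq (by simp)))⟩

open scoped Classical in
/-- The extension of a complex commutes with additive functors. -/
def mapExtendXIso (F : V ⥤ W) [F.Additive] (K : HomologicalComplex V c) (i' : ι') :
    F.obj ((K.extend e).X i') ≅ (((F.mapHomologicalComplex c).obj K).extend e).X i' :=
  if h : ∃ i, e.f i = i' then
    F.mapIso (K.extendXIso e h.choose_spec) ≪≫
      (((F.mapHomologicalComplex c).obj K).extendXIso e h.choose_spec).symm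
  else
    (F.map_isZero (K.isZero_extend_X e i' (by tauto))).iso
      (((F.mapHomologicalComplex c).obj K).isZero_extend_X e i' (by tauto))

theorem mapExtendXIso_hom (F : V ⥤ W) [F.Additive] (K : HomologicalComplex V c) {i' : ι'} {i : ι}
    (hi : e.f i = i') :
    (mapExtendXIso e F K i').hom = F.map (K.extendXIso e hi).hom ≫
      (((F.mapHomologicalComplex c).obj K).extendXIso e hi).inv := by
  have h : ∃ i, e.f i = i' := ⟨i, hi⟩
  rw [mapExtendXIso, dif_pos h]
  obtain rfl : h.choose = i := e.injective_f (h.choose_spec.trans hi.symm)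
  rfl

def mapExtendIso (F : V ⥤ W) [F.Additive] (K : HomologicalComplex V c) :
    (F.mapHomologicalComplex c').obj (K.extend e) ≅
      ((F.mapHomologicalComplex c).obj K).extend e :=
  HomologicalComplex.Hom.isoOfComponents (mapExtendXIso e F K) (by
    intro i' j' _
    by_cases hi : ∃ i, e.f i = i'
    · by_cases hj : ∃ j, e.f j = j'
      · obtain ⟨i, hi⟩ := hi
        obtain ⟨j, hj⟩ := hj
        rw [mapExtendXIso_hom e F K hi, mapExtendXIso_hom e F K hj,
          HomologicalComplex.extend_d_eq _ e hi hj]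
        simp only [Functor.mapHomologicalComplex_obj_d, K.extend_d_eq e hi hj, Functor.map_comp]
        have key : ∀ {a b b' c c' d : W} (x : a ⟶ b) (i : b' ≅ b) (u : b ⟶ c) (j : d ≅ c)
            (y : c ⟶ c') (z : c' ⟶ c), y ≫ z = 𝟙 c →
            (x ≫ i.inv) ≫ i.hom ≫ u ≫ j.inv = (x ≫ u ≫ y) ≫ z ≫ j.inv := by
          intro a b b' c c' d x i u j y z h
          simp [reassoc_of% h]
        exact key _ _ _ _ _ _ (F.mapIso (K.extendXIso e hj)).inv_hom_id
      · exact (HomologicalComplex.isZero_extend_X _ e j' (by tauto)).eq_of_tgt _ _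
    · exact (F.map_isZero (K.isZero_extend_X e i' (by tauto))).eq_of_src _ _)

theorem Contractible.map_extend [e.IsRelIff] (F : V ⥤ W) [F.Additive]
    {K : HomologicalComplex V c} (h : Contractible ((F.mapHomologicalComplex c).obj K)) :
    Contractible ((F.mapHomologicalComplex c').obj (K.extend e)) :=
  (h.extend e).of_iso (mapExtendIso e F K)

end Extend

/-! ### Filtered complexes -/

section Filtered

variable {V : Type*} [Category* V] [Preadditive V]

/-- A chain complex built from objects `Y p q`, `p + q = n`, in degree `n`, with differential the
sum of `d₁ : Y (p + 1) q ⟶ Y p q` and `d₂ : Y p (q + 1) ⟶ Y p q`, is contractible if all the rows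
`(Y · q, d₁)` are. -/
theorem contractible_of_rows (K : ChainComplex V ℕ) (Y : ℕ → ℕ → V)
    (inc : ∀ p q n, p + q = n → (Y p q ⟶ K.X n))
    (desc : ∀ (n : ℕ) (T : V) (f : ∀ p q, p + q = n → (Y p q ⟶ T)),
      ∃ g : K.X n ⟶ T, ∀ p q h, inc p q n h ≫ g = f p q h)
    (ext : ∀ (n : ℕ) (T : V) (g g' : K.X n ⟶ T),
      (∀ p q h, inc p q n h ≫ g = inc p q n h ≫ g') → g = g')
    (d₁ : ∀ p q, Y (p + 1) q ⟶ Y p q) (d₂ : ∀ p q, Y p (q + 1) ⟶ Y p q)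
    (hd : ∀ p q n (h : p + 1 + (q + 1) = n + 1), inc (p + 1) (q + 1) (n + 1) h ≫ K.d (n + 1) n =
      d₁ p (q + 1) ≫ inc p (q + 1) n (by omega) + d₂ (p + 1) q ≫ inc (p + 1) q n (by omega))
    (hd₁ : ∀ p n (h : p + 1 + 0 = n + 1), inc (p + 1) 0 (n + 1) h ≫ K.d (n + 1) n =
      d₁ p 0 ≫ inc p 0 n (by omega))
    (hd₂ : ∀ q n (h : 0 + (q + 1) = n + 1), inc 0 (q + 1) (n + 1) h ≫ K.d (n + 1) n =
      d₂ 0 q ≫ inc 0 q n (by omega))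
    (s : ∀ p q, Y p q ⟶ Y (p + 1) q)
    (hs₀ : ∀ q, s 0 q ≫ d₁ 0 q = 𝟙 _)
    (hs : ∀ p q, d₁ p q ≫ s p q + s (p + 1) q ≫ d₁ (p + 1) q = 𝟙 _) :
    Contractible K := by
  -- The row homotopies `s`, assembled on the summands, form the candidate homotopy for `K`; it
  -- ignores `d₂`.
  choose h hh using fun n => desc n (K.X (n + 1))
    (fun p q e => s p q ≫ inc (p + 1) q (n + 1) (by omega))
  let hom : ∀ i j, K.X i ⟶ K.X j := fun i j =>
    if e : i + 1 = j then h i ≫ eqToHom (by rw [e]) else 0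
  have hom_succ : ∀ n, hom n (n + 1) = h n := fun n => by simp [hom]
  let f := Homotopy.nullHomotopicMap hom
  have hf : Homotopy f 0 := Homotopy.nullHomotopy hom (fun i j hij => dif_neg hij)
  have f_zero : f.f 0 = h 0 ≫ K.d 1 0 := by
    rw [← hom_succ]
    exact Homotopy.nullHomotopicMap_f_of_not_rel_left (by simp) (by simp) _
  have f_succ : ∀ n, f.f (n + 1) = K.d (n + 1) n ≫ h n + h (n + 1) ≫ K.d (n + 2) (n + 1) := by
    intro n
    rw [← hom_succ, ← hom_succ]
    exact Homotopy.nullHomotopicMap_f (by simp) (by simp) _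
  -- The row identities turn the `d₁` part of `f` into the identity. The error is `d₂ s + s d₂`,
  -- which maps `Y p q` to `Y (p + 1) (q - 1)` and vanishes for `q = 0`. No commutation between `d₁`
  -- and `d₂` is needed.
  have key : ∀ n, ∀ p q, ∀ e : p + q = n, (q = 0 ∧ inc p q n e ≫ (f.f n - 𝟙 _) = 0) ∨
      ∃ q' g, ∃ e' : q = q' + 1,
        inc p q n e ≫ (f.f n - 𝟙 _) = g ≫ inc (p + 1) q' n (by omega) := by
    intro n p q e
    rcases n with _ | n
    · obtain rfl : p = 0 := by omega
      obtain rfl : q = 0 := by omega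
      left
      refine ⟨rfl, ?_⟩
      rw [Preadditive.comp_sub, f_zero, ← Category.assoc, hh, Category.assoc, hd₁,
        ← Category.assoc, hs₀]
      simp
    · rcases q with _ | q
      · left
        refine ⟨rfl, ?_⟩
        obtain rfl : p = n + 1 := by omega
        rw [Preadditive.comp_sub, f_succ, Preadditive.comp_add, ← Category.assoc,
          ← Category.assoc, hh, hd₁, Category.assoc, Category.assoc, hh, hd₁, ← Category.assoc,
          ← Category.assoc, ← Preadditive.add_comp, hs]
        simp
      · right
        rcases p with _ | p
        · refine ⟨q, d₂ 0 q ≫ s 0 q + s 0 (q + 1) ≫ d₂ 1 q, rfl, ?_⟩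
          rw [Preadditive.comp_sub, f_succ, Preadditive.comp_add, ← Category.assoc,
            ← Category.assoc, hh, hd₂, Category.assoc, Category.assoc, hh, hd,
            Preadditive.comp_add, ← Category.assoc (s 0 (q + 1)) (d₁ 0 (q + 1)), hs₀]
          simp only [Preadditive.add_comp, Category.assoc, Category.comp_id, Category.id_comp]
          abel
        · refine ⟨q, d₂ (p + 1) q ≫ s (p + 1) q + s (p + 1) (q + 1) ≫ d₂ (p + 2) q, rfl, ?_⟩
          rw [Preadditive.comp_sub, f_succ, Preadditive.comp_add, ← Category.assoc,
            ← Category.assoc, hh, hd, Preadditive.add_comp, Category.assoc, Category.assoc,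
            Category.assoc, hh, hh, hd, Preadditive.comp_add,
            ← Category.assoc (d₁ p (q + 1)), ← Category.assoc (s (p + 1) (q + 1)) (d₁ _ _)]
          have := congrArg (· ≫ inc (p + 1) (q + 1) (n + 1) e) (hs p (q + 1))
          simp only [Preadditive.add_comp, Category.id_comp] at this
          simp only [Preadditive.add_comp, Category.assoc, Category.comp_id] at this ⊢
          rw [← sub_eq_zero] at this ⊢
          rw [← this]
          abel
  -- Each application of the error lowers `q`, so `q + 1` of them kill `Y p q`; as `q ≤ n`, the
  -- exponent `n + 1` works for all summands of degree `n`.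
  have nil : ∀ n, IsNilpotent (show End (K.X n) from f.f n - 𝟙 _) := by
    intro n
    have : ∀ q p (e : p + q = n),
        inc p q n e ≫ ((show End (K.X n) from f.f n - 𝟙 _) ^ (q + 1) : End (K.X n)) = 0 := by
      intro q
      induction q with
      | zero =>
        intro p e
        rcases key n p 0 e with ⟨_, h1⟩ | ⟨q', g, e', _⟩
        · rw [zero_add, pow_one]; exact h1
        · omega
      | succ q ih =>
        intro p e
        rw [pow_succ, End.mul_def, ← Category.assoc]
        rcases key n p (q + 1) e with ⟨h0, h1⟩ | ⟨q', g, e', h1⟩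
        · omega
        · obtain rfl : q = q' := by omega
          rw [h1, Category.assoc, ih, comp_zero]
    refine ⟨n + 1, ext n _ _ _ fun p q e => ?_⟩
    rw [show n + 1 = p + (q + 1) by omega, pow_add, End.mul_def, ← Category.assoc, this,
      zero_comp]
    exact comp_zero.symm
  have : ∀ n, IsIso (f.f n) := fun n => by
    have h1 := (nil n).isUnit_one_add
    have h2 : (1 : End (K.X n)) + (show End (K.X n) from f.f n - 𝟙 _) = f.f n :=
      add_sub_cancel (𝟙 _) (f.f n)
    rw [h2] at h1
    exact (isUnit_iff_isIso (C := V) (f.f n)).1 h1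
  have : IsIso f := HomologicalComplex.Hom.isIso_of_components f
  exact contractible_of_homotopy_of_isIso hf

end Filtered

/-! ### Total complexes -/

section Total

variable {C₁ C₂ D E : Type*} [Category* C₁] [Category* C₂] [Category* D] [Category* E]
  [Preadditive C₁] [Preadditive C₂] [Preadditive D] [Preadditive E]
  (F : C₁ ⥤ C₂ ⥤ D) [F.Additive] [∀ X, (F.obj X).Additive]
  (A : ChainComplex C₁ ℕ) (B : ChainComplex C₂ ℕ)
  [HomologicalComplex.HasMapBifunctor A B F (ComplexShape.down ℕ)]

open HomologicalComplex

/-- The projection of a total complex to one of its summands. -/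
def totalProj (n p q : ℕ) : (mapBifunctor A B F (ComplexShape.down ℕ)).X n ⟶
    (F.obj (A.X p)).obj (B.X q) :=
  mapBifunctorDesc (fun p' q' _ => if h : p' = p ∧ q' = q then
    eqToHom (by rw [h.1, h.2]) else 0)

/-- The inclusion of a summand of a total complex. -/
def totalInc (p q n : ℕ) (h : p + q = n) : (F.obj (A.X p)).obj (B.X q) ⟶
    (mapBifunctor A B F (ComplexShape.down ℕ)).X n :=
  ιMapBifunctor A B F (ComplexShape.down ℕ) p q n h

theorem totalInc_proj_self (p q n : ℕ) (h : p + q = n) :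
    totalInc F A B p q n h ≫ totalProj F A B n p q = 𝟙 _ := by
  simp [totalInc, totalProj]

theorem totalInc_proj_of_ne {p q p' q' : ℕ} (n : ℕ) (h : p + q = n) (h' : ¬ (p = p' ∧ q = q')) :
    totalInc F A B p q n h ≫ totalProj F A B n p' q' = 0 := by
  simp [totalInc, totalProj, h']

theorem sum_totalProj_inc (n : ℕ) :
    ∑ x ∈ (Finset.HasAntidiagonal.antidiagonal n).attach, totalProj F A B n x.1.1 x.1.2 ≫
      totalInc F A B x.1.1 x.1.2 n (Finset.HasAntidiagonal.mem_antidiagonal.1 x.2) = 𝟙 _ := by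
  refine mapBifunctor.hom_ext (fun p q h => ?_)
  change totalInc F A B p q n h ≫ _ = totalInc F A B p q n h ≫ _
  rw [Preadditive.comp_sum, Finset.sum_eq_single ⟨(p, q), Finset.HasAntidiagonal.mem_antidiagonal.2 h⟩]
  · rw [← Category.assoc, totalInc_proj_self, Category.id_comp, Category.comp_id]
  · intro x _ hx
    rw [← Category.assoc, totalInc_proj_of_ne, zero_comp]
    rintro ⟨h1, h2⟩
    exact hx (Subtype.ext (Prod.ext h1.symm h2.symm))
  · intro h'
    exact absurd (Finset.mem_attach _ _) h'

theorem totalInc_d_succ_succ (p q n : ℕ) (h : p + 1 + (q + 1) = n + 1) :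
    totalInc F A B (p + 1) (q + 1) (n + 1) h ≫
      (mapBifunctor A B F (ComplexShape.down ℕ)).d (n + 1) n =
    (F.map (A.d (p + 1) p)).app (B.X (q + 1)) ≫ totalInc F A B p (q + 1) n (by omega) +
      ((-1 : ℤˣ) ^ (p + 1) • (F.obj (A.X (p + 1))).map (B.d (q + 1) q)) ≫
        totalInc F A B (p + 1) q n (by omega) := by
  rw [totalInc, mapBifunctor.d_eq, Preadditive.comp_add, mapBifunctor.ι_D₁, mapBifunctor.ι_D₂,
    mapBifunctor.d₁_eq A B F (ComplexShape.down ℕ) (show p + 1 = p + 1 from rfl) (q + 1) n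
      (show p + (q + 1) = n by omega),
    mapBifunctor.d₂_eq A B F (ComplexShape.down ℕ) (p + 1) (show q + 1 = q + 1 from rfl) n
      (show p + 1 + q = n by omega)]
  rw [show ComplexShape.ε₁ (ComplexShape.down ℕ) (ComplexShape.down ℕ) (ComplexShape.down ℕ)
      (p + 1, q + 1) = 1 from rfl, show ComplexShape.ε₂ (ComplexShape.down ℕ)
      (ComplexShape.down ℕ) (ComplexShape.down ℕ) (p + 1, q + 1) = (-1) ^ (p + 1) from rfl,
    one_smul, Linear.units_smul_comp]
  rfl

theorem totalInc_d_succ_zero (p n : ℕ) (h : p + 1 + 0 = n + 1) :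
    totalInc F A B (p + 1) 0 (n + 1) h ≫
      (mapBifunctor A B F (ComplexShape.down ℕ)).d (n + 1) n =
    (F.map (A.d (p + 1) p)).app (B.X 0) ≫ totalInc F A B p 0 n (by omega) := by
  rw [totalInc, mapBifunctor.d_eq, Preadditive.comp_add, mapBifunctor.ι_D₁, mapBifunctor.ι_D₂,
    mapBifunctor.d₁_eq A B F (ComplexShape.down ℕ) (show p + 1 = p + 1 from rfl) 0 n
      (show p + 0 = n by omega),
    mapBifunctor.d₂_eq_zero A B F (ComplexShape.down ℕ) (p + 1) 0 n (by simp)]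
  rw [show ComplexShape.ε₁ (ComplexShape.down ℕ) (ComplexShape.down ℕ) (ComplexShape.down ℕ)
      (p + 1, 0) = 1 from rfl, one_smul, add_zero]
  rfl

theorem totalInc_d_zero_succ (q n : ℕ) (h : 0 + (q + 1) = n + 1) :
    totalInc F A B 0 (q + 1) (n + 1) h ≫
      (mapBifunctor A B F (ComplexShape.down ℕ)).d (n + 1) n =
    ((-1 : ℤˣ) ^ 0 • (F.obj (A.X 0)).map (B.d (q + 1) q)) ≫
        totalInc F A B 0 q n (by omega) := by
  rw [totalInc, mapBifunctor.d_eq, Preadditive.comp_add, mapBifunctor.ι_D₁, mapBifunctor.ι_D₂,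
    mapBifunctor.d₁_eq_zero A B F (ComplexShape.down ℕ) 0 (q + 1) n (by simp),
    mapBifunctor.d₂_eq A B F (ComplexShape.down ℕ) 0 (show q + 1 = q + 1 from rfl) n
      (show 0 + q = n by omega)]
  rw [show ComplexShape.ε₂ (ComplexShape.down ℕ)
      (ComplexShape.down ℕ) (ComplexShape.down ℕ) (0, q + 1) = (-1) ^ 0 from rfl,
    zero_add, Linear.units_smul_comp]
  rfl

variable (G : D ⥤ E) [G.Additive]

/-- An additive functor preserves the finite direct sum in each degree of the total complex, so its
image still has the universal property that `contractible_of_rows` asks for. -/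
theorem map_total_desc (n : ℕ) (T : E)
    (f : ∀ p q, p + q = n → (G.obj ((F.obj (A.X p)).obj (B.X q)) ⟶ T)) :
    ∃ g : G.obj ((mapBifunctor A B F (ComplexShape.down ℕ)).X n) ⟶ T,
      ∀ p q h, G.map (totalInc F A B p q n h) ≫ g = f p q h := by
  refine ⟨∑ x ∈ (Finset.HasAntidiagonal.antidiagonal n).attach, G.map (totalProj F A B n x.1.1 x.1.2) ≫
    f x.1.1 x.1.2 (Finset.HasAntidiagonal.mem_antidiagonal.1 x.2), fun p q h => ?_⟩
  rw [Preadditive.comp_sum, Finset.sum_eq_single ⟨(p, q), Finset.HasAntidiagonal.mem_antidiagonal.2 h⟩]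
  · rw [← G.map_comp_assoc, totalInc_proj_self, G.map_id, Category.id_comp]
  · intro x _ hx
    rw [← G.map_comp_assoc, totalInc_proj_of_ne, G.map_zero, zero_comp]
    rintro ⟨h1, h2⟩
    exact hx (Subtype.ext (Prod.ext h1.symm h2.symm))
  · intro h'
    exact absurd (Finset.mem_attach _ _) h'

theorem map_total_ext (n : ℕ) (T : E)
    (g g' : G.obj ((mapBifunctor A B F (ComplexShape.down ℕ)).X n) ⟶ T)
    (h : ∀ p q h, G.map (totalInc F A B p q n h) ≫ g = G.map (totalInc F A B p q n h) ≫ g') :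
    g = g' := by
  rw [← Category.id_comp g, ← Category.id_comp g', ← G.map_id, ← sum_totalProj_inc, G.map_sum,
    Preadditive.sum_comp, Preadditive.sum_comp]
  refine Finset.sum_congr rfl fun x _ => ?_
  rw [G.map_comp, Category.assoc, Category.assoc, h]

/-- In degree zero no differential leaves the chain complex, so only one of the two terms of the
homotopy identity survives there. -/
theorem Contractible.exists_chain {V : Type*} [Category* V] [Preadditive V]
    {K : ChainComplex V ℕ} (h : Contractible K) : ∃ s : ∀ n, K.X n ⟶ K.X (n + 1),
      s 0 ≫ K.d 1 0 = 𝟙 _ ∧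
      ∀ n, K.d (n + 1) n ≫ s n + s (n + 1) ≫ K.d (n + 2) (n + 1) = 𝟙 _ := by
  obtain ⟨h⟩ := h
  refine ⟨fun n => h.hom n (n + 1), ?_, fun n => ?_⟩
  · have := h.comm 0
    rw [dNext_eq_zero _ _ (by simp), prevD_eq _ (j' := 1) (by simp)] at this
    simpa using this.symm
  · have := h.comm (n + 1)
    rw [dNext_eq _ (i' := n) (by simp), prevD_eq _ (j' := n + 2) (by simp)] at this
    simpa using this.symm

/-- The image of a total complex under an additive functor is contractible if the images of all
the rows are. -/
theorem contractible_map_total_of_rows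
    (h : ∀ q, Contractible (((F.flip.obj (B.X q) ⋙ G).mapHomologicalComplex _).obj A)) :
    Contractible ((G.mapHomologicalComplex _).obj
      (mapBifunctor A B F (ComplexShape.down ℕ))) := by
  choose s hs₀ hs using fun q => (h q).exists_chain
  refine contractible_of_rows _ (fun p q => G.obj ((F.obj (A.X p)).obj (B.X q)))
    (fun p q n h => G.map (totalInc F A B p q n h)) (map_total_desc F A B G)
    (map_total_ext F A B G)
    (fun p q => G.map ((F.map (A.d (p + 1) p)).app (B.X q)))
    (fun p q => G.map ((-1 : ℤˣ) ^ p • (F.obj (A.X p)).map (B.d (q + 1) q)))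
    (fun p q n h => ?_) (fun p n h => ?_) (fun q n h => ?_) (fun p q => s q p) hs₀
    (fun p q => hs q p)
  · erw [← G.map_comp, totalInc_d_succ_succ, G.map_add, G.map_comp, G.map_comp]
    rfl
  · erw [← G.map_comp, totalInc_d_succ_zero, G.map_comp]
    rfl
  · erw [← G.map_comp, totalInc_d_zero_succ, G.map_comp]
    rfl

/-- The image of a total complex under an additive functor is contractible if the images of all
the columns are. -/
theorem contractible_map_total_of_columns
    (h : ∀ p, Contractible (((F.obj (A.X p) ⋙ G).mapHomologicalComplex _).obj B)) :
    Contractible ((G.mapHomologicalComplex _).obj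
      (mapBifunctor A B F (ComplexShape.down ℕ))) := by
  have h' : ∀ p, ∃ s : ∀ n, G.obj ((F.obj (A.X p)).obj (B.X n)) ⟶
      G.obj ((F.obj (A.X p)).obj (B.X (n + 1))),
      s 0 ≫ G.map ((F.obj (A.X p)).map (B.d 1 0)) = 𝟙 _ ∧
      ∀ n, G.map ((F.obj (A.X p)).map (B.d (n + 1) n)) ≫ s n +
        s (n + 1) ≫ G.map ((F.obj (A.X p)).map (B.d (n + 2) (n + 1))) = 𝟙 _ :=
    fun p => (h p).exists_chain
  choose s hs₀ hs using h'
  have sq : ∀ p : ℕ, ((-1 : ℤˣ) ^ p * (-1) ^ p) = 1 := fun p => by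
    rw [← mul_pow]; simp
  -- The roles of `p` and `q` are exchanged. The differential of column `p` carries the Koszul sign
  -- `(-1) ^ p`; giving the homotopy the same sign makes the two cancel.
  refine contractible_of_rows _ (fun q p => G.obj ((F.obj (A.X p)).obj (B.X q)))
    (fun q p n h => G.map (totalInc F A B p q n (by omega)))
    (fun n T f => ?_) (fun n T g g' h => ?_)
    (fun q p => G.map ((-1 : ℤˣ) ^ p • (F.obj (A.X p)).map (B.d (q + 1) q)))
    (fun q p => G.map ((F.map (A.d (p + 1) p)).app (B.X q)))
    (fun q p n h => ?_) (fun q n h => ?_) (fun p n h => ?_) (fun q p => (-1 : ℤˣ) ^ p • s p q)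
    (fun p => ?_) (fun q p => ?_)
  · obtain ⟨g, hg⟩ := map_total_desc F A B G n T (fun p q h => f q p (by omega))
    exact ⟨g, fun q p h => hg p q (by omega)⟩
  · exact map_total_ext F A B G n T g g' (fun p q e => h q p (by omega))
  · erw [← G.map_comp, totalInc_d_succ_succ, G.map_add, G.map_comp, G.map_comp]
    exact add_comm _ _
  · erw [← G.map_comp, totalInc_d_zero_succ, G.map_comp]
    rfl
  · erw [← G.map_comp, totalInc_d_succ_zero, G.map_comp]
    rfl
  · refine Eq.trans ?_ (hs₀ p)
    simp only [Units.smul_def, G.map_zsmul, Preadditive.zsmul_comp, Preadditive.comp_zsmul,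
      smul_smul, ← Units.val_mul, sq, Units.val_one, one_smul]
  · refine Eq.trans ?_ (hs p q)
    simp only [Units.smul_def, G.map_zsmul, Preadditive.zsmul_comp, Preadditive.comp_zsmul,
      smul_smul, ← Units.val_mul, sq, Units.val_one, one_smul]

end Total

/-! ### Complexes of homomorphisms -/

section HomComplex

variable {V : Type*} [Category* V] [Preadditive V]

open CochainComplex.HomComplex

/-- The complex of homomorphisms from an object to a complex. -/
abbrev homFrom (X : V) {ι : Type*} {c : ComplexShape ι} (G : HomologicalComplex V c) :
    HomologicalComplex AddCommGrpCat c :=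
  ((preadditiveCoyoneda.obj (Opposite.op X)).mapHomologicalComplex c).obj G

theorem Contractible.exists_homFrom {G : CochainComplex V ℤ} {X : V}
    (h : Contractible (homFrom X G)) :
    ∃ s : ∀ q q' : ℤ, (X ⟶ G.X q) →+ (X ⟶ G.X q'), ∀ (q q' q'' : ℤ), q + 1 = q' → q' + 1 = q'' →
      ∀ f : X ⟶ G.X q', s q'' q' (f ≫ G.d q' q'') + s q' q f ≫ G.d q q' = f := by
  obtain ⟨h⟩ := h
  refine ⟨fun q q' => (h.hom q q').hom, fun q q' q'' e e' f => ?_⟩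
  have := h.comm q'
  rw [dNext_eq _ (i' := q'') (by simpa using e'), prevD_eq _ (j' := q) (by simpa using e)] at this
  have := ConcreteCategory.congr_hom this f
  exact (add_zero _).symm.trans this.symm

variable (F G : CochainComplex V ℤ)

/-- The complex of homomorphisms from a bounded above complex `F` to `G` is contractible if the
complexes of homomorphisms from the objects of `F` to `G` are. -/
theorem contractible_homComplex (hF : ∀ p : ℤ, 0 < p → IsZero (F.X p))
    (h : ∀ p, Contractible (homFrom (F.X p) G)) :
    Contractible (CochainComplex.HomComplex F G) := by
  choose s hs using fun p => (h p).exists_homFrom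
  -- The candidate homotopy applies the homotopy of Hom(F_p, G) to the component of a cochain at
  -- `p`, for each `p` separately; it ignores the differential of `F`.
  let S : ∀ n m : ℤ, Cochain F G n →+ Cochain F G m := fun n m =>
    { toFun := fun z => Cochain.mk fun p q _ => s p (p + n) q (z.v p (p + n) rfl)
      map_zero' := by ext; simp
      map_add' := by intros; ext; simp }
  have S_v : ∀ (n m : ℤ) (z : Cochain F G n) (p q q' : ℤ) (e : p + m = q) (e' : p + n = q'),
      (S n m z).v p q e = s p q' q (z.v p q' e') := by
    intro n m z p q q' e e'
    subst e'
    rfl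
  let hom : ∀ i j : ℤ, (CochainComplex.HomComplex F G).X i ⟶ (CochainComplex.HomComplex F G).X j :=
    fun i j => if (ComplexShape.up ℤ).Rel j i then AddCommGrpCat.ofHom (S i j) else 0
  have hom_pred : ∀ n m : ℤ, m + 1 = n → hom n m = AddCommGrpCat.ofHom (S n m) :=
    fun n m e => if_pos e
  let f := Homotopy.nullHomotopicMap hom
  have hf : Homotopy f 0 := Homotopy.nullHomotopy hom (fun i j hij => if_neg hij)
  let T : ∀ n : ℤ, Cochain F G n →+ Cochain F G n := fun n => (f.f n).hom
  have f_apply : ∀ (n : ℤ) (z : Cochain F G n), T n z =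
      S (n + 1) n (δ n (n + 1) z) + δ (n - 1) n (S n (n - 1) z) := by
    intro n z
    have := Homotopy.nullHomotopicMap_f (c := ComplexShape.up ℤ) (k₂ := n - 1) (k₁ := n)
      (k₀ := n + 1) (by simp) (by simp) hom
    rw [hom_pred _ _ (by simp), hom_pred _ _ (by simp)] at this
    exact ConcreteCategory.congr_hom this z
  let N : ∀ n : ℤ, Cochain F G n →+ Cochain F G n := fun n => T n - AddMonoidHom.id _
  -- The homotopies `s p` account for the composition with the differential of `G`. The error
  -- consists of the two terms with `F.d p (p + 1)`, so at `p` it only sees the component at `p +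
  -- 1`.
  have N_local : ∀ (n : ℤ) (p q q' : ℤ) (e : p + n = q) (e' : p + 1 + n = q'), ∃
      t : (F.X (p + 1) ⟶ G.X q') →+ (F.X p ⟶ G.X q), ∀ z, (N n z).v p q e = t (z.v (p + 1) q' e') := by
    intro n p q q' e e'
    refine ⟨
      { toFun := fun x => s p q' q ((n + 1).negOnePow • F.d p (p + 1) ≫ x) +
          n.negOnePow • F.d p (p + 1) ≫ s (p + 1) q' q x
        map_zero' := by simp
        map_add' := by intros; simp only [Preadditive.comp_add, smul_add, map_add]; abel }, ?_⟩
    intro z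
    have h1 : N n z = T n z - z := rfl
    rw [h1, f_apply, Cochain.sub_v, Cochain.add_v, S_v _ _ _ p q q' e (by omega),
      δ_v n (n + 1) rfl z p q' (by omega) q (p + 1) (by omega) rfl,
      δ_v (n - 1) n (by omega) _ p q e (q - 1) (p + 1) rfl rfl, map_add,
      S_v n (n - 1) z p (q - 1) q (by omega) e, S_v n (n - 1) z (p + 1) q q' (by omega) e']
    have h2 := hs p (q - 1) q q' (by omega) (by omega) (z.v p q e)
    change _ = s p q' q ((n + 1).negOnePow • F.d p (p + 1) ≫ z.v (p + 1) q' e') +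
          n.negOnePow • F.d p (p + 1) ≫ s (p + 1) q' q (z.v (p + 1) q' e')
    rw [← sub_eq_zero] at h2 ⊢
    rw [← h2]
    abel
  -- `k` applications of the error look at the component at `p + k`, which is zero once `p + k` is
  -- positive.
  have N_pow : ∀ (n : ℤ) (k : ℕ) (z : Cochain F G n) (p q : ℤ) (e : p + n = q), 0 < p + k →
      (((N n)^[k]) z).v p q e = 0 := by
    intro n k
    induction k with
    | zero => intro z p q e hp; exact (hF p (by simpa using hp)).eq_of_src _ _
    | succ k ih =>
      intro z p q e hp
      obtain ⟨t, ht⟩ := N_local n p q (q + 1) e (by omega)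
      rw [Function.iterate_succ_apply', ht, ih z _ _ _ (by push_cast at hp; omega), map_zero]
  have f_eq : ∀ (n : ℤ) (z : Cochain F G n), T n z = z + N n z :=
    fun n z => (add_sub_cancel z (T n z)).symm
  -- `T = 1 + N`, where `N` is nilpotent at each `p` but with no bound uniform in `p`; this still
  -- suffices for bijectivity on families of components.
  have f_bij : ∀ n, Function.Bijective (T n) := by
    intro n
    constructor
    · rw [injective_iff_map_eq_zero]
      intro z hz
      rw [f_eq, add_eq_zero_iff_eq_neg] at hz
      -- On the kernel `N` is `-1`, so all iterates of `N` on `z` are `z` or `-z`, while each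
      -- component of a high iterate vanishes.
      have hz' : N n z = -z := by rw [hz, neg_neg, ← hz]
      have hk : ∀ k, ((N n)^[k]) z = z ∨ ((N n)^[k]) z = -z := by
        intro k
        induction k with
        | zero => exact Or.inl rfl
        | succ k ih =>
          rw [Function.iterate_succ_apply']
          rcases ih with ih | ih <;> rw [ih]
          · exact Or.inr hz'
          · rw [map_neg, hz', neg_neg]; exact Or.inl rfl
      refine Cochain.ext _ _ fun p q e => ?_
      have h0 := N_pow n (1 - p).toNat z p q e (by omega)
      rcases hk (1 - p).toNat with h1 | h1 <;> rw [h1] at h0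
      · exact h0
      · rw [Cochain.neg_v, neg_eq_zero] at h0; exact h0
    · intro w
      -- Partial sums of the geometric series for the inverse of `1 + N`. By `y_v` below, the
      -- component at `p` no longer changes once `p + K` is positive.
      let y : ℕ → Cochain F G n := fun K => ∑ k ∈ Finset.range K, ((-(N n))^[k]) w
      have hy : ∀ K, y K + N n (y K) = w - ((-(N n))^[K]) w := by
        intro K
        induction K with
        | zero => simp [y]
        | succ K ih =>
          have : y (K + 1) = y K + ((-(N n))^[K]) w := Finset.sum_range_succ _ _
          rw [this, map_add, add_add_add_comm, ih, Function.iterate_succ_apply',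
            AddMonoidHom.neg_apply]
          abel
      have neg_pow : ∀ (k : ℕ) (p q : ℤ) (e : p + n = q), 0 < p + k →
          (((-(N n))^[k]) w).v p q e = 0 := by
        intro k p q e hp
        have : ∀ k, ((-(N n))^[k]) w = ((N n)^[k]) w ∨ ((-(N n))^[k]) w = -((N n)^[k]) w := by
          intro k
          induction k with
          | zero => exact Or.inl rfl
          | succ k ih =>
            rw [Function.iterate_succ_apply', Function.iterate_succ_apply',
              AddMonoidHom.neg_apply]
            rcases ih with ih | ih <;> rw [ih]
            · exact Or.inr rfl
            · rw [map_neg, neg_neg]; exact Or.inl rfl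
        rcases this k with h1 | h1 <;> rw [h1]
        · exact N_pow n k w p q e hp
        · rw [Cochain.neg_v, N_pow n k w p q e hp, neg_zero]
      have y_v : ∀ (K : ℕ) (j : ℕ) (p q : ℤ) (e : p + n = q), 0 < p + K →
          (y (K + j)).v p q e = (y K).v p q e := by
        intro K j p q e hp
        induction j with
        | zero => rfl
        | succ j ih =>
          have : y (K + j + 1) = y (K + j) + ((-(N n))^[K + j]) w := Finset.sum_range_succ _ _
          rw [← add_assoc, this, Cochain.add_v, ih, neg_pow _ _ _ _ (by push_cast; omega),
            add_zero]
      -- The limit of the series: `1 - p` terms suffice at `p`. For positive `p` the truncated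
      -- subtraction leaves no terms, which is right because the component is zero.
      let x : Cochain F G n := Cochain.mk fun p q e => (y (1 - p).toNat).v p q e
      refine ⟨x, Cochain.ext _ _ fun p q e => ?_⟩
      have h1 : x.v p q e = (y (1 - p).toNat).v p q e := rfl
      obtain ⟨t, ht⟩ := N_local n p q (q + 1) e (by omega)
      -- `T x` at `p` also involves `x` at `p + 1`, defined with fewer terms; stability allows the
      -- same partial sum to be used at both places.
      have h2 : x.v (p + 1) (q + 1) (by omega) =
          (y (1 - p).toNat).v (p + 1) (q + 1) (by omega) := by
        obtain ⟨j, hj⟩ : ∃ j, (1 - p).toNat = (1 - (p + 1)).toNat + j :=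
          Nat.exists_eq_add_of_le (by omega)
        rw [hj, y_v _ _ _ _ _ (by omega)]
        rfl
      rw [f_eq, Cochain.add_v, ht, h1, h2, ← ht, ← Cochain.add_v, hy, Cochain.sub_v,
        neg_pow _ _ _ _ (by omega), sub_zero]
  have : ∀ n, IsIso (f.f n) := fun n => by
    rw [ConcreteCategory.isIso_iff_bijective]
    exact f_bij n
  have : IsIso f := HomologicalComplex.Hom.isIso_of_components f
  exact contractible_of_homotopy_of_isIso hf

end HomComplex

/-! ### Complexes of homomorphisms from an object -/

section HomFrom

variable {V : Type*} [Category* V] [Preadditive V] {ι : Type*} {c : ComplexShape ι}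
  {G : HomologicalComplex V c}

/-- Precomposition is contravariant, so Hom(X, -) maps to Hom(Y t, -) by `ψ t` and back by `φ t`,
and the sum of the round trips is still the identity. -/
theorem contractible_homFrom_of_sum {X : V} {T : Type*} (s : Finset T) (Y : T → V)
    (φ : ∀ t, X ⟶ Y t) (ψ : ∀ t, Y t ⟶ X) (h : ∑ t ∈ s, φ t ≫ ψ t = 𝟙 X)
    (hY : ∀ t ∈ s, Contractible (homFrom (Y t) G)) : Contractible (homFrom X G) := by
  refine contractible_map_of_sum s _ (fun t => preadditiveCoyoneda.obj (Opposite.op (Y t)))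
    (fun t => preadditiveCoyoneda.map (ψ t).op) (fun t => preadditiveCoyoneda.map (φ t).op)
    (fun Z => ?_) hY
  ext f
  let ev : ((preadditiveCoyoneda.obj (Opposite.op X)).obj Z ⟶
      (preadditiveCoyoneda.obj (Opposite.op X)).obj Z) →+ (X ⟶ Z) :=
    { toFun := fun g => g.hom f
      map_zero' := rfl
      map_add' := fun _ _ => rfl }
  have key : ∀ f : X ⟶ Z, ∑ t ∈ s, φ t ≫ ψ t ≫ f = f := fun f => by
    simp_rw [← Category.assoc, ← Preadditive.sum_comp, h, Category.id_comp]
  exact (map_sum ev _ _).trans (key f)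

theorem Contractible.homFrom (h : Contractible G) (X : V) : Contractible (homFrom X G) :=
  h.map _

end HomFrom

/-! ### Formal direct sums -/

section Mat

variable {C D E : Type} [Category.{0} C] [Category.{0} D] [Category.{0} E]
  [Preadditive C] [Preadditive D] [Preadditive E]

/-- The projection of a formal direct sum to one of its summands. -/
def matProj (M : Mat_ C) (i : M.ι) : M ⟶ (Mat_.embedding C).obj (M.X i) :=
  fun j _ => (𝟙 M : M ⟶ M) j i

/-- The inclusion of a summand of a formal direct sum. -/
def matInc (M : Mat_ C) (i : M.ι) : (Mat_.embedding C).obj (M.X i) ⟶ M :=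
  fun _ j => (𝟙 M : M ⟶ M) i j

theorem sum_matProj_inc (M : Mat_ C) : ∑ i, matProj M i ≫ matInc M i = 𝟙 M := by
  conv_rhs => rw [← Category.id_comp (𝟙 M)]
  ext j k
  rw [Mat_.comp_apply]
  let ev : (M ⟶ M) →+ (M.X j ⟶ M.X k) :=
    { toFun := fun g => g j k
      map_zero' := rfl
      map_add' := fun _ _ => rfl }
  refine (map_sum ev _ _).trans (Finset.sum_congr rfl fun i _ => ?_)
  change ∑ _ : PUnit, (𝟙 M : M ⟶ M) j i ≫ (𝟙 M : M ⟶ M) i k = _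
  simp

theorem sum_map_comp_map (F : C ⥤ D) [F.Additive] {M N K : Mat_ C} (f : M ⟶ N) (g : N ⟶ K)
    (i : M.ι) (k : K.ι) : ∑ j : N.ι, F.map (f i j) ≫ F.map (g j k) = F.map ((f ≫ g) i k) := by
  rw [Mat_.comp_apply, F.map_sum]
  simp only [F.map_comp]

/-- The natural transformation of functors between categories of formal direct sums induced by a
natural transformation. -/
def mapMatNat {F G : C ⥤ D} [F.Additive] [G.Additive] (τ : F ⟶ G) : F.mapMat_ ⟶ G.mapMat_ where
  -- The entry of the identity matrix makes this the diagonal matrix of the components of `τ`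
  -- without deciding equality of indices.
  app M := fun i j => τ.app (M.X i) ≫ G.map ((𝟙 M : M ⟶ M) i j)
  naturality M N f := by
    refine Mat_.hom_ext _ _ (fun (i : M.ι) (k : N.ι) => ?_)
    change ∑ j : N.ι, F.map (f i j) ≫ τ.app (N.X j) ≫ G.map ((𝟙 N : N ⟶ N) j k) =
      ∑ j : M.ι, (τ.app (M.X i) ≫ G.map ((𝟙 M : M ⟶ M) i j)) ≫ G.map (f j k)
    simp only [τ.naturality_assoc, Category.assoc]
    rw [← Preadditive.comp_sum, ← Preadditive.comp_sum, sum_map_comp_map, sum_map_comp_map,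
      Category.id_comp, Category.comp_id]

theorem mapMatNat_app_embedding {F G : C ⥤ D} [F.Additive] [G.Additive] (τ : F ⟶ G) (X : C) :
    (mapMatNat τ).app ((Mat_.embedding C).obj X) = (Mat_.embedding D).map (τ.app X) := by
  refine Mat_.hom_ext _ _ (fun (i : PUnit) (j : PUnit) => ?_)
  have h : (𝟙 ((Mat_.embedding C).obj X) : _ ⟶ _) = (Mat_.embedding C).map (𝟙 X) :=
    ((Mat_.embedding C).map_id X).symm
  have h1 : ∀ (g : (Mat_.embedding C).obj X ⟶ (Mat_.embedding C).obj X),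
      g = (Mat_.embedding C).map (𝟙 X) → τ.app X ≫ G.map (show X ⟶ X from g i j) = τ.app X := by
    intro g hg
    subst hg
    exact (congrArg (τ.app X ≫ ·) (G.map_id X)).trans (Category.comp_id _)
  exact h1 _ h

theorem mapMatNat_id (F : C ⥤ D) [F.Additive] : mapMatNat (𝟙 F) = 𝟙 F.mapMat_ := by
  ext M : 2
  refine Eq.trans ?_ (F.mapMat_.map_id M)
  refine Mat_.hom_ext _ _ (fun (i : M.ι) (j : M.ι) => ?_)
  exact Category.id_comp _

theorem mapMatNat_comp {F G H : C ⥤ D} [F.Additive] [G.Additive] [H.Additive] (τ : F ⟶ G)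
    (σ : G ⟶ H) : mapMatNat (τ ≫ σ) = mapMatNat τ ≫ mapMatNat σ := by
  ext M : 2
  refine Mat_.hom_ext _ _ (fun (i : M.ι) (k : M.ι) => ?_)
  change (τ.app (M.X i) ≫ σ.app (M.X i)) ≫ H.map ((𝟙 M : M ⟶ M) i k) =
    ∑ j : M.ι, (τ.app (M.X i) ≫ G.map ((𝟙 M : M ⟶ M) i j)) ≫ σ.app (M.X j) ≫
      H.map ((𝟙 M : M ⟶ M) j k)
  simp only [Category.assoc, σ.naturality_assoc]
  rw [← Preadditive.comp_sum, ← Preadditive.comp_sum, sum_map_comp_map, Category.comp_id]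

theorem mapMatNat_sum {F G : C ⥤ D} [F.Additive] [G.Additive] {T : Type*} (s : Finset T)
    (τ : T → (F ⟶ G)) : mapMatNat (∑ t ∈ s, τ t) = ∑ t ∈ s, mapMatNat (τ t) := by
  let Φ : (F ⟶ G) →+ (F.mapMat_ ⟶ G.mapMat_) :=
    { toFun := mapMatNat
      map_zero' := by
        ext M : 2
        exact Mat_.hom_ext _ _ (fun (i : M.ι) (j : M.ι) => zero_comp)
      map_add' := fun σ τ => by
        ext M : 2
        exact Mat_.hom_ext _ _ (fun (i : M.ι) (j : M.ι) => Preadditive.add_comp _ _ _ _ _ _) }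
  exact map_sum Φ _ _

variable (F : C ⥤ D ⥤ E)

instance [F.Additive] (Y : D) : (F.flip.obj Y).Additive where
  map_add {_ _ f g} := by simp

theorem matTensor_embedding_left (X : C) {N N' : Mat_ D} (g : N ⟶ N') :
    matTensor F (𝟙 ((Mat_.embedding C).obj X)) g =
      fun (x : PUnit × N.ι) (y : PUnit × N'.ι) => (F.obj X).map (g x.2 y.2) := by
  rw [← (Mat_.embedding C).map_id X]
  refine Mat_.hom_ext _ _ (fun (x : PUnit × N.ι) (y : PUnit × N'.ι) => ?_)
  change (F.map (𝟙 X)).app (N.X x.2) ≫ (F.obj X).map (g x.2 y.2) = (F.obj X).map (g x.2 y.2)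
  rw [F.map_id, NatTrans.id_app, Category.id_comp]

theorem matTensor_embedding_right {M M' : Mat_ C} (f : M ⟶ M') (Y : D) :
    matTensor F f (𝟙 ((Mat_.embedding D).obj Y)) =
      fun (x : M.ι × PUnit) (y : M'.ι × PUnit) => (F.flip.obj Y).map (f x.1 y.1) := by
  rw [← (Mat_.embedding D).map_id Y]
  refine Mat_.hom_ext _ _ (fun (x : M.ι × PUnit) (y : M'.ι × PUnit) => ?_)
  change (F.map (f x.1 y.1)).app Y ≫ (F.obj (M'.X y.1)).map (𝟙 Y) = (F.map (f x.1 y.1)).app Y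
  rw [CategoryTheory.Functor.map_id, Category.comp_id]

variable [F.Additive] [∀ X, (F.obj X).Additive]

/-- The extension of a bifunctor to formal direct sums, at an object in the first variable. -/
def mapMat₂ObjIso (X : C) : (mapMat₂ F).obj ((Mat_.embedding C).obj X) ≅ (F.obj X).mapMat_ :=
  NatIso.ofComponents
    (fun N =>
      { hom := fun (x : PUnit × N.ι) (j : N.ι) => (F.obj X).map ((𝟙 N : N ⟶ N) x.2 j)
        inv := fun (i : N.ι) (x : PUnit × N.ι) => (F.obj X).map ((𝟙 N : N ⟶ N) i x.2)
        hom_inv_id := by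
          refine Eq.trans ?_ (((mapMat₂ F).obj ((Mat_.embedding C).obj X)).map_id N)
          refine Eq.trans ?_ (matTensor_embedding_left F X (𝟙 N)).symm
          refine Mat_.hom_ext _ _ (fun (x : PUnit × N.ι) (y : PUnit × N.ι) => ?_)
          change ∑ j : N.ι, (F.obj X).map ((𝟙 N : N ⟶ N) x.2 j) ≫
            (F.obj X).map ((𝟙 N : N ⟶ N) j y.2) = (F.obj X).map ((𝟙 N : N ⟶ N) x.2 y.2)
          rw [sum_map_comp_map, Category.comp_id]
        inv_hom_id := by
          refine Eq.trans ?_ ((F.obj X).mapMat_.map_id N)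
          refine Mat_.hom_ext _ _ (fun (i : N.ι) (j : N.ι) => ?_)
          change ∑ x : PUnit × N.ι, (F.obj X).map ((𝟙 N : N ⟶ N) i x.2) ≫
            (F.obj X).map ((𝟙 N : N ⟶ N) x.2 j) = (F.obj X).map ((𝟙 N : N ⟶ N) i j)
          refine (Fintype.sum_prod_type _).trans ((Fintype.sum_unique _).trans
            ((sum_map_comp_map (F.obj X) (𝟙 N) (𝟙 N) i j).trans ?_))
          rw [Category.comp_id] })
    (by
      intro N N' g
      refine Eq.trans (congrArg (· ≫ _) (matTensor_embedding_left F X g)) ?_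
      refine Mat_.hom_ext _ _ (fun (x : PUnit × N.ι) (j : N'.ι) => ?_)
      change ∑ y : PUnit × N'.ι, (F.obj X).map (g x.2 y.2) ≫
          (F.obj X).map ((𝟙 N' : N' ⟶ N') y.2 j) =
        ∑ y : N.ι, (F.obj X).map ((𝟙 N : N ⟶ N) x.2 y) ≫ (F.obj X).map (g y j)
      refine (Fintype.sum_prod_type _).trans ((Fintype.sum_unique _).trans
        ((sum_map_comp_map (F.obj X) g (𝟙 N') x.2 j).trans ?_))
      rw [sum_map_comp_map, Category.id_comp, Category.comp_id])

/-- The extension of a bifunctor to formal direct sums, at an object in the second variable. -/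
def mapMat₂FlipObjIso (Y : D) :
    (mapMat₂ F).flip.obj ((Mat_.embedding D).obj Y) ≅ (F.flip.obj Y).mapMat_ :=
  NatIso.ofComponents
    (fun M =>
      { hom := fun (x : M.ι × PUnit) (j : M.ι) => (F.flip.obj Y).map ((𝟙 M : M ⟶ M) x.1 j)
        inv := fun (i : M.ι) (x : M.ι × PUnit) => (F.flip.obj Y).map ((𝟙 M : M ⟶ M) i x.1)
        hom_inv_id := by
          refine Eq.trans ?_ (((mapMat₂ F).flip.obj ((Mat_.embedding D).obj Y)).map_id M)
          refine Eq.trans ?_ (matTensor_embedding_right F (𝟙 M) Y).symm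
          refine Mat_.hom_ext _ _ (fun (x : M.ι × PUnit) (y : M.ι × PUnit) => ?_)
          change ∑ j : M.ι, (F.flip.obj Y).map ((𝟙 M : M ⟶ M) x.1 j) ≫
            (F.flip.obj Y).map ((𝟙 M : M ⟶ M) j y.1) =
            (F.flip.obj Y).map ((𝟙 M : M ⟶ M) x.1 y.1)
          rw [sum_map_comp_map, Category.comp_id]
        inv_hom_id := by
          refine Eq.trans ?_ ((F.flip.obj Y).mapMat_.map_id M)
          refine Mat_.hom_ext _ _ (fun (i : M.ι) (j : M.ι) => ?_)
          change ∑ x : M.ι × PUnit, (F.flip.obj Y).map ((𝟙 M : M ⟶ M) i x.1) ≫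
            (F.flip.obj Y).map ((𝟙 M : M ⟶ M) x.1 j) =
            (F.flip.obj Y).map ((𝟙 M : M ⟶ M) i j)
          rw [Fintype.sum_prod_type]
          simp_rw [Fintype.sum_unique]
          rw [sum_map_comp_map, Category.comp_id] })
    (by
      intro M M' f
      refine Eq.trans (congrArg (· ≫ _) (matTensor_embedding_right F f Y)) ?_
      refine Mat_.hom_ext _ _ (fun (x : M.ι × PUnit) (j : M'.ι) => ?_)
      change ∑ y : M'.ι × PUnit, (F.flip.obj Y).map (f x.1 y.1) ≫
          (F.flip.obj Y).map ((𝟙 M' : M' ⟶ M') y.1 j) =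
        ∑ y : M.ι, (F.flip.obj Y).map ((𝟙 M : M ⟶ M) x.1 y) ≫ (F.flip.obj Y).map (f y j)
      rw [Fintype.sum_prod_type]
      simp_rw [Fintype.sum_unique]
      rw [sum_map_comp_map, sum_map_comp_map, Category.id_comp, Category.comp_id])

instance (G : C ⥤ D) [G.Additive] : G.mapMat_.Additive where
  map_add {M N _ _} := Mat_.hom_ext _ _ (fun (_ : M.ι) (_ : N.ι) => G.map_add)

end Mat

/-! ### Strictness of planar composition -/

theorem map_heq_map {C D : Type*} [Category* C] [Category* D] (F : C ⥤ D) {X Y X' Y' : C}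
    (hX : X = X') (hY : Y = Y') {f : X ⟶ Y} {f' : X' ⟶ Y'} (h : f ≍ f') :
    F.map f ≍ F.map f' := by
  subst hX hY
  rw [eq_of_heq h]

namespace Cob

variable {l m n k : ℕ}

/-- The class of an elementary cobordism. -/
def move {a b : Diag m n} (e : Move a b) : of a ⟶ of b := movie e.arrow.toPath

/-- The other fields of a move are proofs, so these four determine it, also between diagrams whose
equality is not definitional. -/
theorem move_heq {a b a' b' : Diag m n} (ha : a = a') (hb : b = b') (e : Move a b)
    (e' : Move a' b') (h₁ : e.above = e'.above) (h₂ : e.below = e'.below)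
    (h₃ : e.width = e'.width) (h₄ : e.event = e'.event) : move e ≍ move e' := by
  subst ha hb
  obtain ⟨_, _, _, _, _, _, _, _⟩ := e
  obtain ⟨_, _, _, _, _, _, _, _⟩ := e'
  dsimp only at h₁ h₂ h₃ h₄
  subst h₁ h₂ h₃ h₄
  rfl

theorem lift_map_move {m' n' : ℕ} (f : Diag m n → Diag m' n')
    (g : ∀ {a b : Diag m n}, Move a b → Move (f a) (f b))
    (hF : ∀ {a b : PreCob m n} {u v : a ⟶ b}, Rel u v →
      Rel ((PreCob.map f g).map u) ((PreCob.map f g).map v)) {a b : Diag m n} (e : Move a b) :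
    (lift (PreCob.map f g) hF).map (move e) = move (g e) := by
  refine congrArg (CategoryTheory.Quotient.functor (cobRel m' n')).map ?_
  simp only [Movie.hom, PreCob.map]
  erw [Free.lift_map_single]
  rw [one_smul]
  exact Category.id_comp _

theorem stackTop_move (c : Diag l m) {a b : Diag m n} (e : Move a b) :
    (stackTop c).map (move e) = move (Move.stackTop c e) :=
  lift_map_move _ _ _ e

theorem stackBot_move (c : Diag m n) {a b : Diag l m} (e : Move a b) :
    (stackBot c).map (move e) = move (Move.stackBot c e) :=
  lift_map_move _ _ _ e

instance (c : Diag l m) : (stackTop (n := n) c).Linear Coeff where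
  map_smul f r := lift_smul (PreCob.map c.stack (Move.stackTop c)) (Rel.stackTop c) r f

instance (c : Diag m n) : (stackBot (l := l) c).Linear Coeff where
  map_smul f r :=
    lift_smul (PreCob.map (fun a => a.stack c) (Move.stackBot c)) (Rel.stackBot c) r f

theorem functor_map_single {a b : Diag m n} (p : Movie a b) (r : Coeff) :
    (CategoryTheory.Quotient.functor (cobRel m n)).map
      (show PreCob.of a ⟶ PreCob.of b from Finsupp.single p r) = r • movie p := by
  have h : (show PreCob.of a ⟶ PreCob.of b from Finsupp.single p r) = r • p.hom := by
    change Finsupp.single p r = r • Finsupp.single p (1 : Coeff)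
    rw [Finsupp.smul_single, smul_eq_mul, mul_one]
  rw [h]
  exact CategoryTheory.Functor.map_smul _ r p.hom

/-- Every morphism of `Cob` is the class of a `ℤ[α]`-combination of composites of elementary
cobordisms, so a linear functor is determined by those. The comparison is heterogeneous because
objects such as the two bracketings of a triple stack agree only by associativity of concatenation.
-/
theorem functor_ext {m' n' : ℕ} {F G : Cob m n ⥤ Cob m' n'} [F.Additive] [G.Additive]
    [F.Linear Coeff] [G.Linear Coeff] (hobj : ∀ a, F.obj (of a) = G.obj (of a))
    (hmap : ∀ (a b : Diag m n) (e : Move a b), F.map (move e) ≍ G.map (move e)) : F = G := by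
  have hobj' : ∀ X, F.obj X = G.obj X := fun X => hobj X.as
  have hpath : ∀ (a b : Diag m n) (p : Movie a b), F.map (movie p) = eqToHom (hobj a) ≫
      G.map (movie p) ≫ eqToHom (hobj b).symm := by
    intro a b p
    induction p with
    | nil =>
      have h : movie (Quiver.Path.nil : Movie a a) = 𝟙 (of a) := rfl
      rw [h, F.map_id, G.map_id]
      simp
    | @cons b c p e ih =>
      have h : movie (p.cons e) = movie p ≫ move e := (movie_comp p (Move.arrow e).toPath).symm
      have h' := (conj_eqToHom_iff_heq _ _ (hobj b) (hobj c)).2 (hmap b c e)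
      rw [h, F.map_comp, G.map_comp, ih, h']
      simp
  have hsmul : ∀ (a b : Diag m n) (p : Movie a b) (r : Coeff), F.map (r • movie p) =
      eqToHom (hobj a) ≫ G.map (r • movie p) ≫ eqToHom (hobj b).symm := by
    intro a b p r
    rw [F.map_smul, G.map_smul, hpath, Linear.smul_comp, Linear.comp_smul]
  have hlin : ∀ (a b : Diag m n) (f : Movie a b →₀ Coeff),
      F.map ((CategoryTheory.Quotient.functor (cobRel m n)).map
        (show PreCob.of a ⟶ PreCob.of b from f)) = eqToHom (hobj a) ≫
      G.map ((CategoryTheory.Quotient.functor (cobRel m n)).map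
        (show PreCob.of a ⟶ PreCob.of b from f)) ≫ eqToHom (hobj b).symm := by
    intro a b f
    induction f using Finsupp.induction_linear with
    | zero =>
      have h : (CategoryTheory.Quotient.functor (cobRel m n)).map
        (show PreCob.of a ⟶ PreCob.of b from (0 : Movie a b →₀ Coeff)) = (0 : of a ⟶ of b) :=
        CategoryTheory.Functor.map_zero _ _ _
      refine (congrArg F.map h).trans ?_
      refine Eq.trans ?_ (congrArg (fun u => eqToHom (hobj a) ≫ G.map u ≫ eqToHom (hobj b).symm)
        h.symm)
      change F.map 0 = eqToHom (hobj a) ≫ G.map 0 ≫ eqToHom (hobj b).symm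
      rw [F.map_zero, G.map_zero]
      simp
    | add f g hf hg =>
      have h : (CategoryTheory.Quotient.functor (cobRel m n)).map
        (show PreCob.of a ⟶ PreCob.of b from f + g) =
        ((CategoryTheory.Quotient.functor (cobRel m n)).map
          (show PreCob.of a ⟶ PreCob.of b from f) : of a ⟶ of b) +
        (CategoryTheory.Quotient.functor (cobRel m n)).map
          (show PreCob.of a ⟶ PreCob.of b from g) :=
        CategoryTheory.Functor.map_add _
      refine (congrArg F.map h).trans ?_
      refine Eq.trans ?_ (congrArg (fun u => eqToHom (hobj a) ≫ G.map u ≫ eqToHom (hobj b).symm)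
        h.symm)
      refine (F.map_add).trans ((congrArg₂ (· + ·) hf hg).trans ?_)
      refine Eq.trans ?_ (congrArg (fun u => eqToHom (hobj a) ≫ u ≫ eqToHom (hobj b).symm)
        (G.map_add).symm)
      rw [Preadditive.add_comp, Preadditive.comp_add]
    | single p r =>
      refine (congrArg F.map (functor_map_single p r)).trans ?_
      refine Eq.trans ?_ (congrArg (fun u => eqToHom (hobj a) ≫ G.map u ≫ eqToHom (hobj b).symm)
        (functor_map_single p r).symm)
      exact hsmul a b p r
  refine CategoryTheory.Functor.ext hobj' fun X Y f => ?_
  obtain ⟨f, rfl⟩ := (CategoryTheory.Quotient.functor _).map_surjective f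
  exact hlin X.as Y.as f

end Cob

namespace Diag

theorem stack_assoc {k l m n : ℕ} (a : Diag k l) (b : Diag l m) (c : Diag m n) :
    (a.stack b).stack c = a.stack (b.stack c) :=
  Diag.ext (List.append_assoc _ _ _)

theorem stack_one {m n : ℕ} (a : Diag m n) : a.stack (one n) = a :=
  Diag.ext (List.append_nil _)

end Diag

namespace Cob

variable {k l m n : ℕ}

/-- Stacking concatenates words, hence is strictly associative, and a move keeps its surroundings
and its event under either bracketing. Having an equality of functors, not only an isomorphism, lets
contractibility be transported by rewriting. -/
theorem stackBot_comp (b : Diag l m) (c : Diag m n) :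
    stackBot (l := k) b ⋙ stackBot c = stackBot (b.stack c) := by
  refine functor_ext (fun a => congrArg of (a.stack_assoc b c)) (fun a a' e => ?_)
  have h : (stackBot b ⋙ stackBot c).map (move e) = move (Move.stackBot c (Move.stackBot b e)) :=
    (congrArg (stackBot c).map (stackBot_move b e)).trans (stackBot_move c _)
  rw [h, stackBot_move]
  exact move_heq (a.stack_assoc b c) (a'.stack_assoc b c) _ _ rfl (List.append_assoc _ _ _) rfl rfl

theorem stackTop_comp (a : Diag k l) (b : Diag l m) :
    stackTop (n := n) b ⋙ stackTop a = stackTop (a.stack b) := by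
  refine functor_ext (fun c => congrArg of (a.stack_assoc b c).symm) (fun c c' e => ?_)
  have h : (stackTop b ⋙ stackTop a).map (move e) = move (Move.stackTop a (Move.stackTop b e)) :=
    (congrArg (stackTop a).map (stackTop_move b e)).trans (stackTop_move a _)
  rw [h, stackTop_move]
  exact move_heq (a.stack_assoc b c).symm (a.stack_assoc b c').symm _ _
    (List.append_assoc _ _ _).symm rfl rfl rfl

theorem stackTop_stackBot (a : Diag k l) (c : Diag m n) :
    stackTop a ⋙ stackBot c = stackBot c ⋙ stackTop a := by
  refine functor_ext (fun b => congrArg of (a.stack_assoc b c)) (fun b b' e => ?_)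
  have h : (stackTop a ⋙ stackBot c).map (move e) = move (Move.stackBot c (Move.stackTop a e)) :=
    (congrArg (stackBot c).map (stackTop_move a e)).trans (stackBot_move c _)
  have h' : (stackBot c ⋙ stackTop a).map (move e) = move (Move.stackTop a (Move.stackBot c e)) :=
    (congrArg (stackTop a).map (stackBot_move c e)).trans (stackTop_move a _)
  rw [h, h']
  exact move_heq (a.stack_assoc b c) (a.stack_assoc b' c) _ _ rfl rfl rfl rfl

theorem stackBot_one : stackBot (l := m) (Diag.one n) = 𝟭 (Cob m n) := by
  refine functor_ext (fun b => congrArg of b.stack_one) (fun b b' e => ?_)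
  rw [stackBot_move, Functor.id_map]
  exact move_heq b.stack_one b'.stack_one _ _ rfl (List.append_nil _) rfl rfl

end Cob

namespace QDiag

variable {k l m n : ℕ}

theorem hom_heq {X Y X' Y' : QDiag m n} (hX : X = X') (hY : Y = Y') {f : X ⟶ Y} {f' : X' ⟶ Y'}
    (h : QDiag.Hom.val f ≍ QDiag.Hom.val f') : f ≍ f' := by
  subst hX hY
  exact heq_of_eq (hom_ext (eq_of_heq h))

/-- The identity diagram. -/
abbrev one (n : ℕ) : QDiag n n := ⟨Diag.one n, 0⟩

/-- The functor which stacks a diagram on the bottom. -/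
abbrev bot (y : QDiag m n) : QDiag l m ⥤ QDiag l n := QDiag.stack.flip.obj y

/-- The functor which stacks a diagram on the top. -/
abbrev top (x : QDiag l m) : QDiag m n ⥤ QDiag l n := QDiag.stack.obj x

theorem bot_comp (y : QDiag l m) (z : QDiag m n) :
    bot (l := k) y ⋙ bot z = bot ((bot z).obj y) := by
  have h : ∀ X : QDiag k l, (bot y ⋙ bot z).obj X = (bot ((bot z).obj y)).obj X := fun X =>
    QDiag.ext (X.diag.stack_assoc y.diag z.diag) (add_assoc _ _ _)
  refine Functor.hext h (fun X Y f => hom_heq (h X) (h Y) ?_)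
  exact Functor.hcongr_hom (Cob.stackBot_comp y.diag z.diag) f.val

theorem top_comp (x : QDiag k l) (y : QDiag l m) :
    top (n := n) y ⋙ top x = top ((top x).obj y) := by
  have h : ∀ X : QDiag m n, (top y ⋙ top x).obj X = (top ((top x).obj y)).obj X := fun X =>
    QDiag.ext (x.diag.stack_assoc y.diag X.diag).symm (add_assoc _ _ _).symm
  refine Functor.hext h (fun X Y f => hom_heq (h X) (h Y) ?_)
  exact Functor.hcongr_hom (Cob.stackTop_comp x.diag y.diag) f.val

theorem top_bot (x : QDiag k l) (z : QDiag m n) :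
    top x ⋙ bot z = bot z ⋙ top x := by
  have h : ∀ X : QDiag l m, (top x ⋙ bot z).obj X = (bot z ⋙ top x).obj X := fun X =>
    QDiag.ext (x.diag.stack_assoc X.diag z.diag) (add_assoc _ _ _)
  refine Functor.hext h (fun X Y f => hom_heq (h X) (h Y) ?_)
  exact Functor.hcongr_hom (Cob.stackTop_stackBot x.diag z.diag) f.val

theorem bot_one : bot (l := m) (one n) = 𝟭 (QDiag m n) := by
  have h : ∀ X : QDiag m n, (bot (one n)).obj X = X := fun X =>
    QDiag.ext X.diag.stack_one (add_zero _)
  refine Functor.hext h (fun X Y f => hom_heq (h X) (h Y) ?_)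
  exact Functor.hcongr_hom Cob.stackBot_one f.val

theorem bot_qShift (y : QDiag m n) (s : ℤ) :
    bot (l := l) y ⋙ qShift s = bot ((qShift s).obj y) := by
  have h : ∀ X : QDiag l m, (bot y ⋙ qShift s).obj X = (bot ((qShift s).obj y)).obj X := fun X =>
    QDiag.ext rfl (add_assoc _ _ _)
  exact Functor.hext h (fun X Y f => hom_heq (h X) (h Y) HEq.rfl)

theorem qShift_bot (y : QDiag m n) (s : ℤ) :
    qShift s ⋙ bot (l := l) y = bot ((qShift s).obj y) := by
  have h : ∀ X : QDiag l m, (qShift s ⋙ bot y).obj X = (bot ((qShift s).obj y)).obj X := fun X =>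
    QDiag.ext rfl (by change X.shift + s + y.shift = X.shift + (y.shift + s); ring)
  exact Functor.hext h (fun X Y f => hom_heq (h X) (h Y) HEq.rfl)

end QDiag

/-! ### Surfaces homeomorphic to a product -/

/-- The point `x` lies on one of the levels of the diagram given by the word `w`. -/
def InFrame (m : ℕ) (w : List Arc) (x : ℕ × ℕ) : Prop :=
  x.1 ≤ w.length ∧ x.2 < widthAt m w x.1

/-- Two points lie on the same component of a diagram. -/
abbrev Conn (w : List Arc) : ℕ × ℕ → ℕ × ℕ → Prop := Relation.EqvGen (Joined w)

theorem widthAt_succ_cap {m t i : ℕ} {w : List Arc} (h : w[t]? = some (.cap i)) :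
    widthAt m w (t + 1) = widthAt m w t + 2 := by
  simp [widthAt, List.take_add_one, h]

theorem widthAt_succ_cup {m t i : ℕ} {w : List Arc} (h : w[t]? = some (.cup i)) :
    widthAt m w (t + 1) = widthAt m w t - 2 := by
  simp [widthAt, List.take_add_one, h]

theorem Goes.cap_le {w : List Arc} {m n t i : ℕ} (hw : Goes w m n) (h : w[t]? = some (.cap i)) :
    i ≤ widthAt m w t := by
  induction w generalizing m t with
  | nil => simp at h
  | cons c w ih =>
    rcases t with _ | t
    · simp only [List.getElem?_cons_zero, Option.some.injEq] at h
      subst h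
      exact hw.1
    · simp only [List.getElem?_cons_succ] at h
      cases c with
      | cap j => exact ih hw.2 h
      | cup j => exact ih hw.2 h

theorem Goes.cup_le {w : List Arc} {m n t i : ℕ} (hw : Goes w m n) (h : w[t]? = some (.cup i)) :
    i + 2 ≤ widthAt m w t := by
  induction w generalizing m t with
  | nil => simp at h
  | cons c w ih =>
    rcases t with _ | t
    · simp only [List.getElem?_cons_zero, Option.some.injEq] at h
      subst h
      exact hw.1
    · simp only [List.getElem?_cons_succ] at h
      cases c with
      | cap j => exact ih hw.2 h
      | cup j => exact ih hw.2 h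

theorem Joined.inFrame_iff {w : List Arc} {m n : ℕ} (hw : Goes w m n) {x y : ℕ × ℕ}
    (h : Joined w x y) : InFrame m w x ↔ InFrame m w y := by
  have hl : ∀ {t : ℕ} {c : Arc}, w[t]? = some c → t < w.length := fun h =>
    (List.getElem?_eq_some_iff.1 h).1
  cases h with
  | capLeft t i p h hp | capRight t i p h hp | capTurn t i h =>
    have h1 := hw.cap_le h
    have h2 := widthAt_succ_cap (m := m) h
    have h3 := hl h
    simp only [InFrame]
    omega
  | cupLeft t i p h hp | cupRight t i p h hp | cupTurn t i h =>
    have h1 := hw.cup_le h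
    have h2 := widthAt_succ_cup (m := m) h
    have h3 := hl h
    simp only [InFrame]
    omega

theorem Conn.inFrame_iff {w : List Arc} {m n : ℕ} (hw : Goes w m n) {x y : ℕ × ℕ}
    (h : Conn w x y) : InFrame m w x ↔ InFrame m w y := by
  induction h with
  | rel x y h => exact h.inFrame_iff hw
  | refl x => exact Iff.rfl
  | symm x y _ ih => exact ih.symm
  | trans x y z _ _ ih ih' => exact ih.trans ih'

/-- `Conn` is generated on all pairs of natural numbers, but joined points lie in the frame
together. A chain of joins that starts in the frame stays there, so a function on the frame that is
constant along strands is constant along the chain. -/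
theorem Conn.apply_eq {m n : ℕ} {a : Diag m n} {X : Type*} (f : Frame a → X)
    (hf : ∀ x y : Frame a, Joined a.word x.1 y.1 → f x = f y) {x y : ℕ × ℕ}
    (h : Conn a.word x y) (hx : InFrame m a.word x) (hy : InFrame m a.word y) :
    f ⟨x, hx⟩ = f ⟨y, hy⟩ := by
  induction h with
  | rel x y h => exact hf _ _ h
  | refl x => rfl
  | symm x y _ ih => exact (ih hy hx).symm
  | trans x y z h h' ih ih' =>
    have hy' := (Conn.inFrame_iff a.goes h).1 hx
    exact (ih hx hy').trans (ih' hy' hy)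

/-- A movie with two steps returning to its source sweeps out a surface homeomorphic to a product
if its middle diagram can be projected to the source compatibly with all connections. -/
theorem Movie.homeomorphic_nil {m n : ℕ} {a b : Diag m n} (e : Move a b) (e' : Move b a)
    (ρ : ℕ × ℕ → ℕ × ℕ) (hρ : ∀ y, InFrame m b.word y → InFrame m a.word (ρ y))
    (h₁ : ∀ x y, Joined b.word x y → Conn a.word (ρ x) (ρ y))
    (h₂ : ∀ x y, y.1 ≤ b.word.length → e.Persists x y → Conn a.word x (ρ y))
    (h₂' : ∀ x y, x.1 ≤ b.word.length → e'.Persists x y → Conn a.word (ρ x) y)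
    (h₃ : ∀ x, InFrame m a.word x → ∃ x' y, InFrame m b.word y ∧ Conn a.word x x' ∧
      e.Persists x' y ∧ e'.Persists y x')
    (h₄ : ∀ y, InFrame m b.word y → ∃ x y', InFrame m a.word x ∧ Conn b.word y y' ∧
      (e.Persists x y' ∨ e'.Persists y' x))
    (hm : ∀ c, Movie.euler ((Quiver.Path.nil.cons e.arrow).cons e'.arrow) c = 0 ∧
      Movie.dots ((Quiver.Path.nil.cons e.arrow).cons e'.arrow) c = 0) :
    Movie.Homeomorphic ((Quiver.Path.nil.cons e.arrow).cons e'.arrow) .nil := by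
  let q : Movie a a := .nil
  let p : Movie a a := (Quiver.Path.nil.cons e.arrow).cons e'.arrow
  let cls : Frame a → Component q := fun x => Quot.mk _ x
  have hcls : ∀ x y : Frame a, Joined a.word x.1 y.1 → cls x = cls y := fun x y h =>
    Quot.sound h
  let ρ' : Frame b → Frame a := fun y => ⟨ρ y.1, hρ y.1 y.2⟩
  let A : Frame a → Points p := fun x => Sum.inl (Sum.inl x)
  let B : Frame b → Points p := fun x => Sum.inl (Sum.inr x)
  let A' : Frame a → Points p := fun x => Sum.inr x
  let A₀ : Frame a → Component p := fun x => Quot.mk _ (A x)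
  let B₀ : Frame b → Component p := fun x => Quot.mk _ (B x)
  let A₁ : Frame a → Component p := fun x => Quot.mk _ (A' x)
  have hA : ∀ x y : Frame a, Joined a.word x.1 y.1 → A₀ x = A₀ y := fun x y h => Quot.sound h
  have hB : ∀ x y : Frame b, Joined b.word x.1 y.1 → B₀ x = B₀ y := fun x y h => Quot.sound h
  have hA' : ∀ x y : Frame a, Joined a.word x.1 y.1 → A₁ x = A₁ y := fun x y h => Quot.sound h
  have hAB : ∀ (x : Frame a) (y : Frame b), e.Persists x.1 y.1 → A₀ x = B₀ y := fun x y h =>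
    Quot.sound ⟨x, rfl, h⟩
  have hBA : ∀ (x : Frame b) (y : Frame a), e'.Persists x.1 y.1 → B₀ x = A₁ y := fun x y h =>
    Quot.sound ⟨x, rfl, h⟩
  -- The surface is projected to its first frame: the outer frames by the identity, the middle one
  -- by `ρ`. This becomes the bijection of components, and the inclusion of the first frame its
  -- inverse.
  let f : Points p → Component q := fun x =>
    match (show (Frame a ⊕ Frame b) ⊕ Frame a from x) with
    | .inl (.inl x) => cls x
    | .inl (.inr y) => cls (ρ' y)
    | .inr x => cls x
  have hf : ∀ x y, Adj p x y → f x = f y := by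
    rintro ((x | x) | x) ((y | y) | y) h
    · exact hcls x y h
    · obtain ⟨z, rfl, h⟩ := h
      exact Conn.apply_eq cls hcls (h₂ _ _ y.2.1 h) z.2 (hρ y.1 y.2)
    · obtain ⟨z, hz, h⟩ := h
      cases hz
    · exact h.elim
    · exact Conn.apply_eq cls hcls (h₁ _ _ h) (hρ x.1 x.2) (hρ y.1 y.2)
    · obtain ⟨z, hz, h⟩ := h
      cases hz
      exact Conn.apply_eq cls hcls (h₂' _ _ x.2.1 h) (hρ x.1 x.2) y.2
    · exact h.elim
    · exact h.elim
    · exact hcls x y h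
  -- By `h₃`, each strand of `a` contains a point left alone by both moves, so its first and last
  -- copies lie on one component.
  have hA₁ : ∀ x : Frame a, A₁ x = A₀ x := by
    intro x
    obtain ⟨x', y, hy, hx, he, he'⟩ := h₃ x.1 x.2
    have hx' := (Conn.inFrame_iff a.goes hx).1 x.2
    calc A₁ x = A₁ ⟨x', hx'⟩ := Conn.apply_eq A₁ hA' hx x.2 hx'
      _ = B₀ ⟨y, hy⟩ := (hBA ⟨y, hy⟩ ⟨x', hx'⟩ he').symm
      _ = A₀ ⟨x', hx'⟩ := (hAB ⟨x', hx'⟩ ⟨y, hy⟩ he).symm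
      _ = A₀ x := (Conn.apply_eq A₀ hA hx x.2 hx').symm
  have hcomp : ∀ x y : ℕ × ℕ, Conn b.word x y → Conn a.word (ρ x) (ρ y) := by
    intro x y h
    induction h with
    | rel x y h => exact h₁ x y h
    | refl x => exact .refl _
    | symm x y _ ih => exact ih.symm
    | trans x y z _ _ ih ih' => exact ih.trans _ _ _ ih'
  -- By `h₄`, every component of the middle diagram contains a point that persists from the first or
  -- into the last frame; no component of the surface lives in the middle frame only.
  have hB₀ : ∀ y : Frame b, A₀ (ρ' y) = B₀ y := by
    intro y
    obtain ⟨x, y', hx, hy, he⟩ := h₄ y.1 y.2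
    have hy' := (Conn.inFrame_iff b.goes hy).1 y.2
    have key : A₀ ⟨x, hx⟩ = B₀ ⟨y', hy'⟩ ∧ Conn a.word x (ρ y') := by
      rcases he with he | he
      · exact ⟨hAB ⟨x, hx⟩ ⟨y', hy'⟩ he, h₂ x y' hy'.1 he⟩
      · exact ⟨(hA₁ _).symm.trans (hBA ⟨y', hy'⟩ ⟨x, hx⟩ he).symm, (h₂' y' x hy'.1 he).symm⟩
    calc A₀ (ρ' y) = A₀ ⟨x, hx⟩ :=
          (Conn.apply_eq A₀ hA (key.2.trans _ _ _ (hcomp _ _ hy).symm) hx (hρ y.1 y.2)).symm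
      _ = B₀ ⟨y', hy'⟩ := key.1
      _ = B₀ y := (Conn.apply_eq B₀ hB hy y.2 hy').symm
  let φ : Component p ≃ Component q :=
    { toFun := Quot.lift f hf
      invFun := Quot.lift A₀ hA
      left_inv := by
        rintro ⟨(x | y) | x⟩
        · rfl
        · exact hB₀ y
        · exact (hA₁ x).symm
      right_inv := by
        rintro ⟨x⟩
        rfl }
  exact ⟨φ, fun _ => rfl, fun _ => rfl, fun c =>
    ⟨(show Movie.euler q (φ c) = 0 from rfl).trans (hm c).1.symm,
      (show Movie.dots q (φ c) = 0 from rfl).trans (hm c).2.symm⟩⟩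

/-! ### Isotopies are invertible -/

/-- A planar isotopy of the whole diagram. -/
def Move.isotopy {k n : ℕ} (a b : Diag k n)
    (h : IsotopyStep a.word b.word ∨ IsotopyStep b.word a.word) : Move a b :=
  ⟨[], [], k, .isotopy a.word b.word h, rfl, trivial, (List.append_nil _).symm,
    (List.append_nil _).symm⟩

theorem Move.isotopy_persists {k n : ℕ} (a b : Diag k n)
    (h : IsotopyStep a.word b.word ∨ IsotopyStep b.word a.word) (x y : ℕ × ℕ) :
    (Move.isotopy a b h).Persists x y ↔ x.2 = y.2 ∧ ((x.1 = 0 ∧ y.1 = 0) ∨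
      ∃ s, x.1 = a.word.length + s ∧ y.1 = b.word.length + s) := by
  simp only [Persists, isotopy, Event.src, Event.tgt, List.length_nil, zero_add]
  refine and_congr_right fun _ => or_congr_left ?_
  omega

/-- An isotopy of the whole diagram keeps only the top and bottom levels. Components are therefore
followed through their end points, which needs `ha` and `hb`: neither diagram has closed components.
Isotopies contribute no marks, so Euler characteristics and dots vanish. -/
theorem Movie.homeomorphic_nil_of_isotopy {k n : ℕ} (a b : Diag k n)
    (h : IsotopyStep a.word b.word ∨ IsotopyStep b.word a.word) (ρ : ℕ × ℕ → ℕ × ℕ)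
    (hρ : ∀ y, InFrame k b.word y → InFrame k a.word (ρ y))
    (h₁ : ∀ x y, Joined b.word x y → Conn a.word (ρ x) (ρ y))
    (htop : ∀ p, Conn a.word (0, p) (ρ (0, p)))
    (hbot : ∀ p, Conn a.word (a.word.length, p) (ρ (b.word.length, p)))
    (ha : ∀ x, InFrame k a.word x → ∃ p, Conn a.word x (0, p) ∨ Conn a.word x (a.word.length, p))
    (hb : ∀ x, InFrame k b.word x → ∃ p, Conn b.word x (0, p) ∨
      Conn b.word x (b.word.length, p)) :
    Movie.Homeomorphic ((Quiver.Path.nil.cons (Move.isotopy a b h).arrow).cons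
      (Move.isotopy b a h.symm).arrow) .nil := by
  have hw : ∀ (c : Diag k n) (p : ℕ), InFrame k c.word (c.word.length, p) ↔ p < n := by
    intro c p
    have := c.goes.widthAt_append []
    rw [List.append_nil] at this
    simp [InFrame, this]
  have hz : ∀ (c : Diag k n) (p : ℕ), InFrame k c.word (0, p) ↔ p < k := by
    intro c p
    simp [InFrame, widthAt]
  refine Movie.homeomorphic_nil _ _ ρ hρ h₁ ?_ ?_ ?_ ?_ ?_
  · rintro ⟨t, p⟩ ⟨t', p'⟩ hy he
    rw [Move.isotopy_persists] at he
    obtain ⟨rfl, ⟨rfl, rfl⟩ | ⟨s, rfl, rfl⟩⟩ := he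
    · exact htop p
    · obtain rfl : s = 0 := by simpa using hy
      exact hbot p
  · rintro ⟨t, p⟩ ⟨t', p'⟩ hy he
    rw [Move.isotopy_persists] at he
    obtain ⟨rfl, ⟨rfl, rfl⟩ | ⟨s, rfl, rfl⟩⟩ := he
    · exact (htop p).symm
    · obtain rfl : s = 0 := by simpa using hy
      exact (hbot p).symm
  · intro x hx
    obtain ⟨p, hp | hp⟩ := ha x hx
    · refine ⟨(0, p), (0, p), (hz b p).2 ((hz a p).1 ((hp.inFrame_iff a.goes).1 hx)), hp, ?_, ?_⟩
      · rw [Move.isotopy_persists]; exact ⟨rfl, .inl ⟨rfl, rfl⟩⟩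
      · rw [Move.isotopy_persists]; exact ⟨rfl, .inl ⟨rfl, rfl⟩⟩
    · refine ⟨(_, p), (b.word.length, p),
        (hw b p).2 ((hw a p).1 ((hp.inFrame_iff a.goes).1 hx)), hp, ?_, ?_⟩
      · rw [Move.isotopy_persists]; exact ⟨rfl, .inr ⟨0, rfl, rfl⟩⟩
      · rw [Move.isotopy_persists]; exact ⟨rfl, .inr ⟨0, rfl, rfl⟩⟩
  · intro x hx
    obtain ⟨p, hp | hp⟩ := hb x hx
    · refine ⟨(0, p), (0, p), (hz a p).2 ((hz b p).1 ((hp.inFrame_iff b.goes).1 hx)), hp, .inl ?_⟩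
      rw [Move.isotopy_persists]; exact ⟨rfl, .inl ⟨rfl, rfl⟩⟩
    · refine ⟨(a.word.length, p), (_, p),
        (hw a p).2 ((hw b p).1 ((hp.inFrame_iff b.goes).1 hx)), hp, .inl ?_⟩
      rw [Move.isotopy_persists]; exact ⟨rfl, .inr ⟨0, rfl, rfl⟩⟩
  · intro c
    exact ⟨rfl, rfl⟩

/-- The arrow given by a planar isotopy has a right inverse if the surface of the isotopy followed
by its inverse is a product. -/
theorem Cob.move_comp_move {m n : ℕ} {a b : Diag m n} (e : Move a b) (e' : Move b a)
    (h : Movie.Homeomorphic ((Quiver.Path.nil.cons e.arrow).cons e'.arrow) .nil) :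
    Cob.move e ≫ Cob.move e' = 𝟙 (Cob.of a) :=
  (Cob.movie_comp e.arrow.toPath e'.arrow.toPath).trans
    (CategoryTheory.Quotient.sound _ (Rel.homeo _ _ h))

namespace Conn

variable {w : List Arc} {t i p : ℕ}

theorem capLeft (h : w[t]? = some (.cap i)) (hp : p < i) : Conn w (t, p) (t + 1, p) :=
  .rel _ _ (.capLeft t i p h hp)

theorem capRight (h : w[t]? = some (.cap i)) (hp : i ≤ p) : Conn w (t, p) (t + 1, p + 2) :=
  .rel _ _ (.capRight t i p h hp)

theorem capTurn (h : w[t]? = some (.cap i)) : Conn w (t + 1, i) (t + 1, i + 1) :=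
  .rel _ _ (.capTurn t i h)

theorem cupLeft (h : w[t]? = some (.cup i)) (hp : p < i) : Conn w (t, p) (t + 1, p) :=
  .rel _ _ (.cupLeft t i p h hp)

theorem cupRight (h : w[t]? = some (.cup i)) (hp : i ≤ p) : Conn w (t, p + 2) (t + 1, p) :=
  .rel _ _ (.cupRight t i p h hp)

theorem cupTurn (h : w[t]? = some (.cup i)) : Conn w (t, i) (t, i + 1) :=
  .rel _ _ (.cupTurn t i h)

end Conn

theorem homeomorphic_zigzagL {k i : ℕ} (a : Diag k k) (ha : a.word = [.cap i, .cup (i + 1)]) (h) :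
    Movie.Homeomorphic ((Quiver.Path.nil.cons (Move.isotopy a (Diag.one k) h).arrow).cons
      (Move.isotopy (Diag.one k) a h.symm).arrow) .nil := by
  obtain ⟨w, hw⟩ := a
  dsimp only at ha
  subst ha
  have h0 : [Arc.cap i, Arc.cup (i + 1)][0]? = some (.cap i) := rfl
  have h1 : [Arc.cap i, Arc.cup (i + 1)][1]? = some (.cup (i + 1)) := rfl
  refine Movie.homeomorphic_nil_of_isotopy _ _ _ (fun x => (0, x.2)) ?_ ?_ ?_ ?_ ?_ ?_
  · rintro ⟨t, p⟩ ⟨ht, hp⟩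
    obtain rfl : t = 0 := by simpa [Diag.one] using ht
    simpa [InFrame, widthAt, Diag.one] using hp
  · intro x y hxy
    cases hxy <;> simp_all [Diag.one]
  · intro p
    exact .refl _
  · intro p
    change Conn _ (1 + 1, p) (0, p)
    rcases lt_trichotomy p i with hp | rfl | hp
    · exact ((Conn.capLeft h0 hp).trans _ _ _ (Conn.cupLeft h1 (by omega))).symm
    -- The strand through the zigzag: down to position `i + 2`, round the minimum to `i + 1`, round
    -- the maximum to `i`, and down to the bottom.
    · exact ((Conn.capRight h0 le_rfl).trans _ _ _ ((Conn.cupTurn h1).symm.trans _ _ _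
        ((Conn.capTurn h0).symm.trans _ _ _ (Conn.cupLeft h1 (by omega))))).symm
    · exact ((Conn.capRight h0 hp.le).trans _ _ _ (Conn.cupRight h1 (by omega))).symm
  · rintro ⟨t, p⟩ ⟨ht, hp⟩
    change t ≤ 2 at ht
    interval_cases t
    · exact ⟨p, .inl (.refl _)⟩
    · rcases lt_trichotomy p (i + 1) with hp | rfl | hp
      · exact ⟨p, .inr (Conn.cupLeft h1 hp)⟩
      · exact ⟨i, .inr ((Conn.capTurn h0).symm.trans _ _ _ (Conn.cupLeft h1 (by omega)))⟩
      · obtain ⟨p, rfl⟩ : ∃ q, p = q + 2 := ⟨p - 2, by omega⟩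
        exact ⟨p, .inl (Conn.capRight h0 (by omega)).symm⟩
    · exact ⟨p, .inr (.refl _)⟩
  · rintro ⟨t, p⟩ ⟨ht, hp⟩
    obtain rfl : t = 0 := by simpa [Diag.one] using ht
    exact ⟨p, .inl (.refl _)⟩

theorem homeomorphic_zigzagR {k i : ℕ} (a : Diag k k) (ha : a.word = [.cap (i + 1), .cup i]) (h) :
    Movie.Homeomorphic ((Quiver.Path.nil.cons (Move.isotopy a (Diag.one k) h).arrow).cons
      (Move.isotopy (Diag.one k) a h.symm).arrow) .nil := by
  obtain ⟨w, hw⟩ := a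
  dsimp only at ha
  subst ha
  have h0 : [Arc.cap (i + 1), Arc.cup i][0]? = some (.cap (i + 1)) := rfl
  have h1 : [Arc.cap (i + 1), Arc.cup i][1]? = some (.cup i) := rfl
  refine Movie.homeomorphic_nil_of_isotopy _ _ _ (fun x => (0, x.2)) ?_ ?_ ?_ ?_ ?_ ?_
  · rintro ⟨t, p⟩ ⟨ht, hp⟩
    obtain rfl : t = 0 := by simpa [Diag.one] using ht
    simpa [InFrame, widthAt, Diag.one] using hp
  · intro x y hxy
    cases hxy <;> simp_all [Diag.one]
  · intro p
    exact .refl _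
  · intro p
    change Conn _ (1 + 1, p) (0, p)
    rcases lt_trichotomy p i with hp | rfl | hp
    · exact ((Conn.capLeft h0 (by omega)).trans _ _ _ (Conn.cupLeft h1 hp)).symm
    -- The mirror image: down on the left to position `i`, round the minimum to `i + 1`, round the
    -- maximum to `i + 2`, and down to the bottom.
    · exact ((Conn.capLeft h0 (by omega)).trans _ _ _ ((Conn.cupTurn h1).trans _ _ _
        ((Conn.capTurn h0).trans _ _ _ (Conn.cupRight h1 le_rfl)))).symm
    · exact ((Conn.capRight h0 (by omega)).trans _ _ _ (Conn.cupRight h1 hp.le)).symm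
  · rintro ⟨t, p⟩ ⟨ht, hp⟩
    change t ≤ 2 at ht
    interval_cases t
    · exact ⟨p, .inl (.refl _)⟩
    · rcases lt_trichotomy p (i + 1) with hp | rfl | hp
      · exact ⟨p, .inl (Conn.capLeft h0 hp).symm⟩
      · exact ⟨i, .inl ((Conn.cupTurn h1).symm.trans _ _ _ (Conn.capLeft h0 (by omega)).symm)⟩
      · obtain ⟨p, rfl⟩ : ∃ q, p = q + 2 := ⟨p - 2, by omega⟩
        exact ⟨p, .inr (Conn.cupRight h1 (by omega))⟩
    · exact ⟨p, .inr (.refl _)⟩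
  · rintro ⟨t, p⟩ ⟨ht, hp⟩
    obtain rfl : t = 0 := by simpa [Diag.one] using ht
    exact ⟨p, .inl (.refl _)⟩

/-- The projection of `[cup j, cap i]` to the diagram with the heights of the pieces exchanged. -/
def exchangeProj (j : ℕ) (x : ℕ × ℕ) : ℕ × ℕ :=
  -- A point of the middle level, just below the cup, is pushed up along its strand to the top
  -- level, where the two ends of the cup occupy positions `j` and `j + 1`. The other levels do not
  -- move.
  if x.1 = 1 then (0, if x.2 < j then x.2 else x.2 + 2) else x

theorem exchangeProj_one_of_lt {j p : ℕ} (h : p < j) : exchangeProj j (1, p) = (0, p) := by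
  simp [exchangeProj, h]

theorem exchangeProj_one_of_le {j p : ℕ} (h : j ≤ p) : exchangeProj j (1, p) = (0, p + 2) := by
  simp [exchangeProj, h.not_gt]

theorem homeomorphic_capCup {k i j : ℕ} (hij : i ≤ j) (hj : j + 2 ≤ k) (a b : Diag k k)
    (ha : a.word = [.cap i, .cup (j + 2)]) (hb : b.word = [.cup j, .cap i]) (h) :
    Movie.Homeomorphic ((Quiver.Path.nil.cons (Move.isotopy a b h).arrow).cons
      (Move.isotopy b a h.symm).arrow) .nil := by
  obtain ⟨w, hw⟩ := a
  obtain ⟨w', hw'⟩ := b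
  dsimp only at ha hb
  subst ha hb
  have h0 : [Arc.cap i, Arc.cup (j + 2)][0]? = some (.cap i) := rfl
  have h1 : [Arc.cap i, Arc.cup (j + 2)][1]? = some (.cup (j + 2)) := rfl
  have h0' : [Arc.cup j, Arc.cap i][0]? = some (.cup j) := rfl
  have e0 : ∀ p, exchangeProj j (0, p) = (0, p) := fun p => rfl
  have e2 : ∀ p, exchangeProj j (1 + 1, p) = (1 + 1, p) := fun p => rfl
  refine Movie.homeomorphic_nil_of_isotopy _ _ _ (exchangeProj j) ?_ ?_ ?_ ?_ ?_ ?_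
  · rintro ⟨t, p⟩ ⟨ht, hp⟩
    change t ≤ 2 at ht
    interval_cases t
    · simpa [InFrame, widthAt, e0] using hp
    · have hp' : p < k - 2 := hp
      rcases lt_or_ge p j with h | h
      · rw [exchangeProj_one_of_lt h]
        exact ⟨by simp, show p < k by omega⟩
      · rw [exchangeProj_one_of_le h]
        exact ⟨by simp, show p + 2 < k by omega⟩
    · have hp' : p < k - 2 + 2 := hp
      exact ⟨le_rfl, show p < k + 2 - 2 by omega⟩
  · intro x y hxy
    cases hxy with
    | capLeft t i' p h hp =>
      obtain _ | _ | t := t <;> simp at h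
      subst h
      rw [exchangeProj_one_of_lt (by omega), e2]
      exact (Conn.capLeft h0 hp).trans _ _ _ (Conn.cupLeft h1 (by omega))
    | capRight t i' p h hp =>
      obtain _ | _ | t := t <;> simp at h
      subst h
      rw [zero_add, e2]
      rcases lt_or_ge p j with h | h
      · rw [exchangeProj_one_of_lt h]
        exact (Conn.capRight h0 hp).trans _ _ _ (Conn.cupLeft h1 (by omega))
      · rw [exchangeProj_one_of_le h]
        exact (Conn.capRight h0 (by omega)).trans _ _ _ (Conn.cupRight h1 (by omega))
    | capTurn t i' h =>
      obtain _ | _ | t := t <;> simp at h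
      subst h
      rw [zero_add, e2, e2]
      exact (Conn.cupLeft h1 (by omega)).symm.trans _ _ _ ((Conn.capTurn h0).trans _ _ _
        (Conn.cupLeft h1 (by omega)))
    | cupLeft t i' p h hp =>
      obtain _ | _ | t := t <;> simp at h
      subst h
      rw [zero_add, exchangeProj_one_of_lt hp, e0]
      exact .refl _
    | cupRight t i' p h hp =>
      obtain _ | _ | t := t <;> simp at h
      subst h
      rw [zero_add, exchangeProj_one_of_le hp, e0]
      exact .refl _
    | cupTurn t i' h =>
      obtain _ | _ | t := t <;> simp at h
      subst h
      rw [e0, e0]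
      exact (Conn.capRight h0 hij).trans _ _ _ ((Conn.cupTurn h1).trans _ _ _
        (Conn.capRight h0 (by omega)).symm)
  · intro p
    exact .refl _
  · intro p
    exact .refl _
  · rintro ⟨t, p⟩ ⟨ht, hp⟩
    change t ≤ 2 at ht
    interval_cases t
    · exact ⟨p, .inl (.refl _)⟩
    · rcases lt_or_ge p (j + 2) with hp | hp
      · exact ⟨p, .inr (Conn.cupLeft h1 hp)⟩
      · obtain ⟨p, rfl⟩ : ∃ q, p = q + 2 := ⟨p - 2, by omega⟩
        exact ⟨p, .inl (Conn.capRight h0 (by omega)).symm⟩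
    · exact ⟨p, .inr (.refl _)⟩
  · rintro ⟨t, p⟩ ⟨ht, hp⟩
    change t ≤ 2 at ht
    interval_cases t
    · exact ⟨p, .inl (.refl _)⟩
    · rcases lt_or_ge p j with hp | hp
      · exact ⟨p, .inl (Conn.cupLeft h0' hp).symm⟩
      · exact ⟨p + 2, .inl (Conn.cupRight h0' hp).symm⟩
    · exact ⟨p, .inr (.refl _)⟩

theorem homeomorphic_cupCap {k i j : ℕ} (hij : i ≤ j) (hj : j + 2 ≤ k) (a b : Diag k k)
    (ha : a.word = [.cap (j + 2), .cup i]) (hb : b.word = [.cup i, .cap j]) (h) :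
    Movie.Homeomorphic ((Quiver.Path.nil.cons (Move.isotopy a b h).arrow).cons
      (Move.isotopy b a h.symm).arrow) .nil := by
  obtain ⟨w, hw⟩ := a
  obtain ⟨w', hw'⟩ := b
  dsimp only at ha hb
  subst ha hb
  have h0 : [Arc.cap (j + 2), Arc.cup i][0]? = some (.cap (j + 2)) := rfl
  have h1 : [Arc.cap (j + 2), Arc.cup i][1]? = some (.cup i) := rfl
  have h0' : [Arc.cup i, Arc.cap j][0]? = some (.cup i) := rfl
  have e0 : ∀ p, exchangeProj i (0, p) = (0, p) := fun p => rfl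
  have e2 : ∀ p, exchangeProj i (1 + 1, p) = (1 + 1, p) := fun p => rfl
  refine Movie.homeomorphic_nil_of_isotopy _ _ _ (exchangeProj i) ?_ ?_ ?_ ?_ ?_ ?_
  · rintro ⟨t, p⟩ ⟨ht, hp⟩
    change t ≤ 2 at ht
    interval_cases t
    · simpa [InFrame, widthAt, e0] using hp
    · have hp' : p < k - 2 := hp
      rcases lt_or_ge p i with h | h
      · rw [exchangeProj_one_of_lt h]
        exact ⟨by simp, show p < k by omega⟩
      · rw [exchangeProj_one_of_le h]
        exact ⟨by simp, show p + 2 < k by omega⟩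
    · have hp' : p < k - 2 + 2 := hp
      exact ⟨le_rfl, show p < k + 2 - 2 by omega⟩
  · intro x y hxy
    cases hxy with
    | capLeft t i' p h hp =>
      obtain _ | _ | t := t <;> simp at h
      subst h
      rw [e2, zero_add]
      rcases lt_or_ge p i with h | h
      · rw [exchangeProj_one_of_lt h]
        exact (Conn.capLeft h0 (by omega)).trans _ _ _ (Conn.cupLeft h1 h)
      · rw [exchangeProj_one_of_le h]
        exact (Conn.capLeft h0 (by omega)).trans _ _ _ (Conn.cupRight h1 h)
    | capRight t i' p h hp =>
      obtain _ | _ | t := t <;> simp at h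
      subst h
      rw [zero_add, e2, exchangeProj_one_of_le (by omega)]
      exact (Conn.capRight h0 (by omega)).trans _ _ _ (Conn.cupRight h1 (by omega))
    | capTurn t i' h =>
      obtain _ | _ | t := t <;> simp at h
      subst h
      rw [zero_add, e2, e2]
      exact (Conn.cupRight h1 hij).symm.trans _ _ _ ((Conn.capTurn h0).trans _ _ _
        (Conn.cupRight h1 (by omega)))
    | cupLeft t i' p h hp =>
      obtain _ | _ | t := t <;> simp at h
      subst h
      rw [zero_add, exchangeProj_one_of_lt hp, e0]
      exact .refl _
    | cupRight t i' p h hp =>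
      obtain _ | _ | t := t <;> simp at h
      subst h
      rw [zero_add, exchangeProj_one_of_le hp, e0]
      exact .refl _
    | cupTurn t i' h =>
      obtain _ | _ | t := t <;> simp at h
      subst h
      rw [e0, e0]
      exact (Conn.capLeft h0 (by omega)).trans _ _ _ ((Conn.cupTurn h1).trans _ _ _
        (Conn.capLeft h0 (by omega)).symm)
  · intro p
    exact .refl _
  · intro p
    exact .refl _
  · rintro ⟨t, p⟩ ⟨ht, hp⟩
    change t ≤ 2 at ht
    interval_cases t
    · exact ⟨p, .inl (.refl _)⟩
    · rcases lt_or_ge p (j + 2) with hp | hp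
      · exact ⟨p, .inl (Conn.capLeft h0 hp).symm⟩
      · obtain ⟨p, rfl⟩ : ∃ q, p = q + 2 := ⟨p - 2, by omega⟩
        exact ⟨p, .inr (Conn.cupRight h1 (by omega))⟩
    · exact ⟨p, .inr (.refl _)⟩
  · rintro ⟨t, p⟩ ⟨ht, hp⟩
    change t ≤ 2 at ht
    interval_cases t
    · exact ⟨p, .inl (.refl _)⟩
    · rcases lt_or_ge p i with hp | hp
      · exact ⟨p, .inl (Conn.cupLeft h0' hp).symm⟩
      · exact ⟨p + 2, .inl (Conn.cupRight h0' hp).symm⟩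
    · exact ⟨p, .inr (.refl _)⟩

/-! ### Straightening the surfaces of the duality of caps and cups -/

/-- The projection of the levels of a diagram with three pieces to those of its first piece. -/
def levelProj : ℕ → ℕ
  | 0 => 0
  | 1 => 1
  | 2 => 0
  | _ => 1

theorem sum_ite_eq_zero {p q : Prop} [Decidable p] [Decidable q] (s : ℤ) (h : p ↔ q) :
    (if p then s else 0) + ((if q then -s else 0) + 0) = 0 := by
  by_cases hp : p
  · simp [hp, h.1 hp]
  · simp [hp, mt h.2 hp]

/-- In the intended cases `c'` is the mirror image of `c`, and `[c, c', c]` folds onto `c` with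
levels 0, 1, 2, 3 going to 0, 1, 0, 1. The move `e` inserts two pieces at the top and `e'` removes
the last two; both respect the folding, as they shift levels by 0 or 2. -/
theorem Movie.homeomorphic_nil_of_three {m n : ℕ} {a b : Diag m n} (c c' : Arc)
    (ha : a.word = [c]) (hb : b.word = [c, c', c]) (e : Move a b) (e' : Move b a)
    (hc : ∀ x y, Joined [c, c', c] x y → Conn [c] (levelProj x.1, x.2) (levelProj y.1, y.2))
    (he : ∀ x y, e.Persists x y ↔ x.2 = y.2 ∧ ((x.1 = y.1 ∧ x.1 = 0) ∨ y.1 = x.1 + 2))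
    (he' : ∀ x y, e'.Persists x y ↔ x.2 = y.2 ∧ ((x.1 = y.1 ∧ x.1 ≤ 1) ∨
      (x.1 = y.1 + 2 ∧ 1 ≤ y.1)))
    (hm : ∀ c, Movie.euler ((Quiver.Path.nil.cons e.arrow).cons e'.arrow) c = 0 ∧
      Movie.dots ((Quiver.Path.nil.cons e.arrow).cons e'.arrow) c = 0) :
    Movie.Homeomorphic ((Quiver.Path.nil.cons e.arrow).cons e'.arrow) .nil := by
  -- If `c` and `c'` were both caps or both cups, `a` and `b` could not have the same number of
  -- bottom end points; so `c'` undoes the change of width made by `c`.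
  have hw : widthAt m [c, c', c] 2 = m ∧ widthAt m [c, c', c] 3 = widthAt m [c] 1 := by
    obtain ⟨wa, ga⟩ := a
    obtain ⟨wb, gb⟩ := b
    dsimp only at ha hb
    subst ha hb
    cases c with
    | cap i =>
      cases c' with
      | cap i' =>
        have h1 : m + 2 = n := ga.2
        have h2 : m + 2 + 2 + 2 = n := gb.2.2.2
        omega
      | cup i' => exact ⟨rfl, rfl⟩
    | cup i =>
      have h := gb.1
      cases c' with
      | cap i' =>
        have h3 : m - 2 + 2 = m := by omega
        exact ⟨h3, congrArg (· - 2) h3⟩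
      | cup i' =>
        have h1 : m - 2 = n := ga.2
        have h2 : m - 2 - 2 - 2 = n := gb.2.2.2
        have h4 := gb.2.1
        omega
  refine Movie.homeomorphic_nil e e' (fun x => (levelProj x.1, x.2)) ?_ ?_ ?_ ?_ ?_ ?_ hm
  · rw [ha, hb]
    rintro ⟨t, p⟩ ⟨ht, hp⟩
    change t ≤ 3 at ht
    interval_cases t
    · exact ⟨Nat.zero_le _, hp⟩
    · exact ⟨le_rfl, hp⟩
    · exact ⟨Nat.zero_le _, lt_of_lt_of_eq hp hw.1⟩
    · exact ⟨le_rfl, lt_of_lt_of_eq hp hw.2⟩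
  · rw [ha, hb]
    exact hc
  · rintro ⟨t, p⟩ ⟨t', p'⟩ hy h
    rw [hb] at hy
    change t' ≤ 3 at hy
    rw [he] at h
    dsimp only at h ⊢
    obtain ⟨rfl, h⟩ := h
    rw [show levelProj t' = t by interval_cases t' <;> simp only [levelProj] <;> omega]
    exact .refl _
  · rintro ⟨t, p⟩ ⟨t', p'⟩ hy h
    rw [hb] at hy
    change t ≤ 3 at hy
    rw [he'] at h
    dsimp only at h ⊢
    obtain ⟨rfl, h⟩ := h
    rw [show levelProj t = t' by interval_cases t <;> simp only [levelProj] <;> omega]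
    exact .refl _
  · rw [ha, hb]
    rintro ⟨t, p⟩ ⟨ht, hp⟩
    change t ≤ 1 at ht
    interval_cases t
    · exact ⟨(0, p), (0, p), ⟨Nat.zero_le _, hp⟩, .refl _, (he _ _).2 ⟨rfl, by simp⟩,
        (he' _ _).2 ⟨rfl, by simp⟩⟩
    · exact ⟨(1, p), (3, p), ⟨le_rfl, lt_of_lt_of_eq hp hw.2.symm⟩, .refl _,
        (he _ _).2 ⟨rfl, by simp⟩, (he' _ _).2 ⟨rfl, by simp⟩⟩
  · rw [ha, hb]
    rintro ⟨t, p⟩ ⟨ht, hp⟩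
    change t ≤ 3 at ht
    interval_cases t
    · exact ⟨(0, p), (0, p), ⟨Nat.zero_le _, hp⟩, .refl _, .inl ((he _ _).2 ⟨rfl, by simp⟩)⟩
    · exact ⟨(1, p), (1, p), ⟨le_rfl, hp⟩, .refl _, .inr ((he' _ _).2 ⟨rfl, by simp⟩)⟩
    · exact ⟨(0, p), (2, p), ⟨Nat.zero_le _, lt_of_lt_of_eq hp hw.1⟩, .refl _,
        .inl ((he _ _).2 ⟨rfl, by simp⟩)⟩
    · exact ⟨(1, p), (3, p), ⟨le_rfl, lt_of_lt_of_eq hp hw.2⟩, .refl _,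
        .inr ((he' _ _).2 ⟨rfl, by simp⟩)⟩

namespace Local

/-- `k` vertical strands and a cup, which has `i` strands on its left. -/
def bowl (k i : ℕ) (h : i ≤ k) : Diag (k + 2) k := ⟨[.cup i], ⟨by omega, rfl⟩⟩

/-- The same picture with a circle inserted below the cup. -/
def bowlCircle (k i : ℕ) (h : i ≤ k) : Diag (k + 2) k :=
  ⟨[.cup i, .cap i, .cup i], ⟨by omega, h, by omega, rfl⟩⟩

/-- A circle is born above the cap. -/
def birthArc (k i : ℕ) (h : i ≤ k) : Move (arc k i h) (circleArc k i h) :=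
  ⟨[], [.cap i], k, .birth i, rfl, h, rfl, rfl⟩

/-- A circle is split off from the cup by a saddle above. -/
def splitBowl (k i : ℕ) (h : i ≤ k) : Move (bowl k i h) (bowlCircle k i h) :=
  ⟨[], [.cup i], k + 2, .cosaddle i, rfl, show i + 2 ≤ k + 2 by omega, rfl, rfl⟩

/-- The circle below the cup dies. -/
def deathBowl (k i : ℕ) (h : i ≤ k) : Move (bowlCircle k i h) (bowl k i h) :=
  ⟨[.cup i], [], k, .death i, ⟨by omega, rfl⟩, h, rfl, rfl⟩

/-- A new disk merged into a sheet does not change the sheet. Birth and saddle are marked at the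
same point of the middle frame, so their contributions 1 and -1 to the Euler characteristic cancel.
-/
theorem homeomorphic_birthArc_merge (k i : ℕ) (h : i ≤ k) :
    Movie.Homeomorphic ((Quiver.Path.nil.cons (birthArc k i h).arrow).cons (merge k i h).arrow)
      .nil := by
  have h0 : [Arc.cap i][0]? = some (.cap i) := rfl
  refine Movie.homeomorphic_nil_of_three (.cap i) (.cup i) rfl rfl _ _ ?_ ?_ ?_ ?_
  · intro x y hxy
    cases hxy with
    | capLeft t i' p h hp =>
      obtain _ | _ | _ | t := t <;> simp at h <;> subst h <;> exact Conn.capLeft h0 hp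
    | capRight t i' p h hp =>
      obtain _ | _ | _ | t := t <;> simp at h <;> subst h <;> exact Conn.capRight h0 hp
    | capTurn t i' h =>
      obtain _ | _ | _ | t := t <;> simp at h <;> subst h <;> exact Conn.capTurn h0
    | cupLeft t i' p h hp =>
      obtain _ | _ | _ | t := t <;> simp at h <;> subst h <;> exact (Conn.capLeft h0 hp).symm
    | cupRight t i' p h hp =>
      obtain _ | _ | _ | t := t <;> simp at h <;> subst h <;> exact (Conn.capRight h0 hp).symm
    | cupTurn t i' h =>
      obtain _ | _ | _ | t := t <;> simp at h <;> subst h <;> exact Conn.capTurn h0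
  · rintro ⟨t, p⟩ ⟨t', p'⟩
    simp only [Move.Persists, birthArc, Event.src, Event.tgt, List.length_nil, List.length_cons]
    refine and_congr_right fun _ => ⟨?_, ?_⟩
    · rintro (h | ⟨s, h⟩) <;> omega
    · rintro (h | h)
      · exact .inl (by omega)
      · exact .inr ⟨t, by omega⟩
  · rintro ⟨t, p⟩ ⟨t', p'⟩
    simp only [Move.Persists, merge, Event.src, Event.tgt, List.length_nil, List.length_cons]
    refine and_congr_right fun _ => ⟨?_, ?_⟩
    · rintro (h | ⟨s, h⟩) <;> omega
    · rintro (h | h)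
      · exact .inl (by omega)
      · exact .inr ⟨t' - 1, by omega⟩
  · intro c
    constructor
    · classical
      exact sum_ite_eq_zero 1 Iff.rfl
    · classical
      change (if _ then 0 else 0) + ((if _ then 0 else 0) + 0) = 0
      simp

/-- The upside-down cancellation: splitting off a circle and capping it with a disk leaves the sheet
unchanged. -/
theorem homeomorphic_splitBowl_deathBowl (k i : ℕ) (h : i ≤ k) :
    Movie.Homeomorphic ((Quiver.Path.nil.cons (splitBowl k i h).arrow).cons
      (deathBowl k i h).arrow) .nil := by
  have h0 : [Arc.cup i][0]? = some (.cup i) := rfl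
  refine Movie.homeomorphic_nil_of_three (.cup i) (.cap i) rfl rfl _ _ ?_ ?_ ?_ ?_
  · intro x y hxy
    cases hxy with
    | cupLeft t i' p h hp =>
      obtain _ | _ | _ | t := t <;> simp at h <;> subst h <;> exact Conn.cupLeft h0 hp
    | cupRight t i' p h hp =>
      obtain _ | _ | _ | t := t <;> simp at h <;> subst h <;> exact Conn.cupRight h0 hp
    | cupTurn t i' h =>
      obtain _ | _ | _ | t := t <;> simp at h <;> subst h <;> exact Conn.cupTurn h0
    | capLeft t i' p h hp =>
      obtain _ | _ | _ | t := t <;> simp at h <;> subst h <;> exact (Conn.cupLeft h0 hp).symm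
    | capRight t i' p h hp =>
      obtain _ | _ | _ | t := t <;> simp at h <;> subst h <;> exact (Conn.cupRight h0 hp).symm
    | capTurn t i' h =>
      obtain _ | _ | _ | t := t <;> simp at h <;> subst h <;> exact Conn.cupTurn h0
  · rintro ⟨t, p⟩ ⟨t', p'⟩
    simp only [Move.Persists, splitBowl, Event.src, Event.tgt, List.length_nil, List.length_cons]
    refine and_congr_right fun _ => ⟨?_, ?_⟩
    · rintro (h | ⟨s, h⟩) <;> omega
    · rintro (h | h)
      · exact .inl (by omega)
      · exact .inr ⟨t, by omega⟩
  · rintro ⟨t, p⟩ ⟨t', p'⟩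
    simp only [Move.Persists, deathBowl, Event.src, Event.tgt, List.length_nil, List.length_cons]
    refine and_congr_right fun _ => ⟨?_, ?_⟩
    · rintro (h | ⟨s, h⟩) <;> omega
    · rintro (h | h)
      · exact .inl (by omega)
      · exact .inr ⟨t' - 1, by omega⟩
  · intro c
    -- The saddle is marked at level 0 of the first frame, the death at level 2 of the second. The
    -- cosaddle inserts two pieces above, so these points persist into each other and -1 and 1
    -- belong to the same component.
    have key : Movie.Adj ((Quiver.Path.nil.cons (splitBowl k i h).arrow).cons
        (deathBowl k i h).arrow)
        (Sum.inl (Sum.inl ⟨(0, i), Nat.zero_le _, show i < k + 2 by omega⟩))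
        (Sum.inl (Sum.inr ⟨(2, i), show 2 ≤ 3 by omega, show i < k + 2 - 2 + 2 by omega⟩)) :=
      ⟨_, rfl, rfl, .inr ⟨0, rfl, rfl⟩⟩
    constructor
    · classical
      have hq := Quot.sound key
      exact sum_ite_eq_zero (-1) (Eq.congr_left hq)
    · classical
      change (if _ then 0 else 0) + ((if _ then 0 else 0) + 0) = 0
      simp

end Local

theorem Cob.birthArc_merge (k i : ℕ) (h : i ≤ k) :
    Cob.move (Local.birthArc k i h) ≫ Cob.move (Local.merge k i h) = 𝟙 _ :=
  Cob.move_comp_move _ _ (Local.homeomorphic_birthArc_merge k i h)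

theorem Cob.splitBowl_deathBowl (k i : ℕ) (h : i ≤ k) :
    Cob.move (Local.splitBowl k i h) ≫ Cob.move (Local.deathBowl k i h) = 𝟙 _ :=
  Cob.move_comp_move _ _ (Local.homeomorphic_splitBowl_deathBowl k i h)

/-! ### Complexes killed by stacking a diagram on the bottom -/

section Killed

variable {l m n n' : ℕ} {ι : Type*} {c : ComplexShape ι}

/-- Stacking the diagram `y` on the bottom of `K` gives a contractible complex. -/
def Killed (K : HomologicalComplex (BN l m) c) (y : QDiag m n) : Prop :=
  Contractible (((QDiag.bot y).mapMat_.mapHomologicalComplex c).obj K)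

variable {K : HomologicalComplex (BN l m) c}

theorem Killed.stack {y : QDiag m n} (h : Killed K y) (z : QDiag n n') :
    Killed K ((QDiag.bot z).obj y) := by
  have h' : Contractible (((QDiag.bot y ⋙ QDiag.bot z).mapMat_.mapHomologicalComplex c).obj K) :=
    Contractible.map h (QDiag.bot z).mapMat_
  have e := QDiag.bot_comp (k := l) y z
  unfold Killed
  simp only [← e]
  exact h'

theorem Killed.qShift {y : QDiag m n} (h : Killed K y) (s : ℤ) :
    Killed K ((QDiag.qShift s).obj y) := by
  have h' : Contractible (((QDiag.bot y ⋙ QDiag.qShift s).mapMat_.mapHomologicalComplex c).obj K) :=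
    Contractible.map h (QDiag.qShift s).mapMat_
  have e := QDiag.bot_qShift (l := l) y s
  unfold Killed
  simp only [← e]
  exact h'

/-- Stacking is functorial in the bottom diagram, so a decomposition of the identity of `y` induces
one of the identity of `K ⊗ y`. -/
theorem killed_of_sum {y : QDiag m n} {T : Type*} (s : Finset T) (z : T → QDiag m n)
    (φ : ∀ t, y ⟶ z t) (ψ : ∀ t, z t ⟶ y) (h : ∑ t ∈ s, φ t ≫ ψ t = 𝟙 y)
    (hz : ∀ t ∈ s, Killed K (z t)) : Killed K y := by
  let τ : ∀ t, QDiag.bot (l := l) y ⟶ QDiag.bot (z t) := fun t => QDiag.stack.flip.map (φ t)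
  let σ : ∀ t, QDiag.bot (l := l) (z t) ⟶ QDiag.bot y := fun t => QDiag.stack.flip.map (ψ t)
  have hτ : ∑ t ∈ s, τ t ≫ σ t = 𝟙 (QDiag.bot (l := l) y) := by
    ext X : 2
    rw [NatTrans.app_sum]
    change ∑ t ∈ s, (QDiag.top X).map (φ t) ≫ (QDiag.top X).map (ψ t) = 𝟙 ((QDiag.top X).obj y)
    rw [← (QDiag.top X).map_id, ← h, CategoryTheory.Functor.map_sum]
    simp only [CategoryTheory.Functor.map_comp]
  have hτ' : ∑ t ∈ s, mapMatNat (τ t) ≫ mapMatNat (σ t) = 𝟙 (QDiag.bot (l := l) y).mapMat_ := by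
    rw [← mapMatNat_id, ← hτ, mapMatNat_sum]
    simp only [mapMatNat_comp]
  refine contractible_map_of_sum s _ (fun t => (QDiag.bot (z t)).mapMat_)
    (fun t => mapMatNat (τ t)) (fun t => mapMatNat (σ t)) (fun X => ?_) hz
  exact (NatTrans.app_sum _ _ _).symm.trans (NatTrans.congr_app hτ' X)

theorem killed_of_sum_stack {k k' : ℕ} (u : QDiag m k) (v : QDiag k' n) {y : QDiag k k'}
    {T : Type*} (s : Finset T) (z : T → QDiag k k') (φ : ∀ t, y ⟶ z t) (ψ : ∀ t, z t ⟶ y)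
    (h : ∑ t ∈ s, φ t ≫ ψ t = 𝟙 y)
    (hz : ∀ t ∈ s, Killed K ((QDiag.bot v).obj ((QDiag.top u).obj (z t)))) :
    Killed K ((QDiag.bot v).obj ((QDiag.top u).obj y)) := by
  refine killed_of_sum s _ (fun t => (QDiag.bot v).map ((QDiag.top u).map (φ t)))
    (fun t => (QDiag.bot v).map ((QDiag.top u).map (ψ t))) ?_ hz
  have h1 := congrArg (fun f => (QDiag.bot v).map ((QDiag.top u).map f)) h
  rw [CategoryTheory.Functor.map_id, CategoryTheory.Functor.map_id] at h1
  rw [← h1, CategoryTheory.Functor.map_sum, CategoryTheory.Functor.map_sum]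
  simp only [CategoryTheory.Functor.map_comp]

end Killed

/-! ### Elementary cobordisms as morphisms of degree zero, and neck cutting -/

namespace Cob

theorem move_homog {m n : ℕ} {a b : Diag m n} (e : Move a b) :
    move e ∈ homog a b e.event.degree :=
  AddSubgroup.subset_closure ⟨0, e.arrow.toPath, by
    simp only [Movie.degree, Quiver.Hom.toPath, Nat.cast_zero, mul_zero, zero_add],
    (one_smul Coeff (move e)).symm.trans (by rw [pow_zero]; rfl)⟩

end Cob

namespace QDiag

/-- An elementary cobordism as a morphism of degree zero. -/
def ofMove {m n : ℕ} {a b : Diag m n} (e : Move a b) (s t : ℤ) (h : s - t = e.event.degree) :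
    (⟨a, s⟩ : QDiag m n) ⟶ ⟨b, t⟩ :=
  ⟨Cob.move e, by rw [h]; exact Cob.move_homog e⟩

/-- Neck cutting for a circle in a diagram. -/
theorem neck_cutting (k i : ℕ) (h : i ≤ k) :
    ofMove (Local.circleDot k i h) 0 (-2) rfl ≫ ofMove (Local.death k i h) (-2) (-1) rfl ≫
        ofMove (Local.birth k i h) (-1) 0 rfl +
      ofMove (Local.death k i h) 0 1 rfl ≫ ofMove (Local.birth k i h) 1 2 rfl ≫
        ofMove (Local.circleDot k i h) 2 0 rfl = 𝟙 _ := by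
  refine QDiag.hom_ext ?_
  have h := CategoryTheory.Quotient.sound (cobRel k k) (Rel.neck k i h)
  refine Eq.trans ?_ h.symm
  refine Eq.trans ?_ ((CategoryTheory.Quotient.functor (cobRel k k)).map_add
    (f := (Local.circleDot k i _).hom ≫ (Local.death k i _).hom ≫ (Local.birth k i _).hom)).symm
  refine congrArg₂ (· + ·) ?_ ?_
  · rw [CategoryTheory.Functor.map_comp, CategoryTheory.Functor.map_comp]
    rfl
  · rw [CategoryTheory.Functor.map_comp, CategoryTheory.Functor.map_comp]
    rfl

theorem ofMove_comp_ofMove {m n : ℕ} {a b : Diag m n} (e : Move a b) (e' : Move b a) (s t : ℤ)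
    (h h') (hm : Movie.Homeomorphic ((Quiver.Path.nil.cons e.arrow).cons e'.arrow) .nil) :
    ofMove e s t h ≫ ofMove e' t s h' = 𝟙 _ :=
  QDiag.hom_ext (Cob.move_comp_move e e' hm)

end QDiag

/-! ### Diagrams with fewer end points on the bottom are killed -/

theorem Goes.exists_of_append {u v : List Arc} {m n : ℕ} (h : Goes (u ++ v) m n) :
    ∃ k, Goes u m k ∧ Goes v k n := by
  induction u generalizing m with
  | nil => exact ⟨m, rfl, h⟩
  | cons c u ih =>
    cases c with
    | cap i =>
      obtain ⟨k, h1, h2⟩ := ih h.2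
      exact ⟨k, ⟨h.1, h1⟩, h2⟩
    | cup i =>
      obtain ⟨k, h1, h2⟩ := ih h.2
      exact ⟨k, ⟨h.1, h1⟩, h2⟩

/-- A measure which decreases when a cup is moved above a cap or cancels with it. -/
def Arc.weight (w : List Arc) : ℕ :=
  -- This is the sum over all cups of 2 to the number of caps above it. For a cap and cup followed
  -- by weight `x` it is `2 * x + 2`, against `2 * x + 1` after the exchange and `x` after
  -- cancellation.
  w.foldr (fun c x => match c with | .cap _ => 2 * x | .cup _ => x + 1) 0

theorem Arc.weight_append_lt {v v' : List Arc} (h : weight v < weight v') (u : List Arc) :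
    weight (u ++ v) < weight (u ++ v') := by
  induction u with
  | nil => exact h
  | cons c u ih =>
    cases c with
    | cap i => exact Nat.mul_lt_mul_of_pos_left ih two_pos
    | cup i => exact Nat.succ_lt_succ ih

/-- A word that neither starts with a cup nor has a cap directly above a cup consists of caps only,
and then cannot lose end points. -/
theorem Arc.exists_cap_cup (w : List Arc) :
    (∃ p v, w = .cup p :: v) ∨ (∀ m n, Goes w m n → m ≤ n) ∨
      ∃ u p q v, w = u ++ (.cap p :: .cup q :: v) := by
  induction w with
  | nil => exact .inr (.inl fun m n h => le_of_eq h)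
  | cons c w ih =>
    cases c with
    | cup p => exact .inl ⟨p, w, rfl⟩
    | cap p =>
      rcases ih with ⟨q, v, rfl⟩ | h | ⟨u, p', q, v, rfl⟩
      · exact .inr (.inr ⟨[], p, q, v, rfl⟩)
      · refine .inr (.inl fun m n hw => ?_)
        have := h _ _ hw.2
        omega
      · exact .inr (.inr ⟨.cap p :: u, p', q, v, rfl⟩)

section

variable {l m n : ℕ} {ι : Type*} {c : ComplexShape ι} {K : HomologicalComplex (BN l m) c}

/-- Shifting preserves contractibility, so being killed depends only on the word and the `q`-shift
can be chosen freely. -/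
theorem Killed.of_diag_eq {a b : Diag m n} {s : ℤ} (h : Killed K ⟨a, s⟩) (e : a.word = b.word)
    (t : ℤ) : Killed K ⟨b, t⟩ := by
  obtain rfl : a = b := Diag.ext e
  have := h.qShift (t - s)
  rwa [show (QDiag.qShift (t - s)).obj (⟨a, s⟩ : QDiag m n) = ⟨a, t⟩ from
    QDiag.ext rfl (add_sub_cancel s t)] at this

theorem killed_of_local {k : ℕ} (u : Diag m k) (v : Diag k n) {a : Diag k k} {T : Type*}
    (s : Finset T) (z : T → QDiag k k) (φ : ∀ t, (⟨a, 0⟩ : QDiag k k) ⟶ z t)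
    (ψ : ∀ t, z t ⟶ ⟨a, 0⟩) (h : ∑ t ∈ s, φ t ≫ ψ t = 𝟙 _)
    (hz : ∀ t ∈ s, Killed K ⟨(u.stack (z t).diag).stack v, 0⟩) :
    Killed K ⟨(u.stack a).stack v, 0⟩ :=
  (killed_of_sum_stack ⟨u, 0⟩ ⟨v, 0⟩ s z φ ψ h (fun t ht =>
    (hz t ht).of_diag_eq rfl _)).of_diag_eq rfl 0

/-- Only the round trip from `a` through `b` has to be the identity: a retract of a contractible
complex is contractible. -/
theorem killed_of_isotopy {k : ℕ} (u : Diag m k) (v : Diag k n) (a b : Diag k k)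
    (h : IsotopyStep a.word b.word ∨ IsotopyStep b.word a.word)
    (hm : Movie.Homeomorphic ((Quiver.Path.nil.cons (Move.isotopy a b h).arrow).cons
      (Move.isotopy b a h.symm).arrow) .nil)
    (hb : Killed K ⟨(u.stack b).stack v, 0⟩) : Killed K ⟨(u.stack a).stack v, 0⟩ :=
  killed_of_local u v (Finset.univ : Finset Unit) (fun _ => ⟨b, 0⟩)
    (fun _ => QDiag.ofMove (Move.isotopy a b h) 0 0 rfl)
    (fun _ => QDiag.ofMove (Move.isotopy b a h.symm) 0 0 rfl)
    (by
      rw [Finset.univ_unique, Finset.sum_singleton]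
      exact QDiag.ofMove_comp_ofMove _ _ _ _ _ _ hm) (fun _ _ => hb)

/-- By neck cutting the identity of the circle factors through two copies of the diagram without it,
shifted by -1 and 1. -/
theorem killed_of_circle {k i : ℕ} (h : i ≤ k) (u : Diag m k) (v : Diag k n)
    (hb : Killed K ⟨(u.stack (Diag.one k)).stack v, 0⟩) :
    Killed K ⟨(u.stack (Local.circle k i h)).stack v, 0⟩ :=
  killed_of_local u v (Finset.univ : Finset Bool)
    (fun t => ⟨Diag.one k, bif t then -1 else 1⟩)
    (fun t => match t with
      | true => QDiag.ofMove (Local.circleDot k i h) 0 (-2) rfl ≫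
          QDiag.ofMove (Local.death k i h) (-2) (-1) rfl
      | false => QDiag.ofMove (Local.death k i h) 0 1 rfl)
    (fun t => match t with
      | true => QDiag.ofMove (Local.birth k i h) (-1) 0 rfl
      | false => QDiag.ofMove (Local.birth k i h) 1 2 rfl ≫
          QDiag.ofMove (Local.circleDot k i h) 2 0 rfl)
    (by
      rw [Fintype.sum_bool, Category.assoc]
      exact QDiag.neck_cutting k i h) (fun _ _ => hb)

/-- A complex which is killed by all turnbacks on the bottom is killed by all diagrams with fewer
end points on the bottom than on the top. -/
theorem killed_of_turnbacks (hK : ∀ (p : ℕ) (h : p + 2 ≤ m), Killed K ⟨Diag.cupTurn m p h, 0⟩)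
    (hn : n < m) (a : Diag m n) : Killed K ⟨a, 0⟩ := by
  induction hx : Arc.weight a.word using Nat.strong_induction_on generalizing a with
  | _ x ih =>
  subst hx
  have ih' : ∀ b : Diag m n, Arc.weight b.word < Arc.weight a.word → Killed K ⟨b, 0⟩ :=
    fun b hb => ih _ hb b rfl
  clear ih
  obtain ⟨w, hw⟩ := a
  rcases Arc.exists_cap_cup w with ⟨p, v, rfl⟩ | h | ⟨u, p, q, v, rfl⟩
  -- A leading cup is a turnback, and the rest of the diagram is stacked below it.
  · exact ((hK p hw.1).stack (⟨⟨v, hw.2⟩, 0⟩ : QDiag (m - 2) n)).of_diag_eq rfl 0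
  · exact absurd (h _ _ hw) (by omega)
  · obtain ⟨k, hu, hp, hq, hv⟩ := hw.exists_of_append
    rw [Nat.add_sub_cancel] at hv
    have hlt : ∀ b : List Arc, Arc.weight (b ++ v) < Arc.weight (.cap p :: .cup q :: v) →
        Arc.weight ((u ++ b) ++ v) < Arc.weight (u ++ (.cap p :: .cup q :: v)) := by
      intro b hb
      rw [List.append_assoc]
      exact Arc.weight_append_lt hb u
    let U : Diag m k := ⟨u, hu⟩
    let V : Diag k n := ⟨v, hv⟩
    let A : Diag k k := ⟨[.cap p, .cup q], hp, hq, Nat.add_sub_cancel _ _⟩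
    have key : Killed K ⟨(U.stack A).stack V, 0⟩ → Killed K ⟨⟨_, hw⟩, 0⟩ := fun h =>
      h.of_diag_eq (b := ⟨_, hw⟩) (List.append_assoc u [.cap p, .cup q] v) 0
    have h0 : Killed K ⟨(U.stack (Diag.one k)).stack V, 0⟩ :=
      ih' _ (hlt [] (show Arc.weight v < 2 * (Arc.weight v + 1) by omega))
    apply key
    -- Adjacent positions form a zigzag, which is straightened; equal positions close up to a
    -- circle, which is removed; otherwise the pieces are distant and the cup moves above the cap.
    -- The weight drops in each case.
    rcases lt_trichotomy p q with h | rfl | h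
    · obtain rfl | h := (Nat.succ_le_of_lt h).eq_or_lt'
      · exact killed_of_isotopy U V A (Diag.one k) (.inl (.zigzagL p))
          (homeomorphic_zigzagL A rfl _) h0
      · obtain ⟨j, rfl⟩ : ∃ j, q = j + 2 := ⟨q - 2, by omega⟩
        let B : Diag k k := ⟨[.cup j, .cap p], by omega, by omega, show k - 2 + 2 = k by omega⟩
        exact killed_of_isotopy U V A B (.inl (.capCup p j (by omega)))
          (homeomorphic_capCup (by omega) (by omega) A B rfl rfl _)
          (ih' _ (hlt _ (show 2 * Arc.weight v + 1 < 2 * (Arc.weight v + 1) by omega)))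
    · exact killed_of_circle hp U V h0
    · obtain rfl | h := (Nat.succ_le_of_lt h).eq_or_lt'
      · exact killed_of_isotopy U V A (Diag.one k) (.inl (.zigzagR q))
          (homeomorphic_zigzagR A rfl _) h0
      · obtain ⟨j, rfl⟩ : ∃ j, p = j + 2 := ⟨p - 2, by omega⟩
        let B : Diag k k := ⟨[.cup q, .cap j], by omega, by omega, show k - 2 + 2 = k by omega⟩
        exact killed_of_isotopy U V A B (.inr (.cupCap q j (by omega)))
          (homeomorphic_cupCap (by omega) (by omega) A B rfl rfl _)
          (ih' _ (hlt _ (show 2 * Arc.weight v + 1 < 2 * (Arc.weight v + 1) by omega)))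

end

/-! ### Duality -/

section HalfAdjunction

variable {V W : Type*} [Category.{0} V] [Category.{0} W] [Preadditive V] [Preadditive W]
  (F : V ⥤ W) [F.Additive] (F' : W ⥤ V) [F'.Additive] (η : 𝟭 V ⟶ F ⋙ F') (ε : F' ⋙ F ⟶ 𝟭 W)

/-- The map `Hom(F X, Z) → Hom(X, F' Z)` of an adjunction. -/
def transposeHom (X : V) (Z : W) : (F.obj X ⟶ Z) →+ (X ⟶ F'.obj Z) where
  toFun f := η.app X ≫ F'.map f
  map_zero' := by rw [F'.map_zero, comp_zero]
  map_add' f g := by rw [F'.map_add, Preadditive.comp_add]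

/-- The map `Hom(X, F' Z) → Hom(F X, Z)` of an adjunction. -/
def transposeInvHom (X : V) (Z : W) : (X ⟶ F'.obj Z) →+ (F.obj X ⟶ Z) where
  toFun f := F.map f ≫ ε.app Z
  map_zero' := by rw [F.map_zero, zero_comp]
  map_add' f g := by rw [F.map_add, Preadditive.add_comp]

theorem transposeHom_comp (X : V) {Z Z' : W} (f : F.obj X ⟶ Z) (g : Z ⟶ Z') :
    transposeHom F F' η X Z' (f ≫ g) = transposeHom F F' η X Z f ≫ F'.map g := by
  change η.app X ≫ F'.map (f ≫ g) = (η.app X ≫ F'.map f) ≫ F'.map g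
  rw [F'.map_comp, Category.assoc]

theorem transposeInvHom_comp (X : V) {Z Z' : W} (f : X ⟶ F'.obj Z) (g : Z ⟶ Z') :
    transposeInvHom F F' ε X Z' (f ≫ F'.map g) = transposeInvHom F F' ε X Z f ≫ g := by
  change F.map (f ≫ F'.map g) ≫ ε.app Z' = (F.map f ≫ ε.app Z) ≫ g
  rw [F.map_comp, Category.assoc, Category.assoc]
  exact congrArg (F.map f ≫ ·) (ε.naturality g)

theorem transposeInvHom_transposeHom (X : V) (h : F.map (η.app X) ≫ ε.app (F.obj X) = 𝟙 (F.obj X))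
    {Z : W} (f : F.obj X ⟶ Z) : transposeInvHom F F' ε X Z (transposeHom F F' η X Z f) = f := by
  change F.map (η.app X ≫ F'.map f) ≫ ε.app Z = f
  rw [F.map_comp, Category.assoc]
  refine (congrArg (F.map (η.app X) ≫ ·) (ε.naturality f)).trans ?_
  refine (Category.assoc _ _ _).symm.trans ?_
  exact (congrArg (· ≫ f) h).trans (Category.id_comp f)

/-- The map `Hom(F X, -) ⟶ Hom(X, F' -)` of an adjunction. -/
def coyonedaTranspose (X : V) : preadditiveCoyoneda.obj (Opposite.op (F.obj X)) ⟶
    F' ⋙ preadditiveCoyoneda.obj (Opposite.op X) where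
  app Z := AddCommGrpCat.ofHom (transposeHom F F' η X Z)
  naturality Z Z' g := by
    ext f
    exact transposeHom_comp F F' η X f g

/-- The map `Hom(X, F' -) ⟶ Hom(F X, -)` of an adjunction. -/
def coyonedaTransposeInv (X : V) : F' ⋙ preadditiveCoyoneda.obj (Opposite.op X) ⟶
    preadditiveCoyoneda.obj (Opposite.op (F.obj X)) where
  app Z := AddCommGrpCat.ofHom (transposeInvHom F F' ε X Z)
  naturality Z Z' g := by
    ext f
    exact transposeInvHom_comp F F' ε X f g

/-- One triangle identity makes Hom(F X, -) a retract of Hom(X, F' -), naturally in the second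
variable. This is enough for contractibility, without a full adjunction. -/
theorem contractible_homFrom_of_triangle {ι : Type*} {c : ComplexShape ι}
    {G : HomologicalComplex W c} (X : V) (h : F.map (η.app X) ≫ ε.app (F.obj X) = 𝟙 (F.obj X))
    (hG : Contractible (homFrom X ((F'.mapHomologicalComplex c).obj G))) :
    Contractible (homFrom (F.obj X) G) := by
  refine contractible_map_of_sum (Finset.univ : Finset Unit) _
    (fun _ => F' ⋙ preadditiveCoyoneda.obj (Opposite.op X))
    (fun _ => coyonedaTranspose F F' η X) (fun _ => coyonedaTransposeInv F F' ε X)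
    (fun Z => ?_) (fun _ _ => hG)
  rw [Finset.univ_unique, Finset.sum_singleton]
  ext f
  exact transposeInvHom_transposeHom F F' η ε X h f

end HalfAdjunction

theorem comp_heq_comp {C : Type*} [Category* C] {X Y Z X' Y' Z' : C} (hX : X = X') (hY : Y = Y')
    (hZ : Z = Z') {f : X ⟶ Y} {f' : X' ⟶ Y'} {g : Y ⟶ Z} {g' : Y' ⟶ Z'} (hf : f ≍ f')
    (hg : g ≍ g') : f ≫ g ≍ f' ≫ g' := by
  subst hX hY hZ
  rw [eq_of_heq hf, eq_of_heq hg]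

/-- A diagram `dual` with a unit and a counit which satisfy one of the triangle identities with
`c`. -/
structure QDiag.HasDual {j n : ℕ} (c : QDiag j n) where
  dual : QDiag n j
  unit : QDiag.one j ⟶ (QDiag.bot dual).obj c
  counit : (QDiag.bot c).obj dual ⟶ QDiag.one n
  -- The bracketings `(c ⊗ dual) ⊗ c` and `c ⊗ (dual ⊗ c)` are equal but not identical, so their
  -- common value is named and the two arrows of the triangle are compared with arrows at `mid`
  -- heterogeneously.
  mid : QDiag j n
  left : c ⟶ mid
  right : mid ⟶ c
  obj_eq : (QDiag.bot c).obj ((QDiag.bot dual).obj c) = mid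
  left_heq : (QDiag.bot c).map unit ≍ left
  right_heq : (QDiag.top c).map counit ≍ right
  left_right : left ≫ right = 𝟙 c

namespace QDiag

variable {l j n : ℕ}

theorem one_bot (c : QDiag j n) : (bot c).obj (one j) = c :=
  QDiag.ext rfl (zero_add _)

theorem bot_one_obj (c : QDiag j n) : (bot (one n)).obj c = c :=
  QDiag.ext c.diag.stack_one (add_zero _)

theorem bot_bot_obj {k l m n : ℕ} (x : QDiag k l) (y : QDiag l m) (z : QDiag m n) :
    (bot z).obj ((bot y).obj x) = (bot ((bot z).obj y)).obj x :=
  Functor.congr_obj (bot_comp y z) x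

namespace HasDual

variable {c : QDiag j n} (D : c.HasDual)

/-- The unit as a natural transformation. -/
def unitNat (l : ℕ) : 𝟭 (QDiag l j) ⟶ bot c ⋙ bot D.dual :=
  eqToHom bot_one.symm ≫ QDiag.stack.flip.map D.unit ≫ eqToHom (bot_comp c D.dual).symm

/-- The counit as a natural transformation. -/
def counitNat (l : ℕ) : bot D.dual ⋙ bot c ⟶ 𝟭 (QDiag l n) :=
  eqToHom (bot_comp D.dual c) ≫ QDiag.stack.flip.map D.counit ≫ eqToHom bot_one

theorem unitNat_app (w : QDiag l j) : (D.unitNat l).app w ≍ (top w).map D.unit := by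
  unfold unitNat
  rw [NatTrans.comp_app, NatTrans.comp_app, eqToHom_app, eqToHom_app, eqToHom_comp_heq_iff,
    comp_eqToHom_heq_iff]
  rfl

theorem counitNat_app (w : QDiag l n) : (D.counitNat l).app w ≍ (top w).map D.counit := by
  unfold counitNat
  rw [NatTrans.comp_app, NatTrans.comp_app, eqToHom_app, eqToHom_app, eqToHom_comp_heq_iff,
    comp_eqToHom_heq_iff]
  rfl

/-- The triangle at `w` is the triangle of `c` with `w` stacked on top, since stacking on the top
commutes strictly with stacking on the bottom. -/
theorem triangle (w : QDiag l j) :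
    (bot c).map ((D.unitNat l).app w) ≫ (D.counitNat l).app ((bot c).obj w) =
      𝟙 ((bot c).obj w) := by
  have h1 : (bot c).map ((D.unitNat l).app w) ≍ (top w).map D.left := by
    refine (map_heq_map (bot c) (bot_one_obj w).symm (bot_bot_obj w c D.dual)
      (D.unitNat_app w)).trans ?_
    refine (Functor.hcongr_hom (top_bot w c) D.unit).trans ?_
    exact map_heq_map (top w) (one_bot c) D.obj_eq D.left_heq
  have e : (top c).obj ((bot c).obj D.dual) = D.mid :=
    (bot_bot_obj c D.dual c).symm.trans D.obj_eq
  have h2 : (D.counitNat l).app ((bot c).obj w) ≍ (top w).map D.right := by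
    refine (D.counitNat_app _).trans ?_
    refine (Functor.hcongr_hom (top_comp w c).symm D.counit).trans ?_
    exact map_heq_map (top w) e (bot_one_obj c) D.right_heq
  have h3 : (bot c).obj ((bot c ⋙ bot D.dual).obj w) = (top w).obj D.mid :=
    (congrArg (bot c).obj (bot_bot_obj w c D.dual)).trans
      ((Functor.congr_obj (top_bot w c) _).trans (congrArg (top w).obj D.obj_eq))
  refine eq_of_heq ((comp_heq_comp rfl h3 rfl h1 h2).trans ?_)
  rw [← CategoryTheory.Functor.map_comp, D.left_right, CategoryTheory.Functor.map_id]
  rfl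

theorem contractible_homFrom {ι : Type*} {s : ComplexShape ι}
    {G : HomologicalComplex (BN l n) s} (w : QDiag l j)
    (h : Contractible (homFrom ((Mat_.embedding _).obj w)
      (((bot D.dual).mapMat_.mapHomologicalComplex s).obj G))) :
    Contractible (homFrom ((Mat_.embedding _).obj ((bot c).obj w)) G) := by
  refine contractible_homFrom_of_triangle (bot c).mapMat_ (bot D.dual).mapMat_
    (mapMatNat (D.unitNat l)) (mapMatNat (D.counitNat l)) ((Mat_.embedding _).obj w) ?_ h
  have h1 : (bot c).mapMat_.map ((mapMatNat (D.unitNat l)).app ((Mat_.embedding _).obj w)) =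
      (Mat_.embedding _).map ((bot c).map ((D.unitNat l).app w)) :=
    congrArg (bot c).mapMat_.map (mapMatNat_app_embedding (D.unitNat l) w)
  have h2 := mapMatNat_app_embedding (D.counitNat l) ((bot c).obj w)
  refine (congrArg₂ (· ≫ ·) h1 h2).trans ?_
  refine ((Mat_.embedding _).map_comp _ _).symm.trans ?_
  exact (congrArg (Mat_.embedding _).map (D.triangle w)).trans ((Mat_.embedding _).map_id _)

end HasDual

open Local in
/-- The dual of a cap is a cup. -/
def hasDualArc (k i : ℕ) (h : i ≤ k) : HasDual ⟨arc k i h, 0⟩ where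
  -- The shift 1 makes the birth, of degree -1, and the saddle, of degree 1, into maps of degree
  -- zero.
  dual := ⟨bowl k i h, 1⟩
  unit := ofMove (birth k i h) 0 (0 + 1) rfl
  counit := ofMove (a := (bowl k i h).stack (arc k i h))
    ⟨[], [], k + 2, .saddle i, rfl, show i + 2 ≤ k + 2 by omega, rfl, rfl⟩ (1 + 0) 0 rfl
  mid := ⟨circleArc k i h, 1⟩
  left := ofMove (birthArc k i h) 0 1 rfl
  right := ofMove (merge k i h) 1 0 rfl
  obj_eq := rfl
  left_heq := hom_heq rfl rfl ((heq_of_eq (Cob.stackBot_move (arc k i h) (birth k i h))).trans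
    (Cob.move_heq rfl rfl _ _ rfl rfl rfl rfl))
  right_heq := hom_heq rfl rfl ((heq_of_eq (Cob.stackTop_move (arc k i h) _)).trans
    (Cob.move_heq rfl rfl _ _ rfl rfl rfl rfl))
  left_right := hom_ext (Cob.birthArc_merge k i h)

open Local in
/-- The dual of a cup is a cap. -/
def hasDualBowl (k i : ℕ) (h : i ≤ k) : HasDual ⟨bowl k i h, 0⟩ where
  -- Unit and counit are now a saddle of degree 1 and a death of degree -1, whence the opposite
  -- shift.
  dual := ⟨arc k i h, -1⟩
  unit := ofMove (b := (bowl k i h).stack (arc k i h))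
    ⟨[], [], k + 2, .cosaddle i, rfl, show i + 2 ≤ k + 2 by omega, rfl, rfl⟩ 0 (0 + -1) rfl
  counit := ofMove (death k i h) (-1 + 0) 0 rfl
  mid := ⟨bowlCircle k i h, -1⟩
  left := ofMove (splitBowl k i h) 0 (-1) rfl
  right := ofMove (deathBowl k i h) (-1) 0 rfl
  obj_eq := rfl
  left_heq := hom_heq rfl rfl ((heq_of_eq (Cob.stackBot_move (bowl k i h) _)).trans
    (Cob.move_heq rfl rfl _ _ rfl rfl rfl rfl))
  right_heq := hom_heq rfl rfl ((heq_of_eq (Cob.stackTop_move (bowl k i h) (death k i h))).trans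
    (Cob.move_heq rfl rfl _ _ rfl rfl rfl rfl))
  left_right := hom_ext (Cob.splitBowl_deathBowl k i h)

end QDiag

/-! ### Maps out of diagrams that factor through few points -/

section HomClaim

variable {l j n : ℕ} {ι : Type*} {s : ComplexShape ι}

theorem Killed.of_stack {m : ℕ} {K : HomologicalComplex (BN l m) s} {y : QDiag m n} {k : ℕ}
    {z : QDiag n k} (h : Killed K ((QDiag.bot z).obj y)) :
    Killed (((QDiag.bot y).mapMat_.mapHomologicalComplex s).obj K) z := by
  have e := QDiag.bot_comp (k := l) y z
  have h' : Contractible (((QDiag.bot y ⋙ QDiag.bot z).mapMat_.mapHomologicalComplex s).obj K) := by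
    simp only [e]
    exact h
  exact h'

/-- If `G` is killed by all diagrams with `j` end points on the bottom, then there are no maps
from diagrams which factor through `j` points to `G`, up to homotopy. -/
theorem contractible_homFrom_stack (G : HomologicalComplex (BN l n) s)
    (hG : ∀ t : Diag n j, Killed G ⟨t, 0⟩) (x : QDiag l j) (y : Diag j n) :
    Contractible (homFrom ((Mat_.embedding _).obj ((QDiag.bot ⟨y, 0⟩).obj x)) G) := by
  obtain ⟨w, hw⟩ := y
  -- The lowest piece of `y` is moved to the other side by duality: `G` becomes `G ⊗ dual`, which is
  -- again killed by all `t`, because `G` is killed by `dual ⊗ t`. Once `y` is exhausted, `G = G ⊗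
  -- 1` is itself contractible.
  induction w using List.reverseRecOn generalizing n with
  | nil =>
    obtain rfl : j = n := hw
    have h := hG (Diag.one j)
    unfold Killed at h
    simp only [QDiag.bot_one] at h
    exact Contractible.homFrom (G := G) h _
  | append_singleton w c ih =>
    obtain ⟨k, hw', hc⟩ := hw.exists_of_append
    have key : ∀ (C : Diag k n) (hC : C.word = [c]) (D : (⟨C, 0⟩ : QDiag k n).HasDual),
        Contractible (homFrom ((Mat_.embedding _).obj ((QDiag.bot ⟨⟨w ++ [c], hw⟩, 0⟩).obj x))
          G) := by
      intro C hC D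
      have h := D.contractible_homFrom ((QDiag.bot ⟨⟨w, hw'⟩, 0⟩).obj x) (G := G)
        (ih _ (fun t => Killed.of_stack ((hG (D.dual.diag.stack t)).of_diag_eq rfl _)) hw')
      have e : (QDiag.bot ⟨C, 0⟩).obj ((QDiag.bot ⟨⟨w, hw'⟩, 0⟩).obj x) =
          (QDiag.bot ⟨⟨w ++ [c], hw⟩, 0⟩).obj x := by
        refine QDiag.ext (Diag.ext ?_) ?_
        · change (x.diag.word ++ w) ++ C.word = x.diag.word ++ (w ++ [c])
          rw [hC, List.append_assoc]
        · exact add_zero _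
      rwa [e] at h
    cases c with
    | cap i =>
      obtain ⟨hi, hn⟩ := hc
      obtain rfl : k + 2 = n := hn
      exact key _ rfl (QDiag.hasDualArc k i hi)
    | cup i =>
      obtain ⟨hi, hn⟩ := hc
      obtain rfl : k = n + 2 := by
        have : k - 2 = n := hn
        omega
      exact key _ rfl (QDiag.hasDualBowl n i (by omega))

end HomClaim

/-! ### Planar compositions of complexes -/

section Stack

variable {k l m n n' : ℕ}

/-- `M` is a finite sum of diagrams, and stacking a diagram on top of the contractible complex `B ⊗
t` keeps it contractible. -/
theorem contractible_stack_obj_of_killed {B : ChNonpos l m} (M : BN k l) {t : QDiag m n}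
    (h : Killed B t) : Contractible
      (((BN.stack.obj M ⋙ (QDiag.bot t).mapMat_).mapHomologicalComplex _).obj B) := by
  refine contractible_map_of_sum (Finset.univ : Finset M.ι) _
    (fun i => BN.stack.obj ((Mat_.embedding _).obj (M.X i)) ⋙ (QDiag.bot t).mapMat_)
    (fun i => Functor.whiskerRight (BN.stack.map (matProj M i)) (QDiag.bot t).mapMat_)
    (fun i => Functor.whiskerRight (BN.stack.map (matInc M i)) (QDiag.bot t).mapMat_)
    (fun N => ?_) (fun i _ => ?_)
  · simp only [Functor.whiskerRight_app, ← CategoryTheory.Functor.map_comp, ← NatTrans.comp_app]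
    rw [← CategoryTheory.Functor.map_sum, ← NatTrans.app_sum, ← CategoryTheory.Functor.map_sum,
      sum_matProj_inc, CategoryTheory.Functor.map_id, NatTrans.id_app,
      CategoryTheory.Functor.map_id]
    rfl
  · refine contractible_map_of_iso
      (Functor.isoWhiskerRight (mapMat₂ObjIso QDiag.stack (M.X i)) (QDiag.bot t).mapMat_) ?_
    have h' : Contractible
        (((QDiag.bot t ⋙ QDiag.top (M.X i)).mapMat_.mapHomologicalComplex _).obj B) :=
      Contractible.map h (QDiag.top (M.X i)).mapMat_
    simp only [← QDiag.top_bot] at h'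
    exact h'

/-- `N` is a finite sum of diagrams `y`, and `A ⊗ y ⊗ t` is contractible because `A` is killed by `y
⊗ t`. -/
theorem contractible_stack_flip_obj_of_killed {A : ChNonpos k l} (N : BN l m) {t : QDiag m n}
    (h : ∀ y : QDiag l m, Killed A ((QDiag.bot t).obj y)) : Contractible
      (((BN.stack.flip.obj N ⋙ (QDiag.bot t).mapMat_).mapHomologicalComplex _).obj A) := by
  refine contractible_map_of_sum (Finset.univ : Finset N.ι) _
    (fun i => BN.stack.flip.obj ((Mat_.embedding _).obj (N.X i)) ⋙ (QDiag.bot t).mapMat_)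
    (fun i => Functor.whiskerRight (BN.stack.flip.map (matProj N i)) (QDiag.bot t).mapMat_)
    (fun i => Functor.whiskerRight (BN.stack.flip.map (matInc N i)) (QDiag.bot t).mapMat_)
    (fun M => ?_) (fun i _ => ?_)
  · have h1 : ∑ i, (BN.stack.obj M).map (matProj N i) ≫ (BN.stack.obj M).map (matInc N i) =
        𝟙 ((BN.stack.obj M).obj N) := by
      simp only [← CategoryTheory.Functor.map_comp]
      rw [← CategoryTheory.Functor.map_sum, sum_matProj_inc, CategoryTheory.Functor.map_id]
    have h2 := congrArg (QDiag.bot t).mapMat_.map h1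
    rw [CategoryTheory.Functor.map_sum, CategoryTheory.Functor.map_id] at h2
    simp only [CategoryTheory.Functor.map_comp] at h2
    exact h2
  · refine contractible_map_of_iso
      (Functor.isoWhiskerRight (mapMat₂FlipObjIso QDiag.stack (N.X i)) (QDiag.bot t).mapMat_) ?_
    have h' := h (N.X i)
    unfold Killed at h'
    simp only [← QDiag.bot_comp] at h'
    exact h'

theorem Killed.stack_right {B : ChNonpos l m} {t : QDiag m n} (h : Killed B t)
    (A : ChNonpos k l) : Killed (A.stack B) t :=
  contractible_map_total_of_columns BN.stack A B (QDiag.bot t).mapMat_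
    (fun p => contractible_stack_obj_of_killed (A.X p) h)

theorem killed_stack {A : ChNonpos k l} (B : ChNonpos l m) {t : QDiag m n}
    (h : ∀ y : QDiag l m, Killed A ((QDiag.bot t).obj y)) : Killed (A.stack B) t :=
  contractible_map_total_of_rows BN.stack A B (QDiag.bot t).mapMat_
    (fun q => contractible_stack_flip_obj_of_killed (B.X q) h)

theorem IsUniversalProjector.killed {P : ChNonpos m m} (hP : IsUniversalProjector P) (hn : n < m)
    (y : QDiag m n) : Killed P y :=
  (killed_of_turnbacks (fun p h => contractible_map_of_iso
    (G := BN.stack.flip.obj (BN.of (Diag.cupTurn m p h)))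
    (mapMat₂FlipObjIso QDiag.stack ⟨Diag.cupTurn m p h, 0⟩).symm (hP.below p h)) hn
      y.diag).of_diag_eq rfl y.shift

theorem Killed.toCochain {A : ChNonpos k m} {t : QDiag m n} (h : Killed A t) :
    Killed A.toCochain t :=
  Contractible.map_extend ComplexShape.embeddingDownNat (QDiag.bot t).mapMat_ h

theorem Killed.of_qShift {ι : Type*} {c : ComplexShape ι} {K : HomologicalComplex (BN k m) c}
    {s : ℤ} {t : QDiag m n} (h : Killed K ((QDiag.qShift s).obj t)) :
    Killed (((BN.qShift s).mapHomologicalComplex c).obj K) t := by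
  unfold Killed at h
  simp only [← QDiag.qShift_bot] at h
  exact h

theorem contractible_homFrom_of_entries {ι : Type*} {c : ComplexShape ι}
    {G : HomologicalComplex (BN m n) c} (M : BN m n)
    (h : ∀ i, Contractible (homFrom ((Mat_.embedding _).obj (M.X i)) G)) :
    Contractible (homFrom M G) :=
  contractible_homFrom_of_sum (Finset.univ : Finset M.ι) _ (matProj M) (matInc M)
    (sum_matProj_inc M) (fun i _ => h i)

/-- A chain object of `A ⊗ B` is a finite sum of diagrams that factor through the `m` points between
`A` and `B`, so duality applies to each of them. -/
theorem contractible_homFrom_toCochain_stack {ι : Type*} {c : ComplexShape ι}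
    {G : HomologicalComplex (BN k n) c} (A : ChNonpos k m) (B : ChNonpos m n)
    (hG : ∀ t : Diag n m, Killed G ⟨t, 0⟩) (p : ℤ) :
    Contractible (homFrom ((A.stack B).toCochain.X p) G) := by
  by_cases hp : ∃ q, ComplexShape.embeddingDownNat.f q = p
  · obtain ⟨q, hq⟩ := hp
    let e : (A.stack B).toCochain.X p ≅ (A.stack B).X q :=
      HomologicalComplex.extendXIso _ ComplexShape.embeddingDownNat hq
    refine contractible_homFrom_of_sum (Finset.univ : Finset Unit) _ (fun _ => e.hom)
      (fun _ => e.inv) (by simp) (fun _ _ => ?_)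
    refine contractible_homFrom_of_sum _ _ _ _ (sum_totalProj_inc BN.stack A B q)
      (fun x _ => contractible_homFrom_of_entries _ (fun i => ?_))
    -- The lower diagram has to be unshifted there, so its `q`-shift is moved to the upper one.
    have h := contractible_homFrom_stack G hG
      ((QDiag.qShift ((B.X x.1.2).X i.2).shift).obj ((A.X x.1.1).X i.1)) ((B.X x.1.2).X i.2).diag
    rw [show (QDiag.bot ⟨((B.X x.1.2).X i.2).diag, 0⟩).obj
        ((QDiag.qShift ((B.X x.1.2).X i.2).shift).obj ((A.X x.1.1).X i.1)) =
        (QDiag.stack.obj ((A.X x.1.1).X i.1)).obj ((B.X x.1.2).X i.2) from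
      QDiag.ext rfl (add_zero _)] at h
    exact h
  -- In degrees outside the extended complex the object is zero: its identity is the empty sum.
  · refine contractible_homFrom_of_sum (∅ : Finset Unit) (fun _ => (A.stack B).toCochain.X p)
      (fun _ => 𝟙 _) (fun _ => 𝟙 _) ?_ (by simp)
    exact (HomologicalComplex.isZero_extend_X _ _ _ (fun i hi => hp ⟨i, hi⟩)).eq_of_src _ _

end Stack

end BarNatan

end


/-! ### The proposition -/

theorem mainTheorem9 (P : ∀ n : ℕ, BarNatan.ChNonpos n n)
    (hP : ∀ n : ℕ, BarNatan.IsUniversalProjector (P n)) (a b c d i j : ℕ)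
    (hi : BarNatan.Admissible a b i) (hi' : BarNatan.Admissible c d i)
    (hj : BarNatan.Admissible a b j) (hj' : BarNatan.Admissible c d j) (hji : j < i) (l : ℤ) :
    BarNatan.Contractible (BarNatan.homComplex (BarNatan.iNetwork P hj hj').toCochain
      (BarNatan.iNetwork P hi hi').toCochain l) := by
  refine BarNatan.contractible_homComplex _ _ (fun p hp => ?_) (fun p => ?_)
  · refine HomologicalComplex.isZero_extend_X _ _ _ (fun q hq => ?_)
    have : -(q : ℤ) = p := hq
    omega
  · refine BarNatan.contractible_homFrom_toCochain_stack _ _ (fun t => ?_) p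
    -- With `y` a diagram of the lower part of I_i and `t` stacked below it, P_i meets a diagram
    -- from `i` to `j` points. As `j < i`, P_i kills it, and P_a and P_b on top do no harm.
    exact BarNatan.Killed.of_qShift (BarNatan.Killed.toCochain (BarNatan.killed_stack _
      (fun y => BarNatan.Killed.stack_right ((hP i).killed hji _) _)))
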